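/- All functions of $z$ below are taken on the Riemann surface of the logarithm: $z$ is given by $|z|>0$ and $\arg z\in\mathbb R$, $z^{\mu}=e^{\mu(\log|z|+i\arg z)}$, and $|z|$ also denotes the point with argument $0$. Let $K_\nu$ be the modified Bessel function, $a_n(\nu)=\frac{(4\nu^2-1^2)(4\nu^2-3^2)\cdots(4\nu^2-(2n-1)^2)}{8^n\,n!}$ for $n\ge 0$ (empty product $1$; empty sums are $0$), and define $R_N^{(K)}(z,\nu)$ for integers $N\ge 0$ by $$K_\nu(z)=\Big(\frac{\pi}{2z}\Big)^{1/2}e^{-z}\Big(\sum_{n=0}^{N-1}\frac{a_n(\nu)}{z^n}+R_N^{(K)}(z,\nu)\Big).$$ Let $R_N^{(J)}(z,\nu)$ be the remainders in $$J_\nu(z)=\Big(\frac{2}{\pi z}\Big)^{1/2}\Big(\cos\omega\Big(\sum_{n=0}^{N-1}(-1)^n\frac{a_{2n}(\nu)}{z^{2n}}+R_{2N}^{(J)}(z,\nu)\Big)-\sin\omega\Big(\sum_{m=0}^{M-1}(-1)^m\frac{a_{2m+1}(\nu)}{z^{2m+1}}-R_{2M+1}^{(J)}(z,\nu)\Big)\Big),\qquad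 \omega=z-\tfrac{\pi}{2}\nu-\tfrac{\pi}{4},$$ that is, $2R_{2N}^{(J)}(z,\nu)=R_{2N}^{(K)}(ze^{\frac{\pi}{2}i},\nu)+R_{2N}^{(K)}(ze^{-\frac{\pi}{2}i},\nu)$ and $2iR_{2M+1}^{(J)}(z,\nu)=R_{2M+1}^{(K)}(ze^{\frac{\pi}{2}i},\nu)-R_{2M+1}^{(K)}(ze^{-\frac{\pi}{2}i},\nu)$. Let $\Lambda_p(w)=w^pe^w\Gamma(1-p,w)$, with $\Gamma(\cdot,\cdot)$ the (upper) incomplete gamma function, and $\Pi_p(w)=\frac12\big(\Lambda_p(we^{\frac{\pi}{2}i})+\Lambda_p(we^{-\frac{\pi}{2}i})\big)$. For integers $0\le M<N$ define $R_{N,M}^{(K)}$ and $R_{N,M}^{(J)}$ by $$R_N^{(K)}(z,\nu)=(-1)^N\frac{\cos(\pi\nu)}{2^N\pi}\frac1{z^N}\sum_{m=0}^{M-1}2^m a_m(\nu)\Gamma(N-m)\Lambda_{N-m}(2z)+R_{N,M}^{(K)}(z,\nu),$$ $$R_N^{(J)}(z,\nu)=(-1)^{\lfloor N/2\rfloor}\frac{\cos(\pi\nu)}{2^N\pi}\frac1{z^N}\sum_{m=0}^{M-1}2^m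 a_m(\nu)\Gamma(N-m)\Pi_{N-m}(2z)+R_{N,M}^{(J)}(z,\nu).$$ **Theorem.** Let $N$ and $M$ be non-negative integers with $M<N$, and let $\nu$ be a complex number with $|\Re(\nu)|<M+\frac12$. Then $$\big|R_{N,M}^{(K)}(z,\nu)\big|\le\frac{|\cos(\pi\nu)|}{2^N\pi}\frac{1}{|z|^N}2^M|z|^M\big|R_M^{(K)}(|z|,\nu)\big|\,\Gamma(N-M)\,|\Lambda_{N-M}(2z)|+\frac{|\cos(\pi\nu)|}{2^N\pi}\frac{1}{|z|^N}2^M\frac{|\cos(\pi\nu)|}{|\cos(\pi\Re(\nu))|}|a_M(\Re(\nu))|\,\Gamma(N-M)$$ for $|\arg z|\le\pi$, and $$\big|R_{N,M}^{(J)}(z,\nu)\big|\le\frac{|\cos(\pi\nu)|}{2^N\pi}\frac{1}{|z|^N}2^M|z|^M\big|R_M^{(K)}(|z|,\nu)\big|\,\Gamma(N-M)\,|\Pi_{N-M}(2z)|+\frac{|\cos(\pi\nu)|}{2^N\pi}\frac{1}{|z|^N}2^M\frac{|\cos(\pi\nu)|}{|\cos(\pi\Re(\nu))|}|a_M(\Re(\nu))|\,\Gamma(N-M)$$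 for $|\arg z|\le\frac{\pi}{2}$. If $2\Re(\nu)$ is an odd integer, the quotient $|a_M(\Re(\nu))|/|\cos(\pi\Re(\nu))|$ in these bounds is replaced by its limiting value $\lim_{x\to\Re(\nu)}|a_M(x)|/|\cos(\pi x)|$, which exists. -/

import Mathlib

open Filter Topology

/-!
Multivalued functions of a nonzero complex variable `z` are functions of a point of the Riemann
surface of the logarithm.  Such a point is given here by its logarithm
`ζ = log |z| + i arg z`, an arbitrary complex number.  Thus `z = exp ζ`, `|z| = exp (Re ζ)`,
`arg z = Im ζ`, the positive number `|z|` is the point `Re ζ`, the point `2 z` is `ζ + log 2`,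
the point `z e ^ (i α)` is `ζ + i α`, and `z ^ μ = exp (μ ζ)`.
-/

/-- The modified Bessel function `I_ν(z) = ∑ (z/2)^(ν+2k) / (k! Γ(ν+k+1))` at `z = exp ζ`
(at a pole of `Γ` Mathlib has `Γ = 0`, so `1 / Γ = 0` as it should be). -/
noncomputable def modBesselI (ν ζ : ℂ) : ℂ :=
  ∑' k : ℕ, Complex.exp ((ν + 2 * k) * (ζ - Real.log 2)) /
    ((k.factorial : ℂ) * Complex.Gamma (ν + k + 1))

/-- The Bessel function `J_ν(z) = ∑ (-1)^k (z/2)^(ν+2k) / (k! Γ(ν+k+1))` at `z = exp ζ`. -/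
noncomputable def besselJ (ν ζ : ℂ) : ℂ :=
  ∑' k : ℕ, (-1 : ℂ) ^ k * Complex.exp ((ν + 2 * k) * (ζ - Real.log 2)) /
    ((k.factorial : ℂ) * Complex.Gamma (ν + k + 1))

/-- The modified Bessel function
`K_ν(z) = (π / 2) (I_{-ν}(z) - I_ν(z)) / sin (π ν)` at `z = exp ζ`; the limiting value is taken
when `ν` is an integer, and for other `ν` the limit is the value itself. -/
noncomputable def modBesselK (ν ζ : ℂ) : ℂ :=
  limUnder (𝓝[≠] ν) fun μ : ℂ =>
    (Real.pi / 2 : ℂ) * (modBesselI (-μ) ζ - modBesselI μ ζ) / Complex.sin (Real.pi * μ)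

/-- `a_n(ν) = (4ν² - 1²)(4ν² - 3²) ⋯ (4ν² - (2n-1)²) / (8^n n!)`. -/
noncomputable def hankelCoeff (n : ℕ) (ν : ℂ) : ℂ :=
  (∏ k ∈ Finset.range n, (4 * ν ^ 2 - (2 * (k : ℂ) + 1) ^ 2)) / (8 ^ n * (n.factorial : ℂ))

/-- The remainder `R_N^{(K)}(z, ν)` at `z = exp ζ`, defined by
`K_ν(z) = (π / (2z))^(1/2) e^(-z) (∑_{n<N} a_n(ν) / z^n + R_N^{(K)}(z, ν))`. -/
noncomputable def remK (N : ℕ) (ζ ν : ℂ) : ℂ :=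
  modBesselK ν ζ /
      ((Real.sqrt (Real.pi / 2) : ℂ) * Complex.exp (-ζ / 2) * Complex.exp (-Complex.exp ζ)) -
    ∑ n ∈ Finset.range N, hankelCoeff n ν / Complex.exp ζ ^ n

/-- The remainder `R_N^{(J)}(z, ν)` at `z = exp ζ`:
`2 R_N^{(J)}(z) = R_N^{(K)}(z e^{πi/2}) + R_N^{(K)}(z e^{-πi/2})` for even `N`, and
`2 i R_N^{(J)}(z) = R_N^{(K)}(z e^{πi/2}) - R_N^{(K)}(z e^{-πi/2})` for odd `N`.
See `besselJ_eq_remJ` for the expansion of `J_ν` in which these are the remainders. -/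
noncomputable def remJ (N : ℕ) (ζ ν : ℂ) : ℂ :=
  if Even N then
    (remK N (ζ + Real.pi / 2 * Complex.I) ν + remK N (ζ - Real.pi / 2 * Complex.I) ν) / 2
  else
    (remK N (ζ + Real.pi / 2 * Complex.I) ν - remK N (ζ - Real.pi / 2 * Complex.I) ν) /
      (2 * Complex.I)

/-- The upper incomplete gamma function `Γ(a, w) = ∫_w^∞ t^(a-1) e^(-t) dt` at `w = exp ω`, on the
whole Riemann surface of the logarithm.  The path runs from `w` to `1` along `t = exp (x ω)`
(`x` from `1` to `0`), and from `1` to `∞` along the real axis. -/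
noncomputable def upperGamma (a ω : ℂ) : ℂ :=
  (∫ t in Set.Ioi (1 : ℝ), (t : ℂ) ^ (a - 1) * Complex.exp (-(t : ℂ))) -
    ∫ x in (0 : ℝ)..1, ω * Complex.exp (a * (x * ω) - Complex.exp (x * ω))

/-- The basic terminant `Λ_p(w) = w^p e^w Γ(1 - p, w)` at `w = exp ω`. -/
noncomputable def terminantL (p ω : ℂ) : ℂ :=
  Complex.exp (p * ω) * Complex.exp (Complex.exp ω) * upperGamma (1 - p) ω

/-- The basic terminant `Π_p(w) = (Λ_p(w e^{πi/2}) + Λ_p(w e^{-πi/2})) / 2` at `w = exp ω`. -/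
noncomputable def terminantP (p ω : ℂ) : ℂ :=
  (terminantL p (ω + Real.pi / 2 * Complex.I) + terminantL p (ω - Real.pi / 2 * Complex.I)) / 2

/-- The remainder `R_{N,M}^{(K)}(z, ν)` at `z = exp ζ`, defined by
`R_N^{(K)}(z, ν) = (-1)^N (cos πν / (2^N π)) z^(-N) ∑_{m<M} 2^m a_m(ν) Γ(N-m) Λ_{N-m}(2z)
  + R_{N,M}^{(K)}(z, ν)`. -/
noncomputable def reRemK (N M : ℕ) (ζ ν : ℂ) : ℂ :=
  remK N ζ ν -
    (-1) ^ N * (Complex.cos (Real.pi * ν) / (2 ^ N * Real.pi)) * (1 / Complex.exp ζ ^ N) *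
      ∑ m ∈ Finset.range M, 2 ^ m * hankelCoeff m ν * Complex.Gamma ((N : ℂ) - m) *
        terminantL ((N : ℂ) - m) (ζ + Real.log 2)

/-- The remainder `R_{N,M}^{(J)}(z, ν)` at `z = exp ζ`, defined by
`R_N^{(J)}(z, ν) = (-1)^⌊N/2⌋ (cos πν / (2^N π)) z^(-N) ∑_{m<M} 2^m a_m(ν) Γ(N-m) Π_{N-m}(2z)
  + R_{N,M}^{(J)}(z, ν)`. -/
noncomputable def reRemJ (N M : ℕ) (ζ ν : ℂ) : ℂ :=
  remJ N ζ ν -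
    (-1) ^ (N / 2) * (Complex.cos (Real.pi * ν) / (2 ^ N * Real.pi)) * (1 / Complex.exp ζ ^ N) *
      ∑ m ∈ Finset.range M, 2 ^ m * hankelCoeff m ν * Complex.Gamma ((N : ℂ) - m) *
        terminantP ((N : ℂ) - m) (ζ + Real.log 2)

/-- A bound for `1 / Γ(ν + k + 1)` that is uniform in `k` and in `ν` in a disc. -/
theorem exists_bound_inv_Gamma (R : ℝ) :
    ∃ B : ℝ, ∀ (k : ℕ) (ν : ℂ), ‖ν‖ ≤ R → ‖(Complex.Gamma (ν + k + 1))⁻¹‖ ≤ B := by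
  have h1 : ∀ k : ℕ, ∃ B : ℝ, ∀ ν : ℂ, ‖ν‖ ≤ R → ‖(Complex.Gamma (ν + k + 1))⁻¹‖ ≤ B := by
    intro k
    have hc : Continuous fun ν : ℂ => (Complex.Gamma (ν + k + 1))⁻¹ :=
      Complex.differentiable_one_div_Gamma.continuous.comp (by fun_prop)
    obtain ⟨B, hB⟩ := (isCompact_closedBall (0 : ℂ) R).exists_bound_of_continuousOn hc.continuousOn
    exact ⟨B, fun ν h => hB ν (by simpa using h)⟩
  choose b hb using h1
  obtain ⟨K, hK⟩ := exists_nat_ge (R + 1)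
  have h2 : ∀ k, K ≤ k → ∀ ν : ℂ, ‖ν‖ ≤ R → ‖(Complex.Gamma (ν + k + 1))⁻¹‖ ≤ b K := by
    intro k hk
    induction k, hk using Nat.le_induction with
    | base => exact hb K
    | succ n hn ih =>
      intro ν hν
      refine le_trans ?_ (ih ν hν)
      rw [Complex.one_div_Gamma_eq_self_mul_one_div_Gamma_add_one (ν + n + 1), norm_mul]
      have h3 : (1 : ℝ) ≤ ‖ν + n + 1‖ := by
        have h4 : ‖((n : ℂ) + 1)‖ ≤ ‖ν + n + 1‖ + ‖ν‖ := by
          have := norm_sub_le (ν + n + 1) ν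
          rwa [show ν + n + 1 - ν = (n : ℂ) + 1 by ring] at this
        have h5 : ‖((n : ℂ) + 1)‖ = (n : ℝ) + 1 := by
          exact_mod_cast Complex.norm_natCast (n + 1)
        have h6 : (K : ℝ) ≤ n := by exact_mod_cast hn
        linarith
      push_cast
      rw [show ν + ((n : ℂ) + 1) + 1 = ν + n + 1 + 1 by ring]
      exact le_mul_of_one_le_left (norm_nonneg _) h3
  refine ⟨∑ k ∈ Finset.range (K + 1), |b k|, fun k ν hν => ?_⟩
  rcases le_or_gt K k with hk | hk
  · refine (h2 k hk ν hν).trans ((le_abs_self _).trans ?_)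
    exact Finset.single_le_sum (f := fun k => |b k|) (fun _ _ => abs_nonneg _) (by simp)
  · refine (hb k ν hν).trans ((le_abs_self _).trans ?_)
    exact Finset.single_le_sum (f := fun k => |b k|) (fun _ _ => abs_nonneg _)
      (by simp; omega)

theorem modBesselI_term_bound (ζ : ℂ) (R : ℝ) :
    ∃ u : ℕ → ℝ, Summable u ∧ ∀ (k : ℕ) (ν : ℂ), ‖ν‖ ≤ R →
      ‖Complex.exp ((ν + 2 * k) * (ζ - Real.log 2)) /
        ((k.factorial : ℂ) * Complex.Gamma (ν + k + 1))‖ ≤ u k := by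
  obtain ⟨B, hB⟩ := exists_bound_inv_Gamma R
  set c : ℝ := ‖ζ - Real.log 2‖ with hc
  refine ⟨fun k => Real.exp (R * c) * B * (Real.exp (2 * c) ^ k / k.factorial),
    (Real.summable_pow_div_factorial _).mul_left _, fun k ν hν => ?_⟩
  rw [norm_div, norm_mul, Complex.norm_natCast, div_eq_mul_inv, mul_inv, ← norm_inv (Complex.Gamma _)]
  have h1 : ‖Complex.exp ((ν + 2 * k) * (ζ - Real.log 2))‖ ≤
      Real.exp (R * c) * Real.exp (2 * c) ^ k := by
    rw [← Real.exp_nat_mul, ← Real.exp_add]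
    refine (Complex.norm_exp_le_exp_norm _).trans (Real.exp_le_exp.mpr ?_)
    rw [norm_mul]
    have h2 : ‖ν + 2 * (k : ℂ)‖ ≤ R + 2 * k := by
      refine (norm_add_le _ _).trans (add_le_add hν ?_)
      simp
    nlinarith [norm_nonneg (ζ - Real.log 2)]
  calc _ ≤ (Real.exp (R * c) * Real.exp (2 * c) ^ k) * ((k.factorial : ℝ)⁻¹ * B) := by
        gcongr
        exact hB k ν hν
    _ = _ := by ring

theorem summable_modBesselI (ν ζ : ℂ) :
    Summable fun k : ℕ => Complex.exp ((ν + 2 * k) * (ζ - Real.log 2)) /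
      ((k.factorial : ℂ) * Complex.Gamma (ν + k + 1)) := by
  obtain ⟨u, hu, h⟩ := modBesselI_term_bound ζ ‖ν‖
  exact Summable.of_norm_bounded hu fun k => h k ν le_rfl

/-- `I_ν(z)` is an entire function of the order `ν`. -/
theorem differentiable_modBesselI (ζ : ℂ) : Differentiable ℂ fun ν => modBesselI ν ζ := by
  intro ν
  obtain ⟨u, hu, h⟩ := modBesselI_term_bound ζ (‖ν‖ + 1)
  have h1 : DifferentiableOn ℂ (fun ν => modBesselI ν ζ) (Metric.ball 0 (‖ν‖ + 1)) := by
    refine Complex.differentiableOn_tsum_of_summable_norm hu (fun k => ?_) Metric.isOpen_ball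
      (fun k w hw => h k w (by simpa using (Metric.mem_ball.mp hw).le))
    have h2 : Differentiable ℂ fun ν : ℂ => (Complex.Gamma (ν + k + 1))⁻¹ :=
      Complex.differentiable_one_div_Gamma.comp (by fun_prop)
    have h3 : Differentiable ℂ fun ν : ℂ => Complex.exp ((ν + 2 * k) * (ζ - Real.log 2)) *
        ((k.factorial : ℂ)⁻¹ * (Complex.Gamma (ν + k + 1))⁻¹) := by
      fun_prop
    simpa only [div_eq_mul_inv, mul_inv] using h3.differentiableOn
  exact h1.differentiableAt (Metric.isOpen_ball.mem_nhds (by simp))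

theorem modBesselI_neg_nat (n : ℕ) (ζ : ℂ) : modBesselI (-n) ζ = modBesselI n ζ := by
  have hs := summable_modBesselI (-n) ζ
  unfold modBesselI
  rw [← hs.sum_add_tsum_nat_add n, Finset.sum_eq_zero, zero_add]
  · refine tsum_congr fun k => ?_
    have h1 : (-(n : ℂ) + ((k + n : ℕ) : ℂ) + 1) = (k : ℂ) + 1 := by push_cast; ring
    have h2 : ((n : ℂ) + k + 1) = ((n + k : ℕ) : ℂ) + 1 := by push_cast; ring
    rw [h1, h2, Complex.Gamma_nat_eq_factorial, Complex.Gamma_nat_eq_factorial, add_comm k n,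
      mul_comm ((n + k).factorial : ℂ)]
    congr 2
    push_cast
    ring
  · intro k hk
    have hk' : k < n := Finset.mem_range.mp hk
    have h1 : (-(n : ℂ) + (k : ℂ) + 1) = -((n - k - 1 : ℕ) : ℂ) := by
      rw [Nat.sub_sub, Nat.cast_sub (by omega)]
      push_cast
      ring
    rw [h1, Complex.Gamma_neg_nat_eq_zero]
    simp

theorem modBesselI_neg_int (n : ℤ) (ζ : ℂ) : modBesselI (-n) ζ = modBesselI n ζ := by
  obtain ⟨m, rfl | rfl⟩ := n.eq_nat_or_neg
  · exact_mod_cast modBesselI_neg_nat m ζ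
  · have := modBesselI_neg_nat m ζ
    push_cast
    rw [neg_neg, this]

/-- The limit in the definition of `K_ν(z)` exists for every `ν`. -/
theorem tendsto_modBesselK (ν ζ : ℂ) :
    Tendsto (fun μ : ℂ =>
        (Real.pi / 2 : ℂ) * (modBesselI (-μ) ζ - modBesselI μ ζ) / Complex.sin (Real.pi * μ))
      (𝓝[≠] ν) (𝓝 (modBesselK ν ζ)) := by
  apply tendsto_nhds_limUnder
  have hI := differentiable_modBesselI ζ
  have hg : Differentiable ℂ fun μ : ℂ =>
      (Real.pi / 2 : ℂ) * (modBesselI (-μ) ζ - modBesselI μ ζ) :=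
    ((hI.comp differentiable_neg).sub hI).const_mul _
  have hsd : Differentiable ℂ fun μ : ℂ => Complex.sin (Real.pi * μ) := by fun_prop
  by_cases hs : Complex.sin (Real.pi * ν) = 0
  · obtain ⟨n, hn⟩ := Complex.sin_eq_zero_iff.mp hs
    have hpi : (Real.pi : ℂ) ≠ 0 := by exact_mod_cast Real.pi_ne_zero
    have hνn : ν = n := by
      rw [mul_comm] at hn
      exact mul_right_cancel₀ hpi hn
    have h0 : (Real.pi / 2 : ℂ) * (modBesselI (-ν) ζ - modBesselI ν ζ) = 0 := by
      rw [hνn, modBesselI_neg_int, sub_self, mul_zero]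
    have hd : HasDerivAt (fun μ : ℂ => Complex.sin (Real.pi * μ))
        (Complex.cos (Real.pi * ν) * Real.pi) ν := by
      have h1 : HasDerivAt (fun μ : ℂ => (Real.pi : ℂ) * μ) (Real.pi : ℂ) ν := by
        simpa using (hasDerivAt_id ν).const_mul (Real.pi : ℂ)
      exact h1.csin
    have hne : Complex.cos (Real.pi * ν) * Real.pi ≠ 0 := by
      refine mul_ne_zero (fun hc => ?_) hpi
      have := Complex.sin_sq_add_cos_sq (Real.pi * ν)
      rw [hs, hc] at this
      simp at this
    have t1 := (hg ν).hasDerivAt.tendsto_slope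
    have t2 := hd.tendsto_slope
    refine ⟨_, (t1.div t2 hne).congr' ?_⟩
    filter_upwards [self_mem_nhdsWithin] with μ hμ
    have hμ' : μ - ν ≠ 0 := sub_ne_zero.mpr hμ
    simp only [Pi.div_apply, slope_def_field, h0, hs, sub_zero]
    exact div_div_div_cancel_right₀ hμ' _ _
  · exact ⟨_, ((hg ν).continuousAt.div (hsd ν).continuousAt hs).continuousWithinAt.tendsto⟩

theorem modBesselI_add (ν ζ : ℂ) :
    modBesselI ν (ζ + Real.pi / 2 * Complex.I) =
      Complex.exp (Real.pi / 2 * ν * Complex.I) * besselJ ν ζ := by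
  unfold modBesselI besselJ
  rw [← tsum_mul_left]
  refine tsum_congr fun k => ?_
  have h : (-1 : ℂ) ^ k = Complex.exp (k * (Real.pi * Complex.I)) := by
    rw [Complex.exp_nat_mul, Complex.exp_pi_mul_I]
  rw [h, mul_div_assoc', ← mul_assoc, ← Complex.exp_add, ← Complex.exp_add]
  congr 2
  ring

theorem modBesselI_sub (ν ζ : ℂ) :
    modBesselI ν (ζ - Real.pi / 2 * Complex.I) =
      Complex.exp (-(Real.pi / 2 * ν * Complex.I)) * besselJ ν ζ := by
  unfold modBesselI besselJ
  rw [← tsum_mul_left]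
  refine tsum_congr fun k => ?_
  have h : (-1 : ℂ) ^ k = Complex.exp (-(k * (Real.pi * Complex.I))) := by
    rw [Complex.exp_neg, Complex.exp_nat_mul, Complex.exp_pi_mul_I, ← inv_pow]
    norm_num
  rw [h, mul_div_assoc', ← mul_assoc, ← Complex.exp_add, ← Complex.exp_add]
  congr 2
  ring

/-- The connection formula between `J_ν` and `K_ν`. -/
theorem besselJ_eq_modBesselK (ν ζ : ℂ) :
    Real.pi * Complex.I * besselJ ν ζ =
      Complex.exp (-(Real.pi / 2 * ν * Complex.I)) *
          modBesselK ν (ζ - Real.pi / 2 * Complex.I) -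
        Complex.exp (Real.pi / 2 * ν * Complex.I) *
          modBesselK ν (ζ + Real.pi / 2 * Complex.I) := by
  have hJ : Continuous fun μ => besselJ μ ζ := by
    have h1 : (fun μ => besselJ μ ζ) = fun μ =>
        Complex.exp (-(Real.pi / 2 * μ * Complex.I)) *
          modBesselI μ (ζ + Real.pi / 2 * Complex.I) := by
      funext μ
      rw [modBesselI_add, ← mul_assoc, ← Complex.exp_add, neg_add_cancel, Complex.exp_zero, one_mul]
    rw [h1]
    have := (differentiable_modBesselI (ζ + Real.pi / 2 * Complex.I)).continuous
    fun_prop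
  have e1 : Continuous fun μ : ℂ => Complex.exp (-(Real.pi / 2 * μ * Complex.I)) := by fun_prop
  have e2 : Continuous fun μ : ℂ => Complex.exp (Real.pi / 2 * μ * Complex.I) := by fun_prop
  have t1 := ((e1.tendsto ν).mono_left nhdsWithin_le_nhds).mul
    (tendsto_modBesselK ν (ζ - Real.pi / 2 * Complex.I))
  have t2 := ((e2.tendsto ν).mono_left nhdsWithin_le_nhds).mul
    (tendsto_modBesselK ν (ζ + Real.pi / 2 * Complex.I))
  have t3 : Tendsto (fun μ => Real.pi * Complex.I * besselJ μ ζ) (𝓝[≠] ν)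
      (𝓝 (Real.pi * Complex.I * besselJ ν ζ)) :=
    ((hJ.const_mul _).tendsto ν).mono_left nhdsWithin_le_nhds
  refine tendsto_nhds_unique (t3.congr' ?_) (t1.sub t2)
  have hpi : (Real.pi : ℂ) ≠ 0 := by exact_mod_cast Real.pi_ne_zero
  have hd : Differentiable ℂ fun μ : ℂ => Complex.sin (Real.pi * μ) := by fun_prop
  have han : AnalyticOnNhd ℂ (fun μ : ℂ => Complex.sin (Real.pi * μ)) Set.univ :=
    fun x _ => hd.analyticAt x
  have hev : ∀ᶠ μ in 𝓝[≠] ν, Complex.sin (Real.pi * μ) ≠ 0 := by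
    rcases (hd.analyticAt ν).eventually_eq_zero_or_eventually_ne_zero with h | h
    · exfalso
      have h1 := han.eqOn_zero_of_preconnected_of_eventuallyEq_zero isPreconnected_univ
        (Set.mem_univ ν) h (Set.mem_univ (1 / 2 : ℂ))
      simp only [Pi.zero_apply] at h1
      rw [show (Real.pi : ℂ) * (1 / 2) = Real.pi / 2 by ring, Complex.sin_pi_div_two] at h1
      exact one_ne_zero h1
    · exact h
  filter_upwards [hev] with μ hμ
  rw [modBesselI_add, modBesselI_add, modBesselI_sub, modBesselI_sub]
  set E := Complex.exp (Real.pi / 2 * μ * Complex.I) with hE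
  have hE0 : E ≠ 0 := Complex.exp_ne_zero _
  have hEi : Complex.exp (-(Real.pi / 2 * μ * Complex.I)) = E⁻¹ := by rw [Complex.exp_neg]
  have hEn : Complex.exp (Real.pi / 2 * -μ * Complex.I) = E⁻¹ := by
    rw [← hEi]; congr 1; ring
  have hEnn : Complex.exp (-(Real.pi / 2 * -μ * Complex.I)) = E := by
    rw [hE]; congr 1; ring
  have hsin : 2 * Complex.I * Complex.sin (Real.pi * μ) = E ^ 2 - (E⁻¹) ^ 2 := by
    rw [← hEi, hE, ← Complex.exp_nat_mul, ← Complex.exp_nat_mul, Complex.sin]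
    rw [show ((2 : ℕ) : ℂ) * (Real.pi / 2 * μ * Complex.I) = Real.pi * μ * Complex.I by
      push_cast; ring,
      show ((2 : ℕ) : ℂ) * -(Real.pi / 2 * μ * Complex.I) = -(Real.pi * μ) * Complex.I by
      push_cast; ring]
    linear_combination (Complex.exp (-(Real.pi * μ) * Complex.I) -
      Complex.exp (Real.pi * μ * Complex.I)) * Complex.I_mul_I
  rw [hEi, hEn, hEnn]
  have hEE : E * E⁻¹ = 1 := mul_inv_cancel₀ hE0
  rw [mul_div_assoc', mul_div_assoc', ← sub_div, eq_div_iff hμ]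
  linear_combination (Real.pi / 2 * besselJ μ ζ) * hsin

/-- `R_N^{(J)}` are the remainders in the expansion of `J_ν(z)` in terms of `cos ω` and `sin ω`,
`ω = z - πν/2 - π/4`. -/
theorem besselJ_eq_remJ (N M : ℕ) (ζ ν ω : ℂ)
    (hω : ω = Complex.exp ζ - Real.pi / 2 * ν - Real.pi / 4) :
    besselJ ν ζ = (Real.sqrt (2 / Real.pi) : ℂ) * Complex.exp (-ζ / 2) *
      (Complex.cos ω * (∑ n ∈ Finset.range N,
          (-1) ^ n * hankelCoeff (2 * n) ν / Complex.exp ζ ^ (2 * n) + remJ (2 * N) ζ ν) -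
        Complex.sin ω * (∑ m ∈ Finset.range M,
          (-1) ^ m * hankelCoeff (2 * m + 1) ν / Complex.exp ζ ^ (2 * m + 1) -
            remJ (2 * M + 1) ζ ν)) := by
  set z := Complex.exp ζ with hz
  have hz0 : z ≠ 0 := Complex.exp_ne_zero _
  have hexp1 : Complex.exp (ζ + Real.pi / 2 * Complex.I) = z * Complex.I := by
    rw [Complex.exp_add, Complex.exp_pi_div_two_mul_I]
  have hexp2 : Complex.exp (ζ - Real.pi / 2 * Complex.I) = z * -Complex.I := by
    rw [sub_eq_add_neg, Complex.exp_add, ← neg_mul, ← neg_div, Complex.exp_neg_pi_div_two_mul_I]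
  set P := modBesselK ν (ζ + Real.pi / 2 * Complex.I) /
    ((Real.sqrt (Real.pi / 2) : ℂ) * Complex.exp (-(ζ + Real.pi / 2 * Complex.I) / 2) *
      Complex.exp (-(z * Complex.I))) with hP
  set Q := modBesselK ν (ζ - Real.pi / 2 * Complex.I) /
    ((Real.sqrt (Real.pi / 2) : ℂ) * Complex.exp (-(ζ - Real.pi / 2 * Complex.I) / 2) *
      Complex.exp (-(z * -Complex.I))) with hQ
  have hA : ∀ N : ℕ, ∑ n ∈ Finset.range N,
      (-1) ^ n * hankelCoeff (2 * n) ν / z ^ (2 * n) + remJ (2 * N) ζ ν = (P + Q) / 2 := by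
    intro N
    have h1 : (∑ n ∈ Finset.range (2 * N), hankelCoeff n ν / (z * Complex.I) ^ n) +
        (∑ n ∈ Finset.range (2 * N), hankelCoeff n ν / (z * -Complex.I) ^ n) =
        2 * ∑ n ∈ Finset.range N, (-1) ^ n * hankelCoeff (2 * n) ν / z ^ (2 * n) := by
      induction N with
      | zero => simp
      | succ N ih =>
        have e1 : (z * Complex.I) ^ (2 * N) = (-1) ^ N * z ^ (2 * N) := by
          rw [mul_pow, pow_mul Complex.I, Complex.I_sq, mul_comm]
        have e2 : (z * -Complex.I) ^ (2 * N) = (-1) ^ N * z ^ (2 * N) := by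
          rw [mul_pow, pow_mul (-Complex.I), neg_sq, Complex.I_sq, mul_comm]
        have e3 : hankelCoeff (2 * N) ν / ((-1) ^ N * z ^ (2 * N)) =
            (-1) ^ N * hankelCoeff (2 * N) ν / z ^ (2 * N) := by
          rcases neg_one_pow_eq_or ℂ N with h | h <;> rw [h] <;> simp [neg_div, div_neg]
        have e4 : hankelCoeff (2 * N + 1) ν / (z * -Complex.I) ^ (2 * N + 1) =
            -(hankelCoeff (2 * N + 1) ν / (z * Complex.I) ^ (2 * N + 1)) := by
          rw [mul_neg, Odd.neg_pow (odd_two_mul_add_one N), div_neg]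
        rw [show 2 * (N + 1) = 2 * N + 1 + 1 by ring]
        simp only [Finset.sum_range_succ, e4, e1, e2, e3]
        linear_combination ih
    rw [remJ, if_pos (even_two_mul N), remK, remK, hexp1, hexp2, ← hP, ← hQ]
    linear_combination (-1 / 2) * h1
  have hB : ∀ M : ℕ, ∑ m ∈ Finset.range M,
      (-1) ^ m * hankelCoeff (2 * m + 1) ν / z ^ (2 * m + 1) - remJ (2 * M + 1) ζ ν =
        -((P - Q) / (2 * Complex.I)) := by
    intro M
    have h1 : (∑ n ∈ Finset.range (2 * M + 1), hankelCoeff n ν / (z * Complex.I) ^ n) -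
        (∑ n ∈ Finset.range (2 * M + 1), hankelCoeff n ν / (z * -Complex.I) ^ n) =
        -(2 * Complex.I) * ∑ m ∈ Finset.range M,
          (-1) ^ m * hankelCoeff (2 * m + 1) ν / z ^ (2 * m + 1) := by
      induction M with
      | zero => simp
      | succ M ih =>
        have e1 : (z * Complex.I) ^ (2 * M + 1 + 1) = (z * -Complex.I) ^ (2 * M + 1 + 1) := by
          rw [mul_neg, Even.neg_pow (by rw [add_assoc]; simp [parity_simps])]
        have e2 : (z * Complex.I) ^ (2 * M + 1) = (-1) ^ M * z ^ (2 * M + 1) * Complex.I := by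
          rw [mul_pow, pow_succ Complex.I, pow_mul Complex.I, Complex.I_sq]
          ring
        have e3 : hankelCoeff (2 * M + 1) ν / (z * Complex.I) ^ (2 * M + 1) =
            -Complex.I * ((-1) ^ M * hankelCoeff (2 * M + 1) ν / z ^ (2 * M + 1)) := by
          rw [e2, ← div_div, Complex.div_I]
          rcases neg_one_pow_eq_or ℂ M with h | h <;> rw [h] <;> simp [neg_div, div_neg] <;> ring
        have e4 : hankelCoeff (2 * M + 1) ν / (z * -Complex.I) ^ (2 * M + 1) =
            -(hankelCoeff (2 * M + 1) ν / (z * Complex.I) ^ (2 * M + 1)) := by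
          rw [mul_neg, Odd.neg_pow (odd_two_mul_add_one M), div_neg]
        rw [show 2 * (M + 1) + 1 = 2 * M + 1 + 1 + 1 by ring]
        rw [Finset.sum_range_succ, Finset.sum_range_succ _ (2 * M + 1),
          Finset.sum_range_succ (fun n => hankelCoeff n ν / (z * -Complex.I) ^ n),
          Finset.sum_range_succ (fun n => hankelCoeff n ν / (z * -Complex.I) ^ n) (2 * M + 1),
          Finset.sum_range_succ _ M, e4, e1, e3]
        linear_combination ih
    rw [remJ, if_neg (by simp), remK, remK, hexp1, hexp2, ← hP, ← hQ]
    have hI : (2 * Complex.I) ≠ 0 := by simp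
    rw [sub_sub_sub_comm, h1]
    field_simp
    ring
  rw [hA, hB]
  have hpi : (Real.pi : ℂ) ≠ 0 := by exact_mod_cast Real.pi_ne_zero
  have hI : Complex.I ≠ 0 := Complex.I_ne_zero
  have hmain := besselJ_eq_modBesselK ν ζ
  set S : ℂ := (Real.sqrt (Real.pi / 2) : ℂ) with hS
  have hS2 : S * S = Real.pi / 2 := by
    rw [hS, ← Complex.ofReal_mul, Real.mul_self_sqrt (by positivity)]
    push_cast
    ring
  have hS0 : S ≠ 0 := by
    intro h
    rw [h, zero_mul] at hS2
    exact hpi (by linear_combination -2 * hS2)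
  have hS' : (Real.sqrt (2 / Real.pi) : ℂ) = S⁻¹ := by
    rw [hS, ← Complex.ofReal_inv, ← Real.sqrt_inv, inv_div]
  set F := Complex.exp (-ζ / 2) with hF
  have hF0 : F ≠ 0 := Complex.exp_ne_zero _
  have q1 : Complex.exp (-ω * Complex.I) * P =
      Complex.I * Complex.exp (Real.pi / 2 * ν * Complex.I) *
        modBesselK ν (ζ + Real.pi / 2 * Complex.I) / (S * F) := by
    have : Complex.exp (-ω * Complex.I) =
        Complex.exp (Real.pi / 2 * Complex.I) * Complex.exp (Real.pi / 2 * ν * Complex.I) *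
          Complex.exp (-(ζ + Real.pi / 2 * Complex.I) / 2) * Complex.exp (-(z * Complex.I)) / F := by
      rw [eq_div_iff hF0, hF]
      rw [← Complex.exp_add, ← Complex.exp_add, ← Complex.exp_add, ← Complex.exp_add, hω]
      congr 1
      ring
    rw [this, hP, Complex.exp_pi_div_two_mul_I]
    field_simp
  have q2 : Complex.exp (ω * Complex.I) * Q =
      -Complex.I * Complex.exp (-(Real.pi / 2 * ν * Complex.I)) *
        modBesselK ν (ζ - Real.pi / 2 * Complex.I) / (S * F) := by
    have : Complex.exp (ω * Complex.I) =
        Complex.exp (-Real.pi / 2 * Complex.I) * Complex.exp (-(Real.pi / 2 * ν * Complex.I)) *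
          Complex.exp (-(ζ - Real.pi / 2 * Complex.I) / 2) *
            Complex.exp (-(z * -Complex.I)) / F := by
      rw [eq_div_iff hF0, hF]
      rw [← Complex.exp_add, ← Complex.exp_add, ← Complex.exp_add, ← Complex.exp_add, hω]
      congr 1
      ring_nf
    rw [this, hQ, Complex.exp_neg_pi_div_two_mul_I]
    field_simp
  have q3 : Complex.cos ω * ((P + Q) / 2) - Complex.sin ω * -((P - Q) / (2 * Complex.I)) =
      (Complex.exp (-ω * Complex.I) * P + Complex.exp (ω * Complex.I) * Q) / 2 := by
    rw [Complex.cos, Complex.sin]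
    field_simp
    ring_nf
  rw [q3, q1, q2, hS']
  have h5 : besselJ ν ζ = -Complex.I / Real.pi * (Real.pi * Complex.I * besselJ ν ζ) := by
    field_simp
    rw [Complex.I_sq]
    ring
  rw [h5, hmain, show (Real.pi : ℂ) = 2 * (S * S) by rw [hS2]; ring]
  field_simp
  ring

/-!
Write `k_ν(t) = (1/2) ∫_ℝ e^(ν s - t cosh s) ds` for Macdonald's integral.

The proof rests on a Stieltjes representation: for `|arg z| < π` and `|Re ν| < N + 1/2`,
`R_N^{(K)}(z, ν) = (-1)^N (cos πν / π) (2/π)^(1/2) z^(-N) ∫_0^∞ t^(N-1/2) e^(-t) k_ν(t) / (1 + t/z) dt`.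

* That `k_ν = K_ν`, with `K_ν` defined through the power series of `I_{±ν}`, is obtained from two
  Wronskian identities, whose constants are found at the origin (`sin_mul_macdonaldIntegral`).
* For `N = 0` and `z > 0` the `t`-integral is evaluated under the integral sign of `k_ν`, which leaves
  a scaled complementary error function of `cosh (s/2)`; the representation then amounts to shifting
  the line of integration in `s` by `±iπ` (`cos_mul_integral_stieltjes_eq_macdonaldIntegral`).
  Analytic continuation gives it in the cut plane, the geometric series of `1 / (1 + t/z)` and the
  moments of `t^(-1/2) e^(-t) k_ν(t)` give it for every `N` if `|Re ν| < 1/2`, and analytic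
  continuation in `ν` gives the full range (`remK_eq_besselStieltjes`).

In the density, replace `k_ν(t) = K_ν(t)` by its own Hankel expansion with `M` terms. The explicit
terms integrate to the terminants `Λ_{N-m}(2z)`. In the remainder, write
`t^M R_M(t) = r^M R_M(r) + (t^M R_M(t) - r^M R_M(r))` with `r = |z|`. The first part gives the first
term of the bound. By the Stieltjes representation the difference is at most
`(|t - r| / r) |cos πν| a`, where `a` is the continuous extension of `|a_M(x)| / |cos πx|` to
`x = Re ν`, a ratio of Gamma functions (`hankelQuotient`, `norm_remKDiff_le`); and
`|t - r| ≤ |t + z|` cancels the factor `1 / |1 + t/z|` of the kernel. This is the second term of the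
bound. For `R_{N,M}^{(J)}` the kernel is replaced by the mean of its values at `z e^(±πi/2)`, which is
`z² / (z² + t²)`, and `|t - r| r ≤ |t² + z²|` is used instead.

The argument covers open sectors and orders that are not integers; the bounds extend to the boundary
by continuity in `z`, and to integer orders by letting the order tend to the integer.
-/

open MeasureTheory

/-! ### Integrals depending holomorphically on a parameter -/

/-- An integral of holomorphic functions is holomorphic as soon as the integrand is locally
dominated; the Cauchy estimate supplies the domination of the derivative. -/
theorem differentiableOn_integral_of_locally_dominated {α : Type*} [MeasurableSpace α]
    {μ : Measure α} {F : ℂ → α → ℂ} {U : Set ℂ} (hU : IsOpen U)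
    (hm : ∀ w ∈ U, AEStronglyMeasurable (F w) μ)
    (hd : ∀ᵐ a ∂μ, DifferentiableOn ℂ (fun w => F w a) U)
    (hb : ∀ w ∈ U, ∃ ε > 0, ∃ b : α → ℝ, Integrable b μ ∧
      ∀ᵐ a ∂μ, ∀ v ∈ Metric.ball w ε, ‖F v a‖ ≤ b a) :
    DifferentiableOn ℂ (fun w => ∫ a, F w a ∂μ) U := by
  intro w hw
  obtain ⟨ε, hε, b, hbi, hb⟩ := hb w hw
  obtain ⟨ρ, hρ, hρU⟩ := Metric.isOpen_iff.mp hU w hw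
  obtain ⟨r, hr, hrε, hrρ⟩ : ∃ r > 0, 2 * r < ε ∧ 2 * r < ρ :=
    ⟨min ε ρ / 4, by positivity, by linarith [min_le_left ε ρ], by linarith [min_le_right ε ρ]⟩
  have hsub : ∀ x ∈ Metric.ball w r, ∀ v ∈ Metric.closedBall x r, dist v w < 2 * r := by
    intro x hx v hv
    have := dist_triangle v x w
    rw [Metric.mem_ball] at hx
    rw [Metric.mem_closedBall] at hv
    linarith
  have hmem : ∀ x ∈ Metric.ball w r, x ∈ U := fun x hx =>
    hρU (by have := hsub x hx x (by simp [hr.le]); exact this.trans hrρ)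
  have hball : Metric.ball w r ∈ 𝓝 w := Metric.ball_mem_nhds w hr
  refine (hasDerivAt_integral_of_dominated_loc_of_deriv_le (μ := μ) (F := F)
    (F' := fun x a => deriv (fun v => F v a) x) (bound := fun a => b a / r) hball ?_ ?_ ?_ ?_
    (hbi.div_const r) ?_).2.differentiableAt.differentiableWithinAt
  · filter_upwards [hball] with x hx using hm x (hmem x hx)
  · refine hbi.mono' (hm w hw) ?_
    filter_upwards [hb] with a ha using ha w (Metric.mem_ball_self hε)
  · have hseq : Tendsto (fun n : ℕ => ((r : ℂ) / 2) * (1 / ((n : ℂ) + 1))) atTop (𝓝[≠] 0) := by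
      refine tendsto_nhdsWithin_iff.mpr ⟨?_, Eventually.of_forall fun n => ?_⟩
      · simpa using (tendsto_one_div_add_atTop_nhds_zero_nat (𝕜 := ℂ)).const_mul ((r : ℂ) / 2)
      · have h1 : (n : ℂ) + 1 ≠ 0 := Nat.cast_add_one_ne_zero n
        have h2 : (r : ℂ) ≠ 0 := by exact_mod_cast hr.ne'
        simp [h1, h2]
    have hin : ∀ n : ℕ, w + ((r : ℂ) / 2) * (1 / ((n : ℂ) + 1)) ∈ Metric.ball w r := by
      intro n
      rw [Metric.mem_ball, dist_eq_norm, add_sub_cancel_left, norm_mul, norm_div, norm_div,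
        norm_one]
      have h1 : ‖(n : ℂ) + 1‖ = (n : ℝ) + 1 := by exact_mod_cast Complex.norm_natCast (n + 1)
      have h2 : ‖(r : ℂ)‖ = r := by simp [abs_of_pos hr]
      rw [h1, h2, Complex.norm_two]
      have h3 : 1 / ((n : ℝ) + 1) ≤ 1 := by
        rw [div_le_one (by positivity)]
        linarith [(Nat.cast_nonneg n : (0 : ℝ) ≤ n)]
      nlinarith
    refine aestronglyMeasurable_of_tendsto_ae (atTop : Filter ℕ)
      (f := fun n a => (((r : ℂ) / 2) * (1 / ((n : ℂ) + 1)))⁻¹ •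
        (F (w + ((r : ℂ) / 2) * (1 / ((n : ℂ) + 1))) a - F w a)) (fun n => ?_) ?_
    · exact AEStronglyMeasurable.const_smul ((hm _ (hmem _ (hin n))).sub (hm w hw))
        ((((r : ℂ) / 2) * (1 / ((n : ℂ) + 1)))⁻¹)
    · filter_upwards [hd] with a ha
      have h1 := (ha.differentiableAt (hU.mem_nhds hw)).hasDerivAt
      exact (hasDerivAt_iff_tendsto_slope_zero.mp h1).comp hseq
  · filter_upwards [hb, hd] with a ha hda x hx
    refine Complex.norm_deriv_le_of_forall_mem_sphere_norm_le hr ?_ fun v hv => ?_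
    · refine DifferentiableOn.diffContOnCl (hda.mono ?_)
      rw [closure_ball x hr.ne']
      exact fun v hv => hρU ((hsub x hx v hv).trans hrρ)
    · exact ha v ((hsub x hx v (Metric.sphere_subset_closedBall hv)).trans hrε)
  · filter_upwards [hd] with a hda x hx
    exact (hda.differentiableAt (hU.mem_nhds (hmem x hx))).hasDerivAt

/-! ### The cut plane in logarithmic coordinates and the Stieltjes kernel -/

/-- The strip `|Im ζ| < π`: the plane cut along the negative axis, in the coordinate
`ζ = log z`. -/
def cutStrip : Set ℂ := {ζ | |ζ.im| < Real.pi}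

theorem isOpen_cutStrip : IsOpen cutStrip :=
  isOpen_lt (by fun_prop) continuous_const

theorem isPreconnected_cutStrip : IsPreconnected cutStrip := by
  have h : Convex ℝ cutStrip := by
    have : cutStrip = Complex.imCLM ⁻¹' Set.Ioo (-Real.pi) Real.pi := by
      ext ζ
      simp [cutStrip, abs_lt]
    rw [this]
    exact (convex_Ioo _ _).linear_preimage Complex.imCLM.toLinearMap
  exact h.isPreconnected

theorem ofReal_mem_cutStrip (x : ℝ) : (x : ℂ) ∈ cutStrip := by
  simp [cutStrip, Real.pi_pos]

/-- Holomorphic functions on a connected open set that agree at the real points near some real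
point of the set agree on the set. -/
theorem eqOn_of_eventually_eq_ofReal {f g : ℂ → ℂ} {U : Set ℂ} (hU : IsOpen U)
    (hc : IsPreconnected U) (hf : DifferentiableOn ℂ f U) (hg : DifferentiableOn ℂ g U)
    {x₀ : ℝ} (hx₀ : (x₀ : ℂ) ∈ U) (h : ∀ᶠ x : ℝ in 𝓝 x₀, f x = g x) : Set.EqOn f g U := by
  refine (hf.analyticOnNhd hU).eqOn_of_preconnected_of_frequently_eq (hg.analyticOnNhd hU) hc hx₀ ?_
  have ht : Tendsto (fun x : ℝ => (x : ℂ)) (𝓝[≠] x₀) (𝓝[≠] (x₀ : ℂ)) := by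
    refine tendsto_nhdsWithin_iff.mpr ⟨?_, ?_⟩
    · exact (Complex.continuous_ofReal.tendsto x₀).mono_left nhdsWithin_le_nhds
    · filter_upwards [self_mem_nhdsWithin] with x hx
      simpa using hx
  exact ht.frequently ((h.filter_mono nhdsWithin_le_nhds).frequently)

/-- The Stieltjes kernel `1 / (1 + t / z) = z / (z + t)` at `z = exp ζ`. -/
noncomputable def stieltjesKernel (ζ : ℂ) (t : ℝ) : ℂ :=
  Complex.exp ζ / (Complex.exp ζ + t)

theorem cos_half_im_pos {ζ : ℂ} (hζ : ζ ∈ cutStrip) : 0 < Real.cos (ζ.im / 2) := by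
  have := abs_lt.mp (show |ζ.im| < Real.pi from hζ)
  exact Real.cos_pos_of_mem_Ioo ⟨by linarith [this.1], by linarith [this.2]⟩

/-- The distance of `z` to `-t` is at least `cos (arg z / 2) (|z| + t)`; this bounds the Stieltjes
kernel uniformly in `t ≥ 0`. -/
theorem cos_half_im_mul_le_norm_exp_add (ζ : ℂ) (t : ℝ) :
    Real.cos (ζ.im / 2) * (Real.exp ζ.re + t) ≤ ‖Complex.exp ζ + t‖ := by
  refine Real.le_sqrt_of_sq_le ?_
  rw [Complex.normSq_apply]
  simp only [Complex.add_re, Complex.exp_re, Complex.ofReal_re, Complex.add_im, Complex.exp_im,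
    Complex.ofReal_im, add_zero]
  have h1 : Real.cos ζ.im = 2 * Real.cos (ζ.im / 2) ^ 2 - 1 := by
    rw [← Real.cos_two_mul]; ring_nf
  have h2 := Real.sin_sq_add_cos_sq ζ.im
  have h3 := Real.sin_sq_add_cos_sq (ζ.im / 2)
  set c := Real.cos (ζ.im / 2)
  set s := Real.sin (ζ.im / 2)
  set r := Real.exp ζ.re
  have h4 : (r * Real.cos ζ.im + t) * (r * Real.cos ζ.im + t) +
      r * Real.sin ζ.im * (r * Real.sin ζ.im) - (c * (r + t)) ^ 2 = (s * (r - t)) ^ 2 := by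
    have h5 : s ^ 2 = 1 - c ^ 2 := by linarith
    have h6 : Real.sin ζ.im ^ 2 = 1 - Real.cos ζ.im ^ 2 := by linarith
    rw [mul_pow s, h5]
    linear_combination r ^ 2 * h6 + 2 * r * t * h1
  nlinarith [sq_nonneg (s * (r - t))]

theorem exp_add_ne_zero {ζ : ℂ} (hζ : ζ ∈ cutStrip) {t : ℝ} (ht : 0 ≤ t) :
    Complex.exp ζ + t ≠ 0 := by
  have := cos_half_im_mul_le_norm_exp_add ζ t
  have h2 : 0 < Real.cos (ζ.im / 2) * (Real.exp ζ.re + t) :=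
    mul_pos (cos_half_im_pos hζ) (by positivity)
  exact norm_pos_iff.mp (h2.trans_le this)

theorem norm_stieltjesKernel_le {ζ : ℂ} (hζ : ζ ∈ cutStrip) {t : ℝ} (ht : 0 ≤ t) :
    ‖stieltjesKernel ζ t‖ ≤ (Real.cos (ζ.im / 2))⁻¹ := by
  have hc := cos_half_im_pos hζ
  rw [stieltjesKernel, norm_div, Complex.norm_exp,
    div_le_iff₀ (norm_pos_iff.mpr (exp_add_ne_zero hζ ht)), inv_mul_eq_div, le_div_iff₀ hc]
  refine le_trans ?_ (cos_half_im_mul_le_norm_exp_add ζ t)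
  nlinarith

theorem differentiableOn_stieltjesKernel {t : ℝ} (ht : 0 ≤ t) :
    DifferentiableOn ℂ (fun ζ => stieltjesKernel ζ t) cutStrip := fun _ hζ =>
  (DifferentiableAt.div Complex.differentiable_exp.differentiableAt
    (Complex.differentiable_exp.differentiableAt.add_const (t : ℂ))
    (exp_add_ne_zero hζ ht)).differentiableWithinAt

theorem continuousOn_stieltjesKernel {ζ : ℂ} (hζ : ζ ∈ cutStrip) :
    ContinuousOn (stieltjesKernel ζ) (Set.Ioi 0) := by
  refine ContinuousOn.div (by fun_prop) (by fun_prop) fun t ht => ?_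
  exact exp_add_ne_zero hζ (le_of_lt ht)

theorem aestronglyMeasurable_stieltjesKernel {ζ : ℂ} (hζ : ζ ∈ cutStrip) :
    AEStronglyMeasurable (stieltjesKernel ζ) (volume.restrict (Set.Ioi 0)) :=
  (continuousOn_stieltjesKernel hζ).aestronglyMeasurable measurableSet_Ioi

theorem integrableOn_mul_stieltjesKernel {g : ℝ → ℂ} (hg : IntegrableOn g (Set.Ioi 0)) {ζ : ℂ}
    (hζ : ζ ∈ cutStrip) : IntegrableOn (fun t => g t * stieltjesKernel ζ t) (Set.Ioi 0) := by
  refine Integrable.mul_bdd (c := (Real.cos (ζ.im / 2))⁻¹) hg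
    (aestronglyMeasurable_stieltjesKernel hζ) ?_
  filter_upwards [ae_restrict_mem measurableSet_Ioi] with t ht
  exact norm_stieltjesKernel_le hζ (le_of_lt ht)

/-- A Stieltjes transform is holomorphic in the cut plane. -/
theorem differentiableOn_integral_mul_stieltjesKernel {g : ℝ → ℂ}
    (hg : IntegrableOn g (Set.Ioi 0)) :
    DifferentiableOn ℂ (fun ζ => ∫ t in Set.Ioi (0 : ℝ), g t * stieltjesKernel ζ t) cutStrip := by
  refine differentiableOn_integral_of_locally_dominated isOpen_cutStrip (fun ζ hζ => ?_) ?_ ?_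
  · exact (integrableOn_mul_stieltjesKernel hg hζ).aestronglyMeasurable
  · filter_upwards [ae_restrict_mem measurableSet_Ioi] with t ht
    exact (differentiableOn_stieltjesKernel (le_of_lt ht)).const_mul _
  · intro ζ hζ
    set B := 2 * (Real.cos (ζ.im / 2))⁻¹ with hB
    have hpos := cos_half_im_pos hζ
    have hcont : ContinuousAt (fun v : ℂ => (Real.cos (v.im / 2))⁻¹) ζ :=
      ContinuousAt.inv₀ (by fun_prop) hpos.ne'
    have hev : ∀ᶠ v in 𝓝 ζ, v ∈ cutStrip ∧ (Real.cos (v.im / 2))⁻¹ < B := by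
      refine Filter.Eventually.and (isOpen_cutStrip.mem_nhds hζ) (hcont.eventually_lt continuousAt_const ?_)
      have := inv_pos.mpr hpos
      rw [hB]
      linarith
    obtain ⟨ε, hε, h⟩ := Metric.eventually_nhds_iff.mp hev
    refine ⟨ε, hε, fun t => ‖g t‖ * B, hg.norm.mul_const B, ?_⟩
    filter_upwards [ae_restrict_mem measurableSet_Ioi] with t ht v hv
    obtain ⟨hv1, hv2⟩ := h hv
    rw [norm_mul]
    gcongr
    exact (norm_stieltjesKernel_le hv1 (le_of_lt ht)).trans hv2.le

/-! ### The power series of the Bessel functions -/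

/-- The entire function `∑ y^k / (k! Γ(ν+k+1))`, for which
`I_ν(z) = (z/2)^ν φ_ν((z/2)²)`. -/
noncomputable def besselPhi (ν y : ℂ) : ℂ :=
  ∑' k : ℕ, y ^ k * ((k.factorial : ℂ)⁻¹ * (Complex.Gamma (ν + k + 1))⁻¹)

theorem modBesselI_eq_besselPhi (ν ζ : ℂ) :
    modBesselI ν ζ = Complex.exp (ν * (ζ - Real.log 2)) *
      besselPhi ν (Complex.exp (2 * (ζ - Real.log 2))) := by
  rw [modBesselI, besselPhi, ← tsum_mul_left]
  refine tsum_congr fun k => ?_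
  rw [← Complex.exp_nat_mul, ← mul_assoc, ← Complex.exp_add, div_eq_mul_inv, mul_inv]
  congr 2
  ring

theorem norm_besselPhi_term_le {B : ℝ} {ν : ℂ}
    (hB : ∀ k : ℕ, ‖(Complex.Gamma (ν + k + 1))⁻¹‖ ≤ B) (y : ℂ) (k : ℕ) :
    ‖y ^ k * ((k.factorial : ℂ)⁻¹ * (Complex.Gamma (ν + k + 1))⁻¹)‖ ≤
      ‖y‖ ^ k / k.factorial * B := by
  rw [norm_mul, norm_mul, norm_pow, norm_inv (k.factorial : ℂ), Complex.norm_natCast,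
    div_eq_mul_inv, mul_assoc]
  gcongr
  exact hB k

theorem summable_besselPhi (ν y : ℂ) :
    Summable fun k : ℕ => y ^ k * ((k.factorial : ℂ)⁻¹ * (Complex.Gamma (ν + k + 1))⁻¹) := by
  obtain ⟨B, hB⟩ := exists_bound_inv_Gamma ‖ν‖
  exact Summable.of_norm_bounded ((Real.summable_pow_div_factorial ‖y‖).mul_right B)
    fun k => norm_besselPhi_term_le (fun k => hB k ν le_rfl) y k

theorem hasDerivAt_besselPhi (ν y : ℂ) : HasDerivAt (besselPhi ν) (besselPhi (ν + 1) y) y := by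
  obtain ⟨B, hB⟩ := exists_bound_inv_Gamma ‖ν‖
  have hB0 : 0 ≤ B := (norm_nonneg _).trans (hB 0 ν le_rfl)
  set R := ‖y‖ + 1 with hR
  have h := hasDerivAt_tsum_of_isPreconnected (𝕜 := ℂ)
    (g := fun (k : ℕ) (y : ℂ) => y ^ k * ((k.factorial : ℂ)⁻¹ * (Complex.Gamma (ν + k + 1))⁻¹))
    (g' := fun (k : ℕ) (y : ℂ) =>
      (k * y ^ (k - 1)) * ((k.factorial : ℂ)⁻¹ * (Complex.Gamma (ν + k + 1))⁻¹))
    (u := fun k : ℕ => k * R ^ (k - 1) / k.factorial * B) (t := Metric.ball 0 R) (y₀ := y) (y := y)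
    ?_ Metric.isOpen_ball (convex_ball _ _).isPreconnected ?_ ?_ (by simp [hR])
    (summable_besselPhi ν y) (by simp [hR])
  · refine h.congr_deriv ?_
    have hs : Summable fun k : ℕ =>
        (k * y ^ (k - 1)) * ((k.factorial : ℂ)⁻¹ * (Complex.Gamma (ν + k + 1))⁻¹) := by
      refine (summable_nat_add_iff 1).mp ((summable_besselPhi (ν + 1) y).congr fun k => ?_)
      rw [Nat.factorial_succ, show ν + 1 + (k : ℂ) + 1 = ν + ((k + 1 : ℕ) : ℂ) + 1 by
        push_cast; ring]
      have : ((k : ℂ) + 1) ≠ 0 := Nat.cast_add_one_ne_zero k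
      push_cast
      field_simp
    rw [hs.tsum_eq_zero_add, besselPhi]
    simp only [Nat.cast_zero, zero_mul, zero_add]
    refine tsum_congr fun k => ?_
    rw [Nat.factorial_succ, show ν + 1 + (k : ℂ) + 1 = ν + ((k + 1 : ℕ) : ℂ) + 1 by
        push_cast; ring]
    have : ((k : ℂ) + 1) ≠ 0 := Nat.cast_add_one_ne_zero k
    push_cast
    field_simp
  · refine Summable.mul_right B ((summable_nat_add_iff 1).mp
      ((Real.summable_pow_div_factorial R).congr fun k => ?_))
    rw [Nat.factorial_succ]
    have : ((k : ℝ) + 1) ≠ 0 := Nat.cast_add_one_ne_zero k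
    push_cast
    field_simp
  · intro k w _
    simpa using (hasDerivAt_pow k w).mul_const
      ((k.factorial : ℂ)⁻¹ * (Complex.Gamma (ν + k + 1))⁻¹)
  · intro k w hw
    rw [norm_mul, norm_mul, norm_mul, norm_pow, norm_inv (k.factorial : ℂ), Complex.norm_natCast,
      Complex.norm_natCast, div_eq_mul_inv, mul_assoc _ _ B]
    have hw' : ‖w‖ ≤ R := by simpa using (Metric.mem_ball.mp hw).le
    gcongr
    exact hB k ν le_rfl

/-- The contiguous relation behind `I_{ν-1}(z) - I_{ν+1}(z) = (2ν/z) I_ν(z)`. -/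
theorem besselPhi_sub_one (ν y : ℂ) :
    besselPhi (ν - 1) y - y * besselPhi (ν + 1) y = ν * besselPhi ν y := by
  have hs := summable_besselPhi ν y
  have hs1 := summable_besselPhi (ν - 1) y
  have hs2 := (summable_besselPhi (ν + 1) y).mul_left y
  have key : ∀ k : ℕ, (Complex.Gamma (ν - 1 + k + 1))⁻¹ =
      (ν + k) * (Complex.Gamma (ν + k + 1))⁻¹ := by
    intro k
    have := Complex.one_div_Gamma_eq_self_mul_one_div_Gamma_add_one (ν + k)
    rw [← this]
    congr 2
    ring
  have h2 : y * besselPhi (ν + 1) y = ∑' k : ℕ, (k : ℂ) *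
      (y ^ k * ((k.factorial : ℂ)⁻¹ * (Complex.Gamma (ν + k + 1))⁻¹)) ∧
      Summable fun k : ℕ => (k : ℂ) *
      (y ^ k * ((k.factorial : ℂ)⁻¹ * (Complex.Gamma (ν + k + 1))⁻¹)) := by
    have e : ∀ k : ℕ, y * (y ^ k * ((k.factorial : ℂ)⁻¹ *
        (Complex.Gamma (ν + 1 + k + 1))⁻¹)) = ((k + 1 : ℕ) : ℂ) * (y ^ (k + 1) *
        (((k + 1).factorial : ℂ)⁻¹ * (Complex.Gamma (ν + ((k + 1 : ℕ) : ℂ) + 1))⁻¹)) := by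
      intro k
      rw [Nat.factorial_succ, show ν + 1 + (k : ℂ) + 1 = ν + ((k + 1 : ℕ) : ℂ) + 1 by
        push_cast; ring]
      have : ((k : ℂ) + 1) ≠ 0 := Nat.cast_add_one_ne_zero k
      push_cast
      field_simp
      ring
    have hS : Summable fun k : ℕ => (k : ℂ) *
        (y ^ k * ((k.factorial : ℂ)⁻¹ * (Complex.Gamma (ν + k + 1))⁻¹)) :=
      (summable_nat_add_iff 1).mp (hs2.congr e)
    refine ⟨?_, hS⟩
    rw [hS.tsum_eq_zero_add, besselPhi, ← tsum_mul_left, Nat.cast_zero, zero_mul, zero_add]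
    exact tsum_congr e
  rw [h2.1, besselPhi, besselPhi, ← hs1.tsum_sub h2.2, ← tsum_mul_left]
  refine tsum_congr fun k => ?_
  rw [key]
  ring

theorem besselPhi_zero (ν : ℂ) : besselPhi ν 0 = (Complex.Gamma (ν + 1))⁻¹ := by
  rw [besselPhi, tsum_eq_single 0]
  · simp
  · intro k hk
    simp [hk]

/-- The Wronskian of `I_ν` and `I_{-ν}`, written in terms of the power series. -/
theorem besselPhi_wronskian (ν y : ℂ) :
    y * besselPhi (ν + 1) y * besselPhi (-ν) y - besselPhi (-ν - 1) y * besselPhi ν y =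
      Complex.sin (Real.pi * ν) / Real.pi := by
  set f : ℂ → ℂ := fun y =>
    y * besselPhi (ν + 1) y * besselPhi (-ν) y - besselPhi (-ν - 1) y * besselPhi ν y with hf
  have hd : ∀ y, HasDerivAt f 0 y := by
    intro y
    have h1 := hasDerivAt_besselPhi (ν + 1) y
    have h2 := hasDerivAt_besselPhi (-ν) y
    have h3 := hasDerivAt_besselPhi (-ν - 1) y
    have h4 := hasDerivAt_besselPhi ν y
    refine ((((hasDerivAt_id' y).mul h1).mul h2).sub (h3.mul h4)).congr_deriv ?_
    have r1 := besselPhi_sub_one (ν + 1) y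
    have r2 := besselPhi_sub_one (-ν) y
    rw [add_sub_cancel_right] at r1
    rw [sub_add_cancel]
    simp only [Pi.mul_apply]
    linear_combination -besselPhi (-ν) y * r1 - besselPhi (ν + 1) y * r2
  have hconst := is_const_of_deriv_eq_zero (fun y => (hd y).differentiableAt)
    (fun y => (hd y).deriv) y 0
  have h0 : f 0 = Complex.sin (Real.pi * ν) / Real.pi := by
    have := Complex.Gamma_mul_Gamma_one_sub (-ν)
    simp only [hf, besselPhi_zero]
    rw [zero_mul, zero_mul, zero_sub, sub_add_cancel, ← mul_inv, show ν + 1 = 1 - -ν by ring, this,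
      inv_div, mul_neg, Complex.sin_neg, neg_div, neg_neg]
  rw [← h0, ← hconst]

theorem differentiable_besselPhi_order {y : ℝ} (hy : 0 < y) :
    Differentiable ℂ fun ν => besselPhi ν y := by
  have h : (fun ν => besselPhi ν y) = fun ν => Complex.exp (-(ν * (Real.log y / 2 : ℝ))) *
      modBesselI ν ((Real.log y / 2 : ℝ) + Real.log 2) := by
    funext ν
    rw [modBesselI_eq_besselPhi, add_sub_cancel_right, ← mul_assoc, ← Complex.exp_add,
      neg_add_cancel, Complex.exp_zero, one_mul]
    congr 1
    rw [show (2 : ℂ) * ((Real.log y / 2 : ℝ) : ℂ) = ((Real.log y : ℝ) : ℂ) by push_cast; ring,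
      ← Complex.ofReal_exp, Real.exp_log hy]
  rw [h]
  exact Differentiable.mul (by fun_prop) (differentiable_modBesselI _)

theorem differentiable_modBesselI_arg (ν : ℂ) : Differentiable ℂ (modBesselI ν) := by
  have h : modBesselI ν = fun ζ => Complex.exp (ν * (ζ - Real.log 2)) *
      besselPhi ν (Complex.exp (2 * (ζ - Real.log 2))) :=
    funext (modBesselI_eq_besselPhi ν)
  have h2 : Differentiable ℂ (besselPhi ν) := fun y => (hasDerivAt_besselPhi ν y).differentiableAt
  rw [h]
  exact Differentiable.mul (by fun_prop) (h2.comp (by fun_prop))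

/-! ### Integrals over the line with exponential weights -/

theorem image_exp_univ : Real.exp '' Set.univ = Set.Ioi 0 := by
  rw [Set.image_univ, Real.range_exp]

theorem integral_exp_smul_comp_exp {E : Type*} [NormedAddCommGroup E] [NormedSpace ℝ E]
    (g : ℝ → E) : ∫ s : ℝ, Real.exp s • g (Real.exp s) = ∫ t in Set.Ioi 0, g t := by
  have := integral_image_eq_integral_abs_deriv_smul MeasurableSet.univ
    (fun x _ => (Real.hasDerivAt_exp x).hasDerivWithinAt) Real.exp_injective.injOn g
  rw [image_exp_univ, setIntegral_univ] at this
  simpa using this.symm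

/-- The substitution `t = exp s` preserves integrability. -/
theorem integrable_exp_smul_comp_exp {E : Type*} [NormedAddCommGroup E] [NormedSpace ℝ E]
    {g : ℝ → E} (hg : IntegrableOn g (Set.Ioi 0)) :
    Integrable fun s : ℝ => Real.exp s • g (Real.exp s) := by
  have := integrableOn_image_iff_integrableOn_abs_deriv_smul MeasurableSet.univ
    (fun x _ => (Real.hasDerivAt_exp x).hasDerivWithinAt) Real.exp_injective.injOn g
  rw [image_exp_univ, integrableOn_univ] at this
  simpa using this.mp hg

theorem integrable_exp_neg_mul_abs {b : ℝ} (hb : 0 < b) :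
    Integrable fun s : ℝ => Real.exp (-(b * |s|)) := by
  rw [← integrableOn_univ, ← Set.Iic_union_Ioi (a := (0 : ℝ))]
  refine IntegrableOn.union ?_ ?_
  · refine (integrableOn_exp_mul_Iic hb 0).congr_fun (fun s hs => ?_) measurableSet_Iic
    simp only [abs_of_nonpos (Set.mem_Iic.mp hs)]
    ring_nf
  · refine (integrableOn_exp_mul_Ioi (neg_lt_zero.mpr hb) 0).congr_fun (fun s hs => ?_)
      measurableSet_Ioi
    simp only [abs_of_pos (Set.mem_Ioi.mp hs)]
    ring_nf

theorem exp_abs_le_two_mul_cosh (s : ℝ) : Real.exp |s| ≤ 2 * Real.cosh s := by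
  rw [← Real.cosh_abs s, Real.cosh_eq]
  linarith [Real.exp_pos (-|s|)]

theorem sq_le_four_mul_cosh (s : ℝ) : s ^ 2 ≤ 4 * Real.cosh s := by
  have h1 := Real.quadratic_le_exp_of_nonneg (abs_nonneg s)
  have h2 := exp_abs_le_two_mul_cosh s
  rw [sq_abs] at h1
  nlinarith [abs_nonneg s]

theorem integrable_exp_mul_abs_sub_cosh (c : ℝ) {m : ℝ} (hm : 0 < m) :
    Integrable fun s : ℝ => Real.exp (c * |s| - m * Real.cosh s) := by
  refine ((integrable_exp_neg_mul_abs one_pos).const_mul (Real.exp ((c + 1) ^ 2 / m))).mono'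
    (by fun_prop) (Eventually.of_forall fun s => ?_)
  rw [Real.norm_of_nonneg (Real.exp_pos _).le, ← Real.exp_add]
  refine Real.exp_le_exp.mpr ?_
  have h1 := sq_le_four_mul_cosh s
  have h2 : (c + 1) * |s| - m * (s ^ 2 / 4) ≤ (c + 1) ^ 2 / m := by
    rw [le_div_iff₀ hm]
    have h3 : |s| ^ 2 = s ^ 2 := sq_abs s
    rw [← h3]
    nlinarith [sq_nonneg ((c + 1) - m * |s| / 2)]
  nlinarith

/-! ### The integral representation of `K_ν` -/

/-- The integral `∫ exp (ν s - e^s - y e^{-s}) ds` over the real line, that is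
`∫_0^∞ t^(ν-1) e^(-t-y/t) dt`, for which `K_ν(x) = (x/2)^(-ν) η_ν((x/2)²) / 2`. -/
noncomputable def besselEta (ν : ℂ) (y : ℝ) : ℂ :=
  ∫ s : ℝ, Complex.exp (ν * s - Real.exp s - y * Real.exp (-s))

theorem norm_besselEta_integrand (ν : ℂ) (y s : ℝ) :
    ‖Complex.exp (ν * s - Real.exp s - y * Real.exp (-s))‖ =
      Real.exp (ν.re * s - Real.exp s - y * Real.exp (-s)) := by
  rw [Complex.norm_exp]
  congr 1
  simp [Complex.sub_re, Complex.mul_re, -Complex.ofReal_exp]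

theorem norm_besselEta_integrand_le {ν : ℂ} {y s b m : ℝ} (hν : |ν.re| ≤ b) (hm : m ≤ 1)
    (hy : m ≤ y) :
    ‖Complex.exp (ν * s - Real.exp s - y * Real.exp (-s))‖ ≤
      Real.exp (b * |s| - 2 * m * Real.cosh s) := by
  rw [norm_besselEta_integrand, Real.exp_le_exp, Real.cosh_eq]
  have h1 : ν.re * s ≤ b * |s| := by
    refine (le_abs_self _).trans ?_
    rw [abs_mul]
    gcongr
  nlinarith [Real.exp_pos s, Real.exp_pos (-s)]

theorem continuous_besselEta_integrand (ν : ℂ) (y : ℝ) :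
    Continuous fun s : ℝ => Complex.exp (ν * s - Real.exp s - y * Real.exp (-s)) := by
  fun_prop

theorem integrable_besselEta (ν : ℂ) {y : ℝ} (hy : 0 < y) :
    Integrable fun s : ℝ => Complex.exp (ν * s - Real.exp s - y * Real.exp (-s)) :=
  (integrable_exp_mul_abs_sub_cosh |ν.re| (m := 2 * min 1 y) (by positivity)).mono'
    (continuous_besselEta_integrand ν y).aestronglyMeasurable
    (Eventually.of_forall fun _ =>
      norm_besselEta_integrand_le le_rfl (min_le_left _ _) (min_le_right _ _))

theorem differentiable_besselEta_order {y : ℝ} (hy : 0 < y) :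
    Differentiable ℂ fun ν => besselEta ν y := by
  rw [← differentiableOn_univ]
  refine differentiableOn_integral_of_locally_dominated isOpen_univ
    (fun ν _ => (integrable_besselEta ν hy).aestronglyMeasurable)
    (Eventually.of_forall fun s => ?_) fun w _ => ⟨1, one_pos, _,
      integrable_exp_mul_abs_sub_cosh (‖w‖ + 1) (m := 2 * min 1 y) (by positivity),
      Eventually.of_forall fun s v hv =>
        norm_besselEta_integrand_le ?_ (min_le_left _ _) (min_le_right _ _)⟩
  · fun_prop
  · have h1 := norm_sub_norm_le v w
    have h2 := Complex.abs_re_le_norm v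
    rw [Metric.mem_ball, dist_eq_norm] at hv
    linarith

theorem hasDerivAt_besselEta (ν : ℂ) {y : ℝ} (hy : 0 < y) :
    HasDerivAt (besselEta ν) (-besselEta (ν - 1) y) y := by
  have hmem : Set.Ioi (y / 2) ∈ 𝓝 y := Ioi_mem_nhds (by linarith)
  have e : ∀ x s : ℝ, Complex.exp (ν * s - Real.exp s - x * Real.exp (-s)) * -Real.exp (-s) =
      -Complex.exp ((ν - 1) * s - Real.exp s - x * Real.exp (-s)) := by
    intro x s
    rw [Complex.ofReal_exp (-s), mul_neg, ← Complex.exp_add]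
    congr 2
    push_cast
    ring
  have h := (hasDerivAt_integral_of_dominated_loc_of_deriv_le (μ := volume) hmem
    (F := fun (x : ℝ) (s : ℝ) => Complex.exp (ν * s - Real.exp s - x * Real.exp (-s)))
    (F' := fun x s => Complex.exp (ν * s - Real.exp s - x * Real.exp (-s)) * -Real.exp (-s))
    (bound := fun s => Real.exp (|(ν - 1).re| * |s| - 2 * min 1 (y / 2) * Real.cosh s))
    (x₀ := y) ?_ (integrable_besselEta ν hy) ?_ ?_
    (integrable_exp_mul_abs_sub_cosh _ (by positivity)) ?_).2
  · refine h.congr_deriv ?_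
    simp only [e]
    rw [integral_neg, besselEta]
  · exact Eventually.of_forall fun x => (continuous_besselEta_integrand ν x).aestronglyMeasurable
  · exact Continuous.aestronglyMeasurable (by fun_prop)
  · refine Eventually.of_forall fun s x hx => ?_
    rw [e, norm_neg]
    exact norm_besselEta_integrand_le le_rfl (min_le_left _ _)
      ((min_le_right _ _).trans (le_of_lt hx))
  · refine Eventually.of_forall fun s x _ => ?_
    refine HasDerivAt.cexp ?_
    have h1 : HasDerivAt (fun x : ℝ => (x : ℂ)) 1 x := Complex.ofRealCLM.hasDerivAt
    simpa using (h1.mul_const ((Real.exp (-s) : ℝ) : ℂ)).const_sub (ν * s - Real.exp s)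

/-- The contiguous relation of `K_ν`, from integration by parts. -/
theorem besselEta_add_one (ν : ℂ) {y : ℝ} (hy : 0 < y) :
    besselEta (ν + 1) y = ν * besselEta ν y + y * besselEta (ν - 1) y := by
  have e1 : ∀ s : ℝ, Complex.exp ((ν + 1) * s - Real.exp s - y * Real.exp (-s)) =
      Complex.exp (ν * s - Real.exp s - y * Real.exp (-s)) * Real.exp s := by
    intro s
    rw [Complex.ofReal_exp s, ← Complex.exp_add]
    congr 1
    push_cast
    ring
  have e2 : ∀ s : ℝ, Complex.exp ((ν - 1) * s - Real.exp s - y * Real.exp (-s)) =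
      Complex.exp (ν * s - Real.exp s - y * Real.exp (-s)) * Real.exp (-s) := by
    intro s
    rw [Complex.ofReal_exp (-s), ← Complex.exp_add]
    congr 1
    push_cast
    ring
  have hd : ∀ s : ℝ, HasDerivAt
      (fun s : ℝ => Complex.exp (ν * s - Real.exp s - y * Real.exp (-s)))
      (ν * Complex.exp (ν * s - Real.exp s - y * Real.exp (-s)) -
        Complex.exp ((ν + 1) * s - Real.exp s - y * Real.exp (-s)) +
        y * Complex.exp ((ν - 1) * s - Real.exp s - y * Real.exp (-s))) s := by
    intro s
    have h1 : HasDerivAt (fun s : ℝ => (s : ℂ)) 1 s := Complex.ofRealCLM.hasDerivAt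
    have h2 : HasDerivAt (fun s : ℝ => ((Real.exp s : ℝ) : ℂ)) (Real.exp s : ℝ) s :=
      (Real.hasDerivAt_exp s).ofReal_comp
    have h3 : HasDerivAt (fun s : ℝ => ((Real.exp (-s) : ℝ) : ℂ)) ((Real.exp (-s) * -1 : ℝ) : ℂ) s :=
      ((hasDerivAt_neg s).exp).ofReal_comp
    refine ((((h1.const_mul ν).sub h2).sub (h3.const_mul (y : ℂ))).cexp).congr_deriv ?_
    rw [e1, e2]
    simp only [Pi.sub_apply]
    push_cast
    ring
  have i0 := integrable_besselEta ν hy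
  have i1 := integrable_besselEta (ν + 1) hy
  have i2 := integrable_besselEta (ν - 1) hy
  have h := integral_eq_zero_of_hasDerivAt_of_integrable hd
    (((i0.const_mul ν).sub i1).add (i2.const_mul (y : ℂ))) i0
  rw [integral_add (by exact (i0.const_mul ν).sub i1) (i2.const_mul (y : ℂ)),
    integral_sub (i0.const_mul ν) i1, integral_const_mul, integral_const_mul] at h
  simp only [besselEta]
  linear_combination -h

theorem exp_mul_sub_exp_eq (ν : ℂ) (s : ℝ) :
    Complex.exp (ν * s - Real.exp s) = Real.exp s •
      (((-Real.exp s).exp : ℂ) * ((Real.exp s : ℝ) : ℂ) ^ (ν - 1)) := by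
  rw [Complex.cpow_def_of_ne_zero (by exact_mod_cast (Real.exp_pos s).ne'),
    ← Complex.ofReal_log (Real.exp_pos s).le, Real.log_exp, Complex.real_smul]
  push_cast
  rw [← Complex.exp_add, ← Complex.exp_add]
  congr 1
  ring

theorem integral_exp_mul_sub_exp {ν : ℂ} (hν : 0 < ν.re) :
    ∫ s : ℝ, Complex.exp (ν * s - Real.exp s) = Complex.Gamma ν := by
  simp only [exp_mul_sub_exp_eq]
  rw [integral_exp_smul_comp_exp (fun t : ℝ => ((-t).exp : ℂ) * (t : ℂ) ^ (ν - 1)),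
    Complex.Gamma_eq_integral hν, Complex.GammaIntegral]

theorem integrable_exp_mul_sub_exp {ν : ℂ} (hν : 0 < ν.re) :
    Integrable fun s : ℝ => Complex.exp (ν * s - Real.exp s) := by
  simp only [exp_mul_sub_exp_eq]
  exact integrable_exp_smul_comp_exp (g := fun t : ℝ => ((-t).exp : ℂ) * (t : ℂ) ^ (ν - 1))
    (Complex.GammaIntegral_convergent hν)

/-- At `y = 0` the integral `η_ν(y)` becomes the Gamma integral. -/
theorem tendsto_besselEta_zero {ν : ℂ} (hν : 0 < ν.re) :
    Tendsto (besselEta ν) (𝓝[>] 0) (𝓝 (Complex.Gamma ν)) := by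
  rw [← integral_exp_mul_sub_exp hν]
  refine tendsto_integral_filter_of_dominated_convergence
    (fun s => ‖Complex.exp (ν * s - Real.exp s)‖)
    (Eventually.of_forall fun y => (continuous_besselEta_integrand ν y).aestronglyMeasurable)
    ?_ (integrable_exp_mul_sub_exp hν).norm (Eventually.of_forall fun s => ?_)
  · filter_upwards [self_mem_nhdsWithin] with y hy
    refine Eventually.of_forall fun s => ?_
    rw [norm_besselEta_integrand, Complex.norm_exp]
    refine Real.exp_le_exp.mpr ?_
    have h1 : 0 ≤ y * Real.exp (-s) := mul_nonneg (le_of_lt hy) (Real.exp_pos _).le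
    simp only [Complex.sub_re, Complex.mul_re, Complex.ofReal_re, Complex.ofReal_im, mul_zero,
      sub_zero]
    linarith
  · have hc : Continuous fun y : ℝ => Complex.exp (ν * s - Real.exp s - y * Real.exp (-s)) := by
      fun_prop
    have := (hc.tendsto 0).mono_left (nhdsWithin_le_nhds (s := Set.Ioi 0))
    simpa using this

/-- The Wronskian of `I_ν` and `K_ν`. It does not depend on the argument, tends to `1` at the
origin for `Re ν > 0`, and is an entire function of `ν`. -/
theorem besselEta_besselPhi_wronskian (ν : ℂ) {y : ℝ} (hy : 0 < y) :
    y * besselEta ν y * besselPhi (ν + 1) y + besselEta (ν + 1) y * besselPhi ν y = 1 := by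
  have hphi : ∀ (ν : ℂ) (y : ℝ),
      HasDerivAt (fun y : ℝ => besselPhi ν y) (besselPhi (ν + 1) y) y :=
    fun ν y => (hasDerivAt_besselPhi ν y).comp_ofReal
  have hpos : ∀ ν : ℂ, 0 < ν.re →
      y * besselEta ν y * besselPhi (ν + 1) y + besselEta (ν + 1) y * besselPhi ν y = 1 := by
    intro ν hν
    set f : ℝ → ℂ := fun y =>
      y * besselEta ν y * besselPhi (ν + 1) y + besselEta (ν + 1) y * besselPhi ν y with hf
    have hd : ∀ y ∈ Set.Ioi (0 : ℝ), HasDerivAt f 0 y := by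
      intro y hy
      have h0 : HasDerivAt (fun s : ℝ => (s : ℂ)) 1 y := Complex.ofRealCLM.hasDerivAt
      refine (((h0.mul (hasDerivAt_besselEta ν hy)).mul (hphi (ν + 1) y)).add
        ((hasDerivAt_besselEta (ν + 1) hy).mul (hphi ν y))).congr_deriv ?_
      have r1 := besselPhi_sub_one (ν + 1) y
      have r2 := besselEta_add_one ν hy
      rw [add_sub_cancel_right] at r1 ⊢
      simp only [Pi.mul_apply]
      linear_combination -besselEta ν y * r1 + besselPhi (ν + 1) y * r2
    have hlim : Tendsto f (𝓝[>] 0) (𝓝 1) := by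
      have t1 := tendsto_besselEta_zero hν
      have t2 : Tendsto (besselEta (ν + 1)) (𝓝[>] 0) (𝓝 (Complex.Gamma (ν + 1))) :=
        tendsto_besselEta_zero (by simp; linarith)
      have t3 : ∀ ν : ℂ, Tendsto (fun y : ℝ => besselPhi ν y) (𝓝[>] 0) (𝓝 (besselPhi ν 0)) := by
        intro ν
        have := (hphi ν 0).continuousAt.tendsto.mono_left (nhdsWithin_le_nhds (s := Set.Ioi 0))
        simpa using this
      have t4 : Tendsto (fun y : ℝ => (y : ℂ)) (𝓝[>] 0) (𝓝 0) := by
        have := (Complex.continuous_ofReal.tendsto 0).mono_left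
          (nhdsWithin_le_nhds (s := Set.Ioi 0))
        simpa using this
      have h := ((t4.mul t1).mul (t3 (ν + 1))).add (t2.mul (t3 ν))
      rw [besselPhi_zero ν, mul_inv_cancel₀ (Complex.Gamma_ne_zero_of_re_pos
        (by simp; linarith)), zero_mul, zero_mul, zero_add] at h
      exact h
    have hconst : ∀ x ∈ Set.Ioi (0 : ℝ), f x = f y := fun x hx =>
      isOpen_Ioi.is_const_of_deriv_eq_zero isPreconnected_Ioi
        (fun z hz => (hd z hz).differentiableAt.differentiableWithinAt)
        (fun z hz => (hd z hz).deriv) hx hy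
    refine tendsto_nhds_unique ?_ hlim
    refine Tendsto.congr' ?_ tendsto_const_nhds
    filter_upwards [self_mem_nhdsWithin] with x hx using (hconst x hx).symm
  refine eqOn_of_eventually_eq_ofReal (x₀ := 1)
    (f := fun ν => y * besselEta ν y * besselPhi (ν + 1) y + besselEta (ν + 1) y * besselPhi ν y)
    (g := fun _ => 1)
    isOpen_univ isPreconnected_univ (Differentiable.differentiableOn ?_)
    (differentiableOn_const _) (Set.mem_univ _) ?_ (Set.mem_univ ν)
  · have h1 := differentiable_besselEta_order hy
    have h2 := differentiable_besselPhi_order hy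
    have h3 : Differentiable ℂ fun ν => besselEta (ν + 1) y := h1.comp (by fun_prop)
    have h4 : Differentiable ℂ fun ν => besselPhi (ν + 1) y := h2.comp (by fun_prop)
    fun_prop
  · filter_upwards [lt_mem_nhds one_pos] with x hx using hpos x (by simpa using hx)

/-- Macdonald's integral `½ ∫ exp (ν s - x cosh s) ds` over the real line, which is `K_ν(x)` for
`x > 0`. -/
noncomputable def macdonaldIntegral (ν : ℂ) (x : ℝ) : ℂ :=
  1 / 2 * ∫ s : ℝ, Complex.exp (ν * s - x * Real.cosh s)

theorem macdonaldIntegral_neg (ν : ℂ) (x : ℝ) :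
    macdonaldIntegral (-ν) x = macdonaldIntegral ν x := by
  rw [macdonaldIntegral, macdonaldIntegral,
    ← integral_neg_eq_self (fun s : ℝ => Complex.exp (ν * s - x * Real.cosh s))]
  simp only [Real.cosh_neg, Complex.ofReal_neg, neg_mul, mul_neg]

theorem macdonaldIntegral_exp (ν : ℂ) (Y : ℝ) :
    macdonaldIntegral ν (Real.exp (Y + Real.log 2)) =
      1 / 2 * Complex.exp (-(ν * Y)) * besselEta ν (Real.exp (2 * Y)) := by
  rw [macdonaldIntegral, besselEta, mul_assoc, ← integral_const_mul (Complex.exp (-(ν * Y))),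
    ← integral_add_right_eq_self (fun s : ℝ => Complex.exp
      (ν * s - (Real.exp (Y + Real.log 2) : ℝ) * Real.cosh s)) (-Y)]
  refine congrArg _ (integral_congr_ae (Eventually.of_forall fun s => ?_))
  simp only
  rw [← Complex.exp_add]
  congr 1
  have h : Real.exp (Y + Real.log 2) * Real.cosh (s + -Y) =
      Real.exp s + Real.exp (2 * Y) * Real.exp (-s) := by
    rw [Real.exp_add, Real.exp_log two_pos, Real.cosh_eq, ← Real.exp_add,
      show 2 * Y + -s = Y + (Y - s) by ring, show -(s + -Y) = Y - s by ring, Real.exp_add Y (Y - s),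
      show s = Y + (s + -Y) by ring, Real.exp_add Y (s + -Y)]
    ring_nf
  rw [← Complex.ofReal_mul, h]
  push_cast
  ring

/-- `sin (πν) K_ν(x) = (π / 2) (I_{-ν}(x) - I_ν(x))` for the integral form of `K_ν`: the Wronskians
of `K_ν` with `I_ν` and with `I_{-ν}` agree, and that of `I_ν` with `I_{-ν}` is known. -/
theorem sin_mul_macdonaldIntegral (ν : ℂ) (ξ : ℝ) :
    Complex.sin (Real.pi * ν) * macdonaldIntegral ν (Real.exp ξ) =
      Real.pi / 2 * (modBesselI (-ν) ξ - modBesselI ν ξ) := by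
  obtain ⟨Y, rfl⟩ : ∃ Y, ξ = Y + Real.log 2 := ⟨ξ - Real.log 2, by ring⟩
  have hsym := macdonaldIntegral_neg ν (Real.exp (Y + Real.log 2))
  have hsym' := macdonaldIntegral_neg (ν - 1) (Real.exp (Y + Real.log 2))
  rw [macdonaldIntegral_exp, macdonaldIntegral_exp] at hsym hsym'
  rw [macdonaldIntegral_exp, modBesselI_eq_besselPhi, modBesselI_eq_besselPhi]
  have hy : 0 < Real.exp (2 * Y) := Real.exp_pos _
  have hy' : Complex.exp (2 * ((Y + Real.log 2 : ℝ) - Real.log 2 : ℂ)) = (Real.exp (2 * Y) : ℝ) := by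
    push_cast
    congr 1
    ring
  have hY : (((Y + Real.log 2 : ℝ) : ℂ) - Real.log 2) = Y := by push_cast; ring
  rw [hy', hY]
  have w1 := besselEta_besselPhi_wronskian ν hy
  have w2 := besselEta_besselPhi_wronskian (-ν) hy
  have w3 := besselPhi_wronskian ν (Real.exp (2 * Y) : ℝ)
  have c1 := besselEta_add_one ν hy
  have c2 := besselPhi_sub_one (-ν) (Real.exp (2 * Y) : ℝ)
  rw [show -(ν - 1) = -ν + 1 by ring] at hsym'
  have hE : ((Real.exp (2 * Y) : ℝ) : ℂ) = Complex.exp Y * Complex.exp Y := by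
    rw [← Complex.exp_add]
    push_cast
    congr 1
    ring
  set y : ℂ := ((Real.exp (2 * Y) : ℝ) : ℂ)
  set E := Complex.exp (ν * Y) with hEdef
  have e1 : Complex.exp (-ν * Y) = E⁻¹ := by rw [neg_mul, Complex.exp_neg]
  have e2 : Complex.exp (-(ν * Y)) = E⁻¹ := by rw [Complex.exp_neg]
  have e3 : Complex.exp (-(-ν * Y)) = E := by rw [hEdef]; congr 1; ring
  have e4 : Complex.exp (-((-ν + 1) * Y)) = E * (Complex.exp Y)⁻¹ := by
    rw [hEdef, ← Complex.exp_neg, ← Complex.exp_add]; congr 1; ring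
  have e5 : Complex.exp (-((ν - 1) * Y)) = E⁻¹ * Complex.exp Y := by
    rw [hEdef, ← Complex.exp_neg, ← Complex.exp_add]; congr 1; ring
  have hE0 : E ≠ 0 := Complex.exp_ne_zero _
  have hY0 : Complex.exp Y ≠ 0 := Complex.exp_ne_zero _
  have hpi : (Real.pi : ℂ) ≠ 0 := by exact_mod_cast Real.pi_ne_zero
  rw [e3, e2] at hsym
  rw [e4, e5] at hsym'
  rw [e1, e2]
  have s1 : besselEta (-ν) (Real.exp (2 * Y)) =
      E⁻¹ * E⁻¹ * besselEta ν (Real.exp (2 * Y)) := by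
    field_simp at hsym ⊢
    linear_combination hsym
  have s2 : besselEta (-ν + 1) (Real.exp (2 * Y)) =
      E⁻¹ * E⁻¹ * y * besselEta (ν - 1) (Real.exp (2 * Y)) := by
    rw [hE]
    field_simp at hsym' ⊢
    linear_combination hsym'
  rw [s1, s2] at w2
  have hsin : Complex.sin (Real.pi * ν) =
      Real.pi * (y * besselPhi (ν + 1) y * besselPhi (-ν) y - besselPhi (-ν - 1) y * besselPhi ν y) := by
    rw [w3]
    field_simp
  rw [hsin]
  have w2' : y * besselEta ν (Real.exp (2 * Y)) * besselPhi (-ν + 1) y +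
      y * besselEta (ν - 1) (Real.exp (2 * Y)) * besselPhi (-ν) y = E * E := by
    field_simp at w2
    linear_combination w2
  have hmain : besselEta ν (Real.exp (2 * Y)) * (y * besselPhi (ν + 1) y * besselPhi (-ν) y -
      besselPhi (-ν - 1) y * besselPhi ν y) = besselPhi (-ν) y - E * E * besselPhi ν y := by
    linear_combination besselPhi (-ν) y * w1 - besselPhi ν y * w2' -
      besselPhi ν y * besselPhi (-ν) y * c1 -
      besselPhi ν y * besselEta ν (Real.exp (2 * Y)) * c2
  have hE1 : E⁻¹ * (E * E) = E := by field_simp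
  linear_combination Real.pi / 2 * E⁻¹ * hmain - Real.pi / 2 * besselPhi ν y * hE1

/-! ### Stieltjes transforms of Gamma densities and the basic terminant -/

theorem integrableOn_rpow_mul_exp_neg {p b : ℝ} (hp : 0 < p) (hb : 0 < b) :
    IntegrableOn (fun t : ℝ => t ^ (p - 1) * Real.exp (-(b * t))) (Set.Ioi 0) := by
  have := integrableOn_rpow_mul_exp_neg_mul_rpow (s := p - 1) (by linarith) one_pos hb
  simpa using this

theorem integrableOn_rpow_neg_mul_exp_neg (p : ℝ) {w : ℝ} (hw : 0 < w) :
    IntegrableOn (fun t : ℝ => t ^ (-p) * Real.exp (-t)) (Set.Ioi w) := by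
  have h : IntegrableOn (fun t : ℝ => w ^ (-p - |p|) * (t ^ (|p| + 1 - 1) * Real.exp (-(1 * t))))
      (Set.Ioi w) :=
    ((integrableOn_rpow_mul_exp_neg (by positivity) one_pos).mono_set
      (Set.Ioi_subset_Ioi hw.le)).const_mul _
  refine h.mono' ?_ ?_
  · refine ContinuousOn.aestronglyMeasurable (fun t ht => ?_) measurableSet_Ioi
    have : t ≠ 0 := (hw.trans ht).ne'
    exact ((Real.continuousAt_rpow_const t (-p) (Or.inl this)).mul
      (by fun_prop)).continuousWithinAt
  · filter_upwards [ae_restrict_mem measurableSet_Ioi] with t ht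
    have ht0 : 0 < t := hw.trans ht
    rw [Real.norm_of_nonneg (by positivity), add_sub_cancel_right, one_mul, ← mul_assoc]
    gcongr
    rw [show (-p) = (-p - |p|) + |p| by ring, Real.rpow_add ht0]
    rw [show -p - |p| + |p| - |p| = -p - |p| by ring]
    gcongr ?_ * _
    exact Real.rpow_le_rpow_of_nonpos hw (le_of_lt ht) (by linarith [neg_abs_le p])

/-- `Γ(p) Γ(1-p, w)` as a Laplace transform: write `τ^(-p)` as a Gamma integral and interchange. -/
theorem Gamma_mul_integral_Ioi_rpow_neg {p w : ℝ} (hp : 0 < p) (hw : 0 < w) :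
    Real.Gamma p * ∫ τ in Set.Ioi w, τ ^ (-p) * Real.exp (-τ) =
      Real.exp (-w) * ∫ t in Set.Ioi (0 : ℝ), t ^ (p - 1) * Real.exp (-(w * t)) / (1 + t) := by
  have hin : ∀ τ ∈ Set.Ioi w, ∫ t in Set.Ioi (0 : ℝ), t ^ (p - 1) * Real.exp (-(τ * (1 + t))) =
      Real.Gamma p * (τ ^ (-p) * Real.exp (-τ)) := by
    intro τ hτ
    have hτ0 : 0 < τ := hw.trans hτ
    have h1 : ∀ t : ℝ, t ^ (p - 1) * Real.exp (-(τ * (1 + t))) =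
        Real.exp (-τ) * (t ^ (p - 1) * Real.exp (-(τ * t))) := by
      intro t
      rw [show -(τ * (1 + t)) = -τ + -(τ * t) by ring, Real.exp_add]
      ring
    simp only [h1]
    rw [integral_const_mul, Real.integral_rpow_mul_exp_neg_mul_Ioi hp hτ0, one_div,
      Real.inv_rpow hτ0.le, Real.rpow_neg hτ0.le]
    ring
  have hout : ∀ t ∈ Set.Ioi (0 : ℝ), ∫ τ in Set.Ioi w, t ^ (p - 1) * Real.exp (-(τ * (1 + t))) =
      Real.exp (-w) * (t ^ (p - 1) * Real.exp (-(w * t)) / (1 + t)) := by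
    intro t ht
    have ht0 : (0 : ℝ) < 1 + t := by linarith [Set.mem_Ioi.mp ht]
    have h1 : ∀ τ : ℝ, -(τ * (1 + t)) = -(1 + t) * τ := fun τ => by ring
    simp only [h1]
    rw [integral_const_mul, integral_exp_mul_Ioi (by linarith),
      show -(1 + t) * w = -w + -(w * t) by ring, Real.exp_add]
    field_simp
  have hint : Integrable (Function.uncurry fun τ t : ℝ => t ^ (p - 1) * Real.exp (-(τ * (1 + t))))
      ((volume.restrict (Set.Ioi w)).prod (volume.restrict (Set.Ioi 0))) := by
    rw [integrable_prod_iff]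
    · constructor
      · filter_upwards [ae_restrict_mem measurableSet_Ioi] with τ hτ
        have h := (integrableOn_rpow_mul_exp_neg hp (hw.trans hτ)).const_mul (Real.exp (-τ))
        refine h.congr (Eventually.of_forall fun t => ?_)
        simp only [Function.uncurry_apply_pair]
        rw [show -(τ * (1 + t)) = -τ + -(τ * t) by ring, Real.exp_add]
        ring
      · refine ((integrableOn_rpow_neg_mul_exp_neg p hw).const_mul (Real.Gamma p)).congr ?_
        filter_upwards [ae_restrict_mem measurableSet_Ioi] with τ hτ
        rw [← hin τ hτ]
        refine setIntegral_congr_fun measurableSet_Ioi fun t ht => ?_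
        have : 0 < t := ht
        simp only [Function.uncurry_apply_pair]
        rw [Real.norm_of_nonneg (by positivity)]
    · rw [Measure.prod_restrict]
      refine ContinuousOn.aestronglyMeasurable (fun q hq => ?_)
        (measurableSet_Ioi.prod measurableSet_Ioi)
      have : q.2 ≠ 0 := ne_of_gt hq.2
      exact ((continuousAt_snd.rpow_const (Or.inl this)).mul (by fun_prop)).continuousWithinAt
  rw [← integral_const_mul, ← integral_const_mul,
    ← setIntegral_congr_fun measurableSet_Ioi hin, integral_integral_swap hint]
  exact setIntegral_congr_fun measurableSet_Ioi hout

theorem integral_rpow_mul_exp_neg_mul_div_add {p b x : ℝ} (hp : 0 < p) (hb : 0 < b) (hx : 0 < x) :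
    ∫ t in Set.Ioi (0 : ℝ), t ^ (p - 1) * Real.exp (-(b * t)) * (x / (x + t)) =
      x ^ p * Real.exp (b * x) * Real.Gamma p *
        ∫ τ in Set.Ioi (b * x), τ ^ (-p) * Real.exp (-τ) := by
  have h := integral_comp_mul_left_Ioi
    (fun t : ℝ => t ^ (p - 1) * Real.exp (-(b * t)) * (x / (x + t))) 0 hx
  rw [mul_zero, smul_eq_mul, eq_inv_mul_iff_mul_eq₀ hx.ne'] at h
  rw [← h, mul_assoc, Gamma_mul_integral_Ioi_rpow_neg hp (mul_pos hb hx), ← integral_const_mul,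
    ← integral_const_mul, ← integral_const_mul]
  refine setIntegral_congr_fun measurableSet_Ioi fun t ht => ?_
  have ht0 : 0 < t := ht
  rw [Real.mul_rpow hx.le ht0.le, show b * (x * t) = b * x * t by ring, Real.exp_neg (b * x),
    Real.rpow_sub_one hx.ne']
  have h1 : (1 : ℝ) + t ≠ 0 := by positivity
  have h2 : x + x * t = x * (1 + t) := by ring
  rw [h2]
  field_simp

theorem exp_one_sub_mul_sub_exp_eq (p : ℝ) (u : ℝ) :
    Complex.exp ((1 - p) * u - Complex.exp u) =
      ((Real.exp u • ((Real.exp u) ^ (-p) * Real.exp (-Real.exp u)) : ℝ) : ℂ) := by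
  rw [smul_eq_mul, ← Real.exp_mul, ← Real.exp_add, ← Real.exp_add]
  push_cast
  congr 1
  ring

/-- On the real axis `upperGamma` is the usual incomplete Gamma integral: the substitution `τ = exp u`
turns the path from `w` to `1` into a segment of the real line. -/
theorem upperGamma_one_sub_ofReal (p ξ : ℝ) :
    upperGamma (1 - p) ξ =
      ((∫ τ in Set.Ioi (Real.exp ξ), τ ^ (-p) * Real.exp (-τ) : ℝ) : ℂ) := by
  have hI : ∀ a : ℝ, IntegrableOn
      (fun u => Real.exp u • ((Real.exp u) ^ (-p) * Real.exp (-Real.exp u))) (Set.Ioi a) :=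
    fun a => (integrableOn_comp_exp_Ioi (fun τ : ℝ => τ ^ (-p) * Real.exp (-τ)) a).mpr
      (integrableOn_rpow_neg_mul_exp_neg p (Real.exp_pos a))
  have h1 : ∫ t in Set.Ioi (1 : ℝ), (t : ℂ) ^ ((1 - p : ℂ) - 1) * Complex.exp (-(t : ℂ)) =
      ((∫ u in Set.Ioi (0 : ℝ), Real.exp u • ((Real.exp u) ^ (-p) * Real.exp (-Real.exp u)) : ℝ) : ℂ) := by
    rw [integral_comp_exp_Ioi (fun τ : ℝ => τ ^ (-p) * Real.exp (-τ)) 0, Real.exp_zero,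
      ← integral_complex_ofReal]
    refine setIntegral_congr_fun measurableSet_Ioi fun t ht => ?_
    have ht0 : 0 ≤ t := zero_le_one.trans (le_of_lt ht)
    push_cast
    rw [Complex.ofReal_cpow ht0]
    congr 2
    push_cast
    ring
  have h2 : ∫ x in (0 : ℝ)..1, (ξ : ℂ) *
      Complex.exp ((1 - p) * (x * ξ) - Complex.exp (x * ξ)) =
      ((∫ u in (0 : ℝ)..ξ, Real.exp u • ((Real.exp u) ^ (-p) * Real.exp (-Real.exp u)) : ℝ) : ℂ) := by
    have := intervalIntegral.smul_integral_comp_mul_right (a := 0) (b := 1)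
      (fun u : ℝ => Complex.exp ((1 - p) * u - Complex.exp u)) ξ
    rw [zero_mul, one_mul, ← intervalIntegral.integral_smul] at this
    rw [← intervalIntegral.integral_ofReal]
    simp only [← exp_one_sub_mul_sub_exp_eq]
    rw [← this]
    simp
  rw [upperGamma, h1, h2, ← integral_comp_exp_Ioi (fun τ : ℝ => τ ^ (-p) * Real.exp (-τ)) ξ,
    ← intervalIntegral.integral_interval_add_Ioi (hI 0) (hI ξ)]
  push_cast
  ring

theorem differentiable_upperGamma (a : ℂ) : Differentiable ℂ (upperGamma a) := by
  unfold upperGamma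
  refine Differentiable.const_sub ?_ _
  simp only [intervalIntegral.integral_of_le zero_le_one]
  rw [← differentiableOn_univ]
  refine differentiableOn_integral_of_locally_dominated isOpen_univ
    (fun ω _ => Continuous.aestronglyMeasurable (by fun_prop))
    (Eventually.of_forall fun x => Differentiable.differentiableOn (by fun_prop)) fun w _ =>
    ⟨1, one_pos, fun _ => (‖w‖ + 1) * Real.exp (‖a‖ * (‖w‖ + 1) + Real.exp (‖w‖ + 1)),
      integrable_const _, ?_⟩
  filter_upwards [ae_restrict_mem measurableSet_Ioc] with x hx v hv
  have hv' : ‖v‖ ≤ ‖w‖ + 1 := by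
    have h1 := norm_sub_norm_le v w
    rw [Metric.mem_ball, dist_eq_norm] at hv
    linarith
  have hxv : ‖(x : ℂ) * v‖ ≤ ‖w‖ + 1 := by
    rw [norm_mul, Complex.norm_real, Real.norm_of_nonneg hx.1.le]
    nlinarith [hx.1, hx.2, norm_nonneg v]
  rw [norm_mul]
  gcongr
  refine (Complex.norm_exp_le_exp_norm _).trans (Real.exp_le_exp.mpr ?_)
  refine (norm_sub_le _ _).trans (add_le_add ?_ ?_)
  · rw [norm_mul]
    gcongr
  · exact (Complex.norm_exp_le_exp_norm _).trans (Real.exp_le_exp.mpr hxv)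

theorem differentiable_terminantL (p : ℂ) : Differentiable ℂ (terminantL p) := by
  have := differentiable_upperGamma (1 - p)
  unfold terminantL
  fun_prop

/-- The terminant as a Stieltjes transform, valid in the cut plane. -/
theorem integral_rpow_mul_exp_neg_mul_stieltjesKernel {p b : ℝ} (hp : 0 < p) (hb : 0 < b) {ζ : ℂ}
    (hζ : ζ ∈ cutStrip) :
    ∫ t in Set.Ioi (0 : ℝ), ((t ^ (p - 1) * Real.exp (-(b * t)) : ℝ) : ℂ) * stieltjesKernel ζ t =
      ((b ^ p)⁻¹ * Real.Gamma p : ℝ) * terminantL p (ζ + Real.log b) := by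
  have hT := differentiable_terminantL (p : ℂ)
  refine eqOn_of_eventually_eq_ofReal (x₀ := 0)
    (g := fun ζ => ((b ^ p)⁻¹ * Real.Gamma p : ℝ) * terminantL p (ζ + Real.log b))
    isOpen_cutStrip isPreconnected_cutStrip
    (differentiableOn_integral_mul_stieltjesKernel
      (g := fun t : ℝ => ((t ^ (p - 1) * Real.exp (-(b * t)) : ℝ) : ℂ))
      (integrableOn_rpow_mul_exp_neg hp hb).ofReal)
    (Differentiable.differentiableOn ?_) (ofReal_mem_cutStrip 0)
    (Eventually.of_forall fun ξ => ?_) hζ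
  · fun_prop
  · have h1 : ∀ t : ℝ, ((t ^ (p - 1) * Real.exp (-(b * t)) : ℝ) : ℂ) * stieltjesKernel ξ t =
        ((t ^ (p - 1) * Real.exp (-(b * t)) * (Real.exp ξ / (Real.exp ξ + t)) : ℝ) : ℂ) := by
      intro t
      rw [stieltjesKernel]
      push_cast
      ring
    simp only [h1]
    rw [integral_complex_ofReal, integral_rpow_mul_exp_neg_mul_div_add hp hb (Real.exp_pos ξ),
      terminantL, ← Complex.ofReal_add, upperGamma_one_sub_ofReal, ← Complex.ofReal_mul,
      ← Complex.ofReal_exp, ← Complex.ofReal_exp, ← Complex.ofReal_exp, ← Complex.ofReal_mul,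
      ← Complex.ofReal_mul, ← Complex.ofReal_mul, Complex.ofReal_inj]
    have h2 : Real.exp (ξ + Real.log b) = b * Real.exp ξ := by
      rw [Real.exp_add, Real.exp_log hb, mul_comm]
    rw [mul_comm p, Real.exp_mul (ξ + Real.log b), h2, Real.mul_rpow hb.le (Real.exp_pos ξ).le]
    have : b ^ p ≠ 0 := (Real.rpow_pos_of_pos hb p).ne'
    field_simp

/-! ### The scaled complementary error function -/

/-- `∫_0^∞ exp (-y² - 2wy) dy`, which is `(√π / 2) exp (w²) erfc w`. -/
noncomputable def scaledErfc (w : ℂ) : ℂ :=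
  ∫ y in Set.Ioi (0 : ℝ), Complex.exp (-(y : ℂ) ^ 2 - 2 * w * y)

theorem norm_scaledErfc_integrand (w : ℂ) (y : ℝ) :
    ‖Complex.exp (-(y : ℂ) ^ 2 - 2 * w * y)‖ = Real.exp (-y ^ 2 - 2 * w.re * y) := by
  rw [Complex.norm_exp]
  congr 1
  simp [pow_two, Complex.mul_re]

theorem integrableOn_exp_neg_sq_add (c : ℝ) :
    IntegrableOn (fun y : ℝ => Real.exp (-y ^ 2 + c * y)) (Set.Ioi 0) := by
  refine ((integrableOn_exp_neg_Ioi 0).const_mul (Real.exp ((c + 1) ^ 2 / 4))).mono'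
    (Continuous.aestronglyMeasurable (by fun_prop)) (Eventually.of_forall fun y => ?_)
  rw [Real.norm_of_nonneg (Real.exp_pos _).le, ← Real.exp_add]
  refine Real.exp_le_exp.mpr ?_
  nlinarith [sq_nonneg ((c + 1) / 2 - y)]

theorem integrableOn_scaledErfc (w : ℂ) :
    IntegrableOn (fun y : ℝ => Complex.exp (-(y : ℂ) ^ 2 - 2 * w * y)) (Set.Ioi 0) := by
  refine (integrableOn_exp_neg_sq_add (-2 * w.re)).mono'
    (Continuous.aestronglyMeasurable (by fun_prop)) (Eventually.of_forall fun y => ?_)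
  rw [norm_scaledErfc_integrand]
  refine le_of_eq ?_
  ring_nf

theorem differentiable_scaledErfc : Differentiable ℂ scaledErfc := by
  rw [← differentiableOn_univ]
  refine differentiableOn_integral_of_locally_dominated isOpen_univ
    (fun w _ => (integrableOn_scaledErfc w).aestronglyMeasurable)
    (Eventually.of_forall fun y => Differentiable.differentiableOn (by fun_prop)) fun w _ =>
    ⟨1, one_pos, _, integrableOn_exp_neg_sq_add (2 * (‖w‖ + 1)), ?_⟩
  filter_upwards [ae_restrict_mem measurableSet_Ioi] with y hy v hv
  have hy0 : 0 < y := hy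
  have h1 := norm_sub_norm_le v w
  have h2 := Complex.abs_re_le_norm v
  rw [Metric.mem_ball, dist_eq_norm] at hv
  rw [norm_scaledErfc_integrand]
  refine Real.exp_le_exp.mpr ?_
  nlinarith [neg_abs_le v.re]

/-- In the closed right half-plane the scaled complementary error function is `O(1 / (1 + |w|))`,
by integration by parts. -/
theorem exists_bound_scaledErfc :
    ∃ C : ℝ, ∀ w : ℂ, 0 ≤ w.re → (1 + ‖w‖) * ‖scaledErfc w‖ ≤ C := by
  have hle : ∀ w : ℂ, 0 ≤ w.re → ∀ y ∈ Set.Ioi (0 : ℝ),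
      ‖Complex.exp (-(y : ℂ) ^ 2 - 2 * w * y)‖ ≤ Real.exp (-y ^ 2 + 0 * y) := by
    intro w hw y hy
    have hy0 : 0 < y := hy
    rw [norm_scaledErfc_integrand]
    refine Real.exp_le_exp.mpr ?_
    nlinarith [mul_nonneg hw hy0.le]
  have hint : IntegrableOn (fun y : ℝ => 2 * Real.exp (-y ^ 2 + 1 * y)) (Set.Ioi 0) :=
    (integrableOn_exp_neg_sq_add 1).const_mul 2
  set A := ∫ y in Set.Ioi (0 : ℝ), Real.exp (-y ^ 2 + 0 * y) with hA
  set B := ∫ y in Set.Ioi (0 : ℝ), 2 * Real.exp (-y ^ 2 + 1 * y) with hB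
  refine ⟨A + (1 + B) / 2, fun w hw => ?_⟩
  have h1 : ‖scaledErfc w‖ ≤ A := by
    refine norm_integral_le_of_norm_le (integrableOn_exp_neg_sq_add 0) ?_
    filter_upwards [ae_restrict_mem measurableSet_Ioi] with y hy using hle w hw y hy
  have hle2 : ∀ y ∈ Set.Ioi (0 : ℝ), ‖2 * (y : ℂ) * Complex.exp (-(y : ℂ) ^ 2 - 2 * w * y)‖ ≤
      2 * Real.exp (-y ^ 2 + 1 * y) := by
    intro y hy
    have hy0 : 0 < y := hy
    rw [norm_mul, norm_mul, Complex.norm_two, Complex.norm_real, Real.norm_of_nonneg hy0.le,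
      mul_assoc, Real.exp_add, mul_comm (Real.exp _)]
    gcongr
    · rw [one_mul]
      linarith [Real.add_one_le_exp y]
    · simpa using hle w hw y hy
  have hi2 : IntegrableOn (fun y : ℝ => 2 * (y : ℂ) * Complex.exp (-(y : ℂ) ^ 2 - 2 * w * y))
      (Set.Ioi 0) := by
    refine hint.mono' (Continuous.aestronglyMeasurable (by fun_prop)) ?_
    filter_upwards [ae_restrict_mem measurableSet_Ioi] with y hy using hle2 y hy
  have h2 : ‖∫ y in Set.Ioi (0 : ℝ), 2 * (y : ℂ) * Complex.exp (-(y : ℂ) ^ 2 - 2 * w * y)‖ ≤ B := by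
    refine norm_integral_le_of_norm_le hint ?_
    filter_upwards [ae_restrict_mem measurableSet_Ioi] with y hy using hle2 y hy
  have hd : ∀ y : ℝ, HasDerivAt (fun y : ℝ => Complex.exp (-(y : ℂ) ^ 2 - 2 * w * y))
      (-(2 * (y : ℂ) * Complex.exp (-(y : ℂ) ^ 2 - 2 * w * y)) -
        2 * w * Complex.exp (-(y : ℂ) ^ 2 - 2 * w * y)) y := by
    intro y
    have h0 : HasDerivAt (fun s : ℝ => (s : ℂ)) 1 y := Complex.ofRealCLM.hasDerivAt
    refine ((((h0.pow 2).neg).sub (h0.const_mul (2 * w))).cexp).congr_deriv ?_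
    simp only [Pi.sub_apply, Pi.neg_apply, Pi.pow_apply]
    push_cast
    ring
  have ht : Tendsto (fun y : ℝ => Complex.exp (-(y : ℂ) ^ 2 - 2 * w * y)) atTop (𝓝 0) := by
    refine squeeze_zero_norm' (a := fun y : ℝ => Real.exp (-y)) ?_ Real.tendsto_exp_neg_atTop_nhds_zero
    filter_upwards [eventually_ge_atTop 1] with y hy
    rw [norm_scaledErfc_integrand]
    refine Real.exp_le_exp.mpr ?_
    nlinarith [mul_nonneg hw (zero_le_one.trans hy)]
  have hparts := integral_Ioi_of_hasDerivAt_of_tendsto (a := 0) (hd 0).continuousAt.continuousWithinAt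
    (fun y _ => hd y) (hi2.neg.sub ((integrableOn_scaledErfc w).const_mul (2 * w))) ht
  rw [integral_sub (by exact hi2.neg) ((integrableOn_scaledErfc w).const_mul (2 * w)), integral_neg,
    integral_const_mul] at hparts
  have h3 : 2 * w * scaledErfc w =
      1 - ∫ y in Set.Ioi (0 : ℝ), 2 * (y : ℂ) * Complex.exp (-(y : ℂ) ^ 2 - 2 * w * y) := by
    rw [scaledErfc]
    simp only [Complex.ofReal_zero, mul_zero, ne_eq, OfNat.ofNat_ne_zero, not_false_eq_true,
      zero_pow, neg_zero, sub_zero, Complex.exp_zero] at hparts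
    linear_combination -hparts
  have h4 : 2 * (‖w‖ * ‖scaledErfc w‖) ≤ 1 + B := by
    calc 2 * (‖w‖ * ‖scaledErfc w‖) = ‖2 * w * scaledErfc w‖ := by
          rw [norm_mul, norm_mul, Complex.norm_two, mul_assoc]
      _ ≤ 1 + B := by
          rw [h3]
          refine (norm_sub_le _ _).trans ?_
          rw [norm_one]
          linarith
  linarith

/-- At opposite imaginary points the two half-line integrals join to the Fourier transform of a
Gaussian. -/
theorem scaledErfc_mul_I_add (b : ℝ) :
    scaledErfc (b * Complex.I) + scaledErfc (-(b * Complex.I)) =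
      Real.sqrt Real.pi * Complex.exp (-(b : ℂ) ^ 2) := by
  have hg := fourierIntegral_gaussian (b := 1) (by simp) (2 * b : ℂ)
  have hi := integrable_cexp_quadratic (b := 1) (by simp) (-(2 * b * Complex.I)) 0
  have e1 : ∀ y : ℝ, Complex.exp (-1 * (y : ℂ) ^ 2 + -(2 * b * Complex.I) * y + 0) =
      Complex.exp (-(y : ℂ) ^ 2 - 2 * (b * Complex.I) * y) := fun y => by
    congr 1; ring
  simp only [e1] at hi
  have hsplit : ∫ y : ℝ, Complex.exp (-(y : ℂ) ^ 2 - 2 * (b * Complex.I) * y) =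
      scaledErfc (b * Complex.I) + scaledErfc (-(b * Complex.I)) := by
    rw [← intervalIntegral.integral_Iic_add_Ioi (b := 0) hi.integrableOn hi.integrableOn, add_comm,
      scaledErfc, scaledErfc]
    congr 1
    have hr := integral_comp_neg_Ioi (0 : ℝ)
      (fun y : ℝ => Complex.exp (-(y : ℂ) ^ 2 - 2 * (b * Complex.I) * y))
    rw [neg_zero] at hr
    rw [← hr]
    refine setIntegral_congr_fun measurableSet_Ioi fun y _ => ?_
    congr 1
    push_cast
    ring
  have hrefl : ∫ y : ℝ, Complex.exp (-(y : ℂ) ^ 2 - 2 * (b * Complex.I) * y) =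
      ∫ y : ℝ, Complex.exp (Complex.I * (2 * b) * y) * Complex.exp (-1 * (y : ℂ) ^ 2) := by
    rw [← integral_neg_eq_self]
    congr 1
    funext y
    rw [← Complex.exp_add]
    congr 1
    push_cast
    ring
  rw [← hsplit, hrefl, hg, div_one, Real.sqrt_eq_rpow, Complex.ofReal_cpow Real.pi_pos.le]
  push_cast
  congr 2
  ring

/-- The substitution `τ = (y + √c)²`. -/
theorem scaledErfc_sqrt {c : ℝ} (hc : 0 < c) :
    scaledErfc (Real.sqrt c) =
      ((1 / 2 * (Real.exp c * ∫ τ in Set.Ioi c, τ ^ (-(1 / 2) : ℝ) * Real.exp (-τ)) : ℝ) : ℂ) := by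
  set w := Real.sqrt c with hw
  have hw0 : 0 < w := Real.sqrt_pos.mpr hc
  have hw2 : w ^ 2 = c := Real.sq_sqrt hc.le
  have h1 := integral_comp_rpow_Ioi_of_pos'
    (g := fun τ : ℝ => τ ^ (-(1 / 2) : ℝ) * Real.exp (-τ)) two_pos hc.le
  have h2 : c ^ (2 : ℝ)⁻¹ = w := by rw [hw, Real.sqrt_eq_rpow, one_div]
  rw [← h1, h2]
  have h3 : ∀ y ∈ Set.Ioi w, (2 * y ^ ((2 : ℝ) - 1)) • ((y ^ (2 : ℝ)) ^ (-(1 / 2) : ℝ) *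
      Real.exp (-y ^ (2 : ℝ))) = 2 * Real.exp (-y ^ 2) := by
    intro y hy
    have hy0 : 0 < y := hw0.trans hy
    rw [← Real.rpow_mul hy0.le, smul_eq_mul]
    norm_num
    rw [Real.rpow_neg_one]
    field_simp
  rw [setIntegral_congr_fun measurableSet_Ioi h3, integral_const_mul]
  have h4 : ∫ y in Set.Ioi w, Real.exp (-y ^ 2) = ∫ y in Set.Ioi (0 : ℝ), Real.exp (-(y + w) ^ 2) := by
    have := (measurePreserving_add_right volume w).setIntegral_preimage_emb
      (measurableEmbedding_addRight w) (fun y => Real.exp (-y ^ 2)) (Set.Ioi w)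
    rw [← this, Set.preimage_add_const_Ioi, sub_self]
  rw [h4, scaledErfc, show 1 / 2 * (Real.exp c * (2 * ∫ y in Set.Ioi (0 : ℝ),
      Real.exp (-(y + w) ^ 2))) = Real.exp c * ∫ y in Set.Ioi (0 : ℝ),
      Real.exp (-(y + w) ^ 2) by ring, ← integral_const_mul, ← integral_complex_ofReal]
  congr 1
  funext y
  rw [← Real.exp_add, ← hw2]
  push_cast
  congr 1
  ring

/-! ### Shifting the contour -/

theorem tendsto_exp_neg_mul_atTop {δ : ℝ} (hδ : 0 < δ) :
    Tendsto (fun T : ℝ => Real.exp (-(δ * T))) atTop (𝓝 0) :=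
  Real.tendsto_exp_neg_atTop_nhds_zero.comp (tendsto_id.const_mul_atTop hδ)

/-- An entire function that decays exponentially in the strip `0 ≤ Im v ≤ h` has the same integral
over the two edges of the strip. -/
theorem integral_add_mul_I_eq {f : ℂ → ℂ} (hf : Differentiable ℂ f) {B δ h : ℝ} (hδ : 0 < δ)
    (hh : 0 ≤ h)
    (hb : ∀ v : ℂ, 0 ≤ v.im → v.im ≤ h → ‖f v‖ ≤ B * Real.exp (-(δ * |v.re|))) :
    (Integrable fun s : ℝ => f s) ∧ (Integrable fun s : ℝ => f (s + h * Complex.I)) ∧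
      ∫ s : ℝ, f (s + h * Complex.I) = ∫ s : ℝ, f s := by
  have hc := hf.continuous
  have i0 : Integrable fun s : ℝ => f s :=
    ((integrable_exp_neg_mul_abs hδ).const_mul B).mono'
      (Continuous.aestronglyMeasurable (by fun_prop))
      (Eventually.of_forall fun s => by simpa using hb s (by simp) (by simpa))
  have i1 : Integrable fun s : ℝ => f (s + h * Complex.I) :=
    ((integrable_exp_neg_mul_abs hδ).const_mul B).mono'
      (Continuous.aestronglyMeasurable (by fun_prop))
      (Eventually.of_forall fun s => by
        simpa using hb (s + h * Complex.I) (by simpa) (by simp))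
  refine ⟨i0, i1, ?_⟩
  have hB : 0 ≤ B := by
    have := (norm_nonneg _).trans (hb 0 le_rfl hh)
    simpa using this
  have hside : ∀ σ : ℝ, |σ| = 1 → Tendsto (fun T : ℝ => Complex.I •
      ∫ y in (0 : ℝ)..h, f ((σ * T : ℝ) + y * Complex.I)) atTop (𝓝 0) := by
    intro σ hσ
    refine squeeze_zero_norm' (a := fun T : ℝ => B * h * Real.exp (-(δ * T))) ?_
      (by simpa using (tendsto_exp_neg_mul_atTop hδ).const_mul (B * h))
    filter_upwards [eventually_ge_atTop 0] with T hT
    rw [norm_smul, Complex.norm_I, one_mul]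
    refine (intervalIntegral.norm_integral_le_of_norm_le_const
      (C := B * Real.exp (-(δ * T))) fun y hy => ?_).trans (le_of_eq ?_)
    · rw [Set.uIoc_of_le hh] at hy
      have := hb ((σ * T : ℝ) + y * Complex.I) (by simpa using hy.1.le) (by simpa using hy.2)
      simpa [abs_mul, hσ, abs_of_nonneg hT] using this
    · rw [sub_zero, abs_of_nonneg hh]
      ring
  have hrect : ∀ T : ℝ, (∫ x in (-T)..T, f (x + h * Complex.I)) = (∫ x in (-T)..T, f x) +
      Complex.I • (∫ y in (0 : ℝ)..h, f ((1 * T : ℝ) + y * Complex.I)) -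
      Complex.I • (∫ y in (0 : ℝ)..h, f ((-1 * T : ℝ) + y * Complex.I)) := by
    intro T
    have := Complex.integral_boundary_rect_eq_zero_of_differentiableOn f (-T : ℝ)
      ((T : ℂ) + h * Complex.I) hf.differentiableOn
    simp only [Complex.ofReal_re, Complex.ofReal_im, Complex.add_re, Complex.mul_re, Complex.I_re,
      mul_zero, Complex.I_im, mul_one, sub_self, add_zero, Complex.add_im, Complex.mul_im, zero_add,
      Complex.ofReal_zero, zero_mul] at this
    rw [one_mul, neg_one_mul]
    linear_combination -this
  have t1 := intervalIntegral_tendsto_integral i1 tendsto_neg_atTop_atBot tendsto_id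
  have t0 := intervalIntegral_tendsto_integral i0 tendsto_neg_atTop_atBot tendsto_id
  have t2 := (t0.add (hside 1 (by simp))).sub (hside (-1) (by simp))
  rw [add_zero, sub_zero] at t2
  exact tendsto_nhds_unique t1 (t2.congr fun T => (hrect T).symm)

theorem exp_abs_le_one_add_two_mul_abs_sinh (x : ℝ) : Real.exp |x| ≤ 1 + 2 * |Real.sinh x| := by
  rw [Real.abs_sinh, Real.sinh_eq]
  have : Real.exp (-|x|) ≤ 1 := Real.exp_le_one_iff.mpr (by simp)
  linarith

theorem re_cosh (v : ℂ) : (Complex.cosh v).re = Real.cosh v.re * Real.cos v.im := by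
  conv_lhs => rw [← Complex.re_add_im v]
  rw [Complex.cosh_add, Complex.cosh_mul_I, Complex.sinh_mul_I]
  simp [Complex.mul_re, Complex.mul_im, Complex.cosh_ofReal_re, Complex.sinh_ofReal_re,
    Complex.cos_ofReal_re, Complex.sin_ofReal_re]

theorem im_cosh (v : ℂ) : (Complex.cosh v).im = Real.sinh v.re * Real.sin v.im := by
  conv_lhs => rw [← Complex.re_add_im v]
  rw [Complex.cosh_add, Complex.cosh_mul_I, Complex.sinh_mul_I]
  simp [Complex.mul_re, Complex.mul_im, Complex.cosh_ofReal_re, Complex.sinh_ofReal_re,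
    Complex.cos_ofReal_re, Complex.sin_ofReal_re]

theorem abs_sinh_re_le_norm_cosh (v : ℂ) : |Real.sinh v.re| ≤ ‖Complex.cosh v‖ := by
  refine Real.le_sqrt_of_sq_le ?_
  rw [Complex.normSq_apply, re_cosh, im_cosh, sq_abs]
  have h1 := Real.cosh_sq v.re
  have h2 := Real.sin_sq_add_cos_sq v.im
  have h3 : Real.cosh v.re * Real.cos v.im * (Real.cosh v.re * Real.cos v.im) +
      Real.sinh v.re * Real.sin v.im * (Real.sinh v.re * Real.sin v.im) =
      Real.sinh v.re ^ 2 + Real.cos v.im ^ 2 := by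
    linear_combination Real.cos v.im ^ 2 * h1 + Real.sinh v.re ^ 2 * h2
  nlinarith [sq_nonneg (Real.cos v.im)]

/-- The integrand decays like `exp (-(1/2 - |Re ν|) |Re v|)` in the strip `0 ≤ Im v ≤ π`, where
`Re cosh (v/2) ≥ 0`. This is where `|Re ν| < 1/2` is needed. -/
theorem exists_bound_exp_mul_scaledErfc_cosh (ν : ℂ) {a : ℝ} (ha : 0 < a) :
    ∃ B : ℝ, ∀ v : ℂ, 0 ≤ v.im → v.im ≤ Real.pi →
      ‖Complex.exp (ν * v) * scaledErfc (a * Complex.cosh (v / 2))‖ ≤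
        B * Real.exp (-((1 / 2 - |ν.re|) * |v.re|)) := by
  obtain ⟨C, hC⟩ := exists_bound_scaledErfc
  refine ⟨Real.exp (|ν.im| * Real.pi) * ((1 + 2 / a) * C), fun v h0 hpi => ?_⟩
  set w : ℂ := a * Complex.cosh (v / 2) with hw
  have hvre : (v / 2).re = v.re / 2 := Complex.div_ofNat_re v 2
  have hvim : (v / 2).im = v.im / 2 := Complex.div_ofNat_im v 2
  have hwre : 0 ≤ w.re := by
    rw [hw, Complex.re_ofReal_mul, re_cosh, hvim]
    have : 0 ≤ Real.cos (v.im / 2) :=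
      Real.cos_nonneg_of_mem_Icc ⟨by linarith [Real.pi_pos], by linarith⟩
    have := Real.cosh_pos (v / 2).re
    positivity
  have hE := hC w hwre
  have hwn : a * |Real.sinh (v.re / 2)| ≤ ‖w‖ := by
    rw [hw, norm_mul, Complex.norm_real, Real.norm_of_nonneg ha.le, ← hvre]
    gcongr
    exact abs_sinh_re_le_norm_cosh _
  have h1 : Real.exp (|v.re| / 2) * ‖scaledErfc w‖ ≤ (1 + 2 / a) * C := by
    have h2 : Real.exp (|v.re| / 2) ≤ 1 + 2 / a * ‖w‖ := by
      have h3 := exp_abs_le_one_add_two_mul_abs_sinh (v.re / 2)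
      rw [abs_div, abs_two] at h3
      refine h3.trans ?_
      have h4 : |Real.sinh (v.re / 2)| ≤ ‖w‖ / a := by
        rw [le_div_iff₀ ha]
        linarith
      calc 1 + 2 * |Real.sinh (v.re / 2)| ≤ 1 + 2 * (‖w‖ / a) := by gcongr
        _ = 1 + 2 / a * ‖w‖ := by ring
    have h5 : 1 + 2 / a * ‖w‖ ≤ (1 + 2 / a) * (1 + ‖w‖) := by
      have : 0 < 2 / a := by positivity
      nlinarith [norm_nonneg w]
    calc Real.exp (|v.re| / 2) * ‖scaledErfc w‖
        ≤ ((1 + 2 / a) * (1 + ‖w‖)) * ‖scaledErfc w‖ := by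
          gcongr
          exact h2.trans h5
      _ = (1 + 2 / a) * ((1 + ‖w‖) * ‖scaledErfc w‖) := by ring
      _ ≤ (1 + 2 / a) * C := by gcongr
  have h6 : ‖Complex.exp (ν * v)‖ ≤ Real.exp (|ν.im| * Real.pi) * Real.exp (|ν.re| * |v.re|) := by
    rw [Complex.norm_exp, ← Real.exp_add, Complex.mul_re]
    refine Real.exp_le_exp.mpr ?_
    have h7 : ν.re * v.re ≤ |ν.re| * |v.re| := (le_abs_self _).trans (abs_mul _ _).le
    have h8 : -(ν.im * v.im) ≤ |ν.im| * Real.pi := by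
      nlinarith [neg_abs_le ν.im, abs_nonneg ν.im]
    linarith
  rw [norm_mul]
  calc ‖Complex.exp (ν * v)‖ * ‖scaledErfc w‖
      ≤ Real.exp (|ν.im| * Real.pi) * Real.exp (|ν.re| * |v.re|) * ‖scaledErfc w‖ := by gcongr
    _ = Real.exp (|ν.im| * Real.pi) * (Real.exp (|v.re| / 2) * ‖scaledErfc w‖) *
        Real.exp (-((1 / 2 - |ν.re|) * |v.re|)) := by
      have : Real.exp (|ν.re| * |v.re|) =
          Real.exp (|v.re| / 2) * Real.exp (-((1 / 2 - |ν.re|) * |v.re|)) := by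
        rw [← Real.exp_add]
        congr 1
        ring
      rw [this]
      ring
    _ ≤ _ := by gcongr

/-- Shifting the contour by `±πi` turns the factor `cos (πν)` into the sum of two values of the
scaled complementary error function at opposite imaginary points, which is a Gaussian. -/
theorem cos_mul_integral_exp_mul_scaledErfc {ν : ℂ} (hν : |ν.re| < 1 / 2) {a : ℝ} (ha : 0 < a) :
    Complex.cos (Real.pi * ν) * ∫ s : ℝ, Complex.exp (ν * s) * scaledErfc (a * Real.cosh (s / 2)) =
      Real.sqrt Real.pi / 2 *
        ∫ s : ℝ, Complex.exp (ν * s) * Complex.exp (-((a * Real.sinh (s / 2) : ℝ) : ℂ) ^ 2) := by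
  have key : ∀ μ : ℂ, |μ.re| < 1 / 2 →
      (Integrable fun s : ℝ => Complex.exp (Real.pi * μ * Complex.I) * (Complex.exp (μ * s) *
        scaledErfc ((a * Real.sinh (s / 2) : ℝ) * Complex.I))) ∧
      ∫ s : ℝ, Complex.exp (Real.pi * μ * Complex.I) * (Complex.exp (μ * s) *
        scaledErfc ((a * Real.sinh (s / 2) : ℝ) * Complex.I)) =
      ∫ s : ℝ, Complex.exp (μ * s) * scaledErfc (a * Real.cosh (s / 2)) := by
    intro μ hμ
    obtain ⟨B, hB⟩ := exists_bound_exp_mul_scaledErfc_cosh μ ha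
    have hf : Differentiable ℂ fun v : ℂ =>
        Complex.exp (μ * v) * scaledErfc (a * Complex.cosh (v / 2)) := by
      have h1 : Differentiable ℂ fun v : ℂ => (a : ℂ) * Complex.cosh (v / 2) := by fun_prop
      exact Differentiable.mul (by fun_prop) (differentiable_scaledErfc.comp h1)
    obtain ⟨-, h1, h2⟩ := integral_add_mul_I_eq hf (sub_pos.mpr hμ) Real.pi_pos.le hB
    have e : ∀ s : ℝ, Complex.exp (μ * (s + Real.pi * Complex.I)) *
        scaledErfc (a * Complex.cosh ((s + Real.pi * Complex.I) / 2)) =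
        Complex.exp (Real.pi * μ * Complex.I) * (Complex.exp (μ * s) *
        scaledErfc ((a * Real.sinh (s / 2) : ℝ) * Complex.I)) := by
      intro s
      rw [← mul_assoc, ← Complex.exp_add]
      congr 2
      · ring
      · rw [show ((s : ℂ) + Real.pi * Complex.I) / 2 = s / 2 + (Real.pi / 2 : ℂ) * Complex.I by ring,
          Complex.cosh_add, Complex.cosh_mul_I, Complex.sinh_mul_I, Complex.cos_pi_div_two,
          Complex.sin_pi_div_two]
        push_cast
        ring
    simp only [e] at h1 h2
    refine ⟨h1, h2.trans ?_⟩
    refine integral_congr_ae (Eventually.of_forall fun s => ?_)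
    simp only
    push_cast
    rfl
  obtain ⟨i1, h1⟩ := key ν hν
  obtain ⟨i2, h2⟩ := key (-ν) (by simpa using hν)
  have hneg1 : ∫ s : ℝ, Complex.exp (-ν * s) * scaledErfc (a * Real.cosh (s / 2)) =
      ∫ s : ℝ, Complex.exp (ν * s) * scaledErfc (a * Real.cosh (s / 2)) := by
    rw [← integral_neg_eq_self]
    congr 1
    funext s
    rw [neg_div, Real.cosh_neg]
    push_cast
    rw [neg_mul_neg]
  have e2 : ∀ s : ℝ, Complex.exp (Real.pi * -ν * Complex.I) * (Complex.exp (-ν * (-s : ℝ)) *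
        scaledErfc ((a * Real.sinh ((-s) / 2) : ℝ) * Complex.I)) =
      Complex.exp (-(Real.pi * ν * Complex.I)) * (Complex.exp (ν * s) *
        scaledErfc (-((a * Real.sinh (s / 2) : ℝ) * Complex.I))) := by
    intro s
    rw [neg_div, Real.sinh_neg]
    congr 2
    · ring
    · congr 1; push_cast; ring
    · congr 1; push_cast; ring
  rw [hneg1, ← integral_neg_eq_self] at h2
  replace i2 := i2.comp_neg
  simp only [e2] at h2 i2
  rw [integral_const_mul] at h1 h2
  have i1' : Integrable fun s : ℝ => Complex.exp (ν * s) *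
      scaledErfc ((a * Real.sinh (s / 2) : ℝ) * Complex.I) := by
    refine (i1.const_mul (Complex.exp (-(Real.pi * ν * Complex.I)))).congr
      (Eventually.of_forall fun s => ?_)
    simp only
    rw [← mul_assoc, ← Complex.exp_add, neg_add_cancel, Complex.exp_zero, one_mul]
  have i2' : Integrable fun s : ℝ => Complex.exp (ν * s) *
      scaledErfc (-((a * Real.sinh (s / 2) : ℝ) * Complex.I)) := by
    refine (i2.const_mul (Complex.exp (Real.pi * ν * Complex.I))).congr
      (Eventually.of_forall fun s => ?_)
    simp only
    rw [← mul_assoc, ← Complex.exp_add, add_neg_cancel, Complex.exp_zero, one_mul]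
  set A := ∫ s : ℝ, Complex.exp (ν * s) * scaledErfc (a * Real.cosh (s / 2)) with hA
  have hsum : (∫ s : ℝ, Complex.exp (ν * s) * scaledErfc ((a * Real.sinh (s / 2) : ℝ) * Complex.I)) +
      (∫ s : ℝ, Complex.exp (ν * s) * scaledErfc (-((a * Real.sinh (s / 2) : ℝ) * Complex.I))) =
      Real.sqrt Real.pi *
        ∫ s : ℝ, Complex.exp (ν * s) * Complex.exp (-((a * Real.sinh (s / 2) : ℝ) : ℂ) ^ 2) := by
    rw [← integral_add i1' i2', ← integral_const_mul]
    congr 1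
    funext s
    rw [← mul_add, scaledErfc_mul_I_add]
    ring
  have hE : Complex.exp (Real.pi * ν * Complex.I) * Complex.exp (-(Real.pi * ν * Complex.I)) = 1 := by
    rw [← Complex.exp_add, add_neg_cancel, Complex.exp_zero]
  have hcos : Complex.cos (Real.pi * ν) = (Complex.exp (Real.pi * ν * Complex.I) +
      Complex.exp (-(Real.pi * ν * Complex.I))) / 2 := by
    rw [Complex.cos, neg_mul]
  set P := Complex.exp (Real.pi * ν * Complex.I)
  set Q := Complex.exp (-(Real.pi * ν * Complex.I))
  rw [hcos]
  linear_combination (1 / 2) * hsum - Q / 2 * h1 - P / 2 * h2 +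
    (1 / 2) * ((∫ s : ℝ, Complex.exp (ν * s) * scaledErfc ((a * Real.sinh (s / 2) : ℝ) * Complex.I)) +
      (∫ s : ℝ, Complex.exp (ν * s) * scaledErfc (-((a * Real.sinh (s / 2) : ℝ) * Complex.I)))) * hE

/-- `K_ν(x)` as a superposition of the Stieltjes transforms of `t^(-1/2) exp (-(1 + cosh s) t)`,
which is the case `N = 0` of the Stieltjes representation with the order of integration
exchanged. Since `1 + cosh s = 2 cosh² (s/2)`, each of these transforms is a value of the scaled
complementary error function at a multiple of `cosh (s/2)`. -/
theorem cos_mul_integral_stieltjes_eq_macdonaldIntegral {ν : ℂ} (hν : |ν.re| < 1 / 2) {x : ℝ}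
    (hx : 0 < x) :
    Complex.cos (Real.pi * ν) * ∫ s : ℝ, Complex.exp (ν * s) *
      ((∫ t in Set.Ioi (0 : ℝ), t ^ ((1 / 2 : ℝ) - 1) * Real.exp (-((1 + Real.cosh s) * t)) *
        (x / (x + t)) : ℝ) : ℂ) =
      2 * Real.pi * Real.sqrt x * Real.exp x * macdonaldIntegral ν x := by
  set a := Real.sqrt (2 * x) with ha
  have ha0 : 0 < a := Real.sqrt_pos.mpr (by positivity)
  have ha2 : a ^ 2 = 2 * x := Real.sq_sqrt (by positivity)
  have h1 : ∀ s : ℝ, Complex.exp (ν * s) *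
      ((∫ t in Set.Ioi (0 : ℝ), t ^ ((1 / 2 : ℝ) - 1) * Real.exp (-((1 + Real.cosh s) * t)) *
        (x / (x + t)) : ℝ) : ℂ) = 2 * Real.sqrt x * Real.sqrt Real.pi *
        (Complex.exp (ν * s) * scaledErfc (a * Real.cosh (s / 2))) := by
    intro s
    have hc : 0 < 1 + Real.cosh s := by linarith [Real.cosh_pos s]
    have hch : 1 + Real.cosh s = 2 * Real.cosh (s / 2) ^ 2 := by
      have h2 := Real.cosh_two_mul (s / 2)
      have h3 := Real.cosh_sq (s / 2)
      rw [show 2 * (s / 2) = s by ring] at h2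
      linarith
    have hw : a * Real.cosh (s / 2) = Real.sqrt ((1 + Real.cosh s) * x) := by
      rw [hch, show 2 * Real.cosh (s / 2) ^ 2 * x = 2 * x * Real.cosh (s / 2) ^ 2 by ring,
        Real.sqrt_mul (by positivity), Real.sqrt_sq (Real.cosh_pos _).le]
    rw [← Complex.ofReal_mul, hw, scaledErfc_sqrt (mul_pos hc hx),
      integral_rpow_mul_exp_neg_mul_div_add (by norm_num) hc hx, Real.Gamma_one_half_eq,
      ← Real.sqrt_eq_rpow]
    push_cast
    ring
  have h2 : ∀ s : ℝ, Complex.exp (ν * s) * Complex.exp (-((a * Real.sinh (s / 2) : ℝ) : ℂ) ^ 2) =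
      Complex.exp x * Complex.exp (ν * s - x * Real.cosh s) := by
    intro s
    have h3 : (a * Real.sinh (s / 2)) ^ 2 = x * (Real.cosh s - 1) := by
      have h4 := Real.cosh_two_mul (s / 2)
      have h5 := Real.cosh_sq (s / 2)
      rw [show 2 * (s / 2) = s by ring] at h4
      rw [mul_pow, ha2]
      linear_combination -x * h4 - x * h5
    rw [← Complex.exp_add, ← Complex.exp_add, ← Complex.ofReal_pow, h3]
    congr 1
    push_cast
    ring
  simp only [h1]
  have h3 := cos_mul_integral_exp_mul_scaledErfc hν ha0
  simp only [h2] at h3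
  rw [integral_const_mul] at h3 ⊢
  have hpi : (Real.sqrt Real.pi : ℂ) * Real.sqrt Real.pi = Real.pi := by
    rw [← Complex.ofReal_mul, Real.mul_self_sqrt Real.pi_pos.le]
  rw [macdonaldIntegral, Complex.ofReal_exp]
  linear_combination 2 * Real.sqrt x * Real.sqrt Real.pi * h3 +
    Real.sqrt x * Complex.exp x * (∫ s : ℝ, Complex.exp (ν * s - x * Real.cosh s)) * hpi

/-! ### Weighted integrals of `K_ν` over the half-line -/

theorem norm_exp_mul_sub_cosh (ν : ℂ) (x s : ℝ) :
    ‖Complex.exp (ν * s - x * Real.cosh s)‖ = Real.exp (ν.re * s - x * Real.cosh s) := by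
  rw [Complex.norm_exp]
  congr 1
  simp [-Complex.ofReal_cosh]

theorem integrable_exp_mul_sub_cosh (ν : ℂ) {x : ℝ} (hx : 0 < x) :
    Integrable fun s : ℝ => Complex.exp (ν * s - x * Real.cosh s) := by
  refine (integrable_exp_mul_abs_sub_cosh |ν.re| hx).mono'
    (Continuous.aestronglyMeasurable (by fun_prop)) (Eventually.of_forall fun s => ?_)
  rw [norm_exp_mul_sub_cosh]
  refine Real.exp_le_exp.mpr ?_
  have : ν.re * s ≤ |ν.re| * |s| := (le_abs_self _).trans (abs_mul _ _).le
  linarith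

theorem macdonaldIntegral_ofReal (σ x : ℝ) :
    macdonaldIntegral σ x = ((1 / 2 * ∫ s : ℝ, Real.exp (σ * s - x * Real.cosh s) : ℝ) : ℂ) := by
  rw [macdonaldIntegral, Complex.ofReal_mul, ← integral_complex_ofReal]
  congr 1
  · norm_num
  · congr 1
    funext s
    push_cast
    rfl

theorem norm_macdonaldIntegral_le (ν : ℂ) (x : ℝ) :
    ‖macdonaldIntegral ν x‖ ≤ (macdonaldIntegral ν.re x).re := by
  rw [macdonaldIntegral_ofReal, Complex.ofReal_re, macdonaldIntegral, norm_mul]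
  gcongr
  · norm_num
  · refine (norm_integral_le_integral_norm _).trans (le_of_eq ?_)
    simp only [norm_exp_mul_sub_cosh]

/-- Up to the factor `2`, `K_σ(x)` is increasing in `|σ|`; this dominates `K_ν` locally uniformly in
the order. -/
theorem macdonaldIntegral_re_le {σ b x : ℝ} (hσ : |σ| ≤ b) (hx : 0 < x) :
    (macdonaldIntegral σ x).re ≤ 2 * (macdonaldIntegral b x).re := by
  have hI : ∀ c : ℝ, Integrable fun s : ℝ => Real.exp (c * s - x * Real.cosh s) := fun c => by
    simpa only [norm_exp_mul_sub_cosh, Complex.ofReal_re] using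
      (integrable_exp_mul_sub_cosh c hx).norm
  have hneg := macdonaldIntegral_neg b x
  rw [← Complex.ofReal_neg] at hneg
  have h2 : 2 * (macdonaldIntegral b x).re =
      (macdonaldIntegral b x).re + (macdonaldIntegral (-b : ℝ) x).re := by rw [hneg, two_mul]
  rw [h2]
  simp only [macdonaldIntegral_ofReal, Complex.ofReal_re]
  rw [← mul_add, ← integral_add (hI _) (hI _)]
  refine mul_le_mul_of_nonneg_left (integral_mono (hI _) ((hI _).add (hI _)) fun s => ?_)
    (by norm_num)
  have hb := abs_le.mp hσ
  simp only
  rcases le_total 0 s with hs | hs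
  · refine le_add_of_le_of_nonneg (Real.exp_le_exp.mpr ?_) (Real.exp_pos _).le
    nlinarith
  · refine le_add_of_nonneg_of_le (Real.exp_pos _).le (Real.exp_le_exp.mpr ?_)
    nlinarith

theorem integrable_exp_mul_one_add_cosh_rpow {σ p : ℝ} (hσ : |σ| < p) :
    Integrable fun s : ℝ => Real.exp (σ * s) * (1 + Real.cosh s) ^ (-p) := by
  have hp : 0 < p := (abs_nonneg σ).trans_lt hσ
  refine ((integrable_exp_neg_mul_abs (sub_pos.mpr hσ)).const_mul (2 ^ p)).mono' ?_
    (Eventually.of_forall fun s => ?_)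
  · refine Continuous.aestronglyMeasurable (Continuous.mul (by fun_prop) ?_)
    refine Continuous.rpow_const (by fun_prop) fun s => Or.inl ?_
    linarith [Real.cosh_pos s]
  · have hc := Real.cosh_pos s
    rw [Real.norm_of_nonneg (by positivity)]
    have h1 : Real.exp |s| / 2 ≤ 1 + Real.cosh s := by linarith [exp_abs_le_two_mul_cosh s]
    have h2 : (1 + Real.cosh s) ^ (-p) ≤ 2 ^ p * Real.exp (-(p * |s|)) := by
      refine (Real.rpow_le_rpow_of_nonpos (by positivity) h1 (by linarith)).trans (le_of_eq ?_)
      rw [Real.div_rpow (Real.exp_pos _).le two_pos.le, ← Real.exp_mul, Real.rpow_neg two_pos.le,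
        div_inv_eq_mul, mul_comm]
      congr 2
      ring
    have h3 : σ * s ≤ |σ| * |s| := (le_abs_self _).trans (abs_mul _ _).le
    calc Real.exp (σ * s) * (1 + Real.cosh s) ^ (-p)
        ≤ Real.exp (|σ| * |s|) * (2 ^ p * Real.exp (-(p * |s|))) := by gcongr
      _ = 2 ^ p * Real.exp (-((p - |σ|) * |s|)) := by
          rw [mul_left_comm, ← Real.exp_add]
          congr 2
          ring

theorem integral_rpow_mul_exp_one_add_cosh {p : ℝ} (hp : 0 < p) (s : ℝ) :
    ∫ t in Set.Ioi (0 : ℝ), t ^ (p - 1) * Real.exp (-((1 + Real.cosh s) * t)) =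
      Real.Gamma p * (1 + Real.cosh s) ^ (-p) := by
  have hc : 0 < 1 + Real.cosh s := by linarith [Real.cosh_pos s]
  rw [Real.integral_rpow_mul_exp_neg_mul_Ioi hp hc, one_div, Real.inv_rpow hc.le,
    Real.rpow_neg hc.le, mul_comm]

theorem integrable_prod_macdonald {ν : ℂ} {p : ℝ} (hν : |ν.re| < p) :
    Integrable (Function.uncurry fun s t : ℝ => Complex.exp (ν * s) *
      ((t ^ (p - 1) * Real.exp (-((1 + Real.cosh s) * t)) : ℝ) : ℂ))
      (volume.prod (volume.restrict (Set.Ioi 0))) := by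
  have hp : 0 < p := (abs_nonneg _).trans_lt hν
  rw [integrable_prod_iff]
  · constructor
    · refine Eventually.of_forall fun s => ?_
      have hc : 0 < 1 + Real.cosh s := by linarith [Real.cosh_pos s]
      exact ((integrableOn_rpow_mul_exp_neg hp hc).ofReal (𝕜 := ℂ)).const_mul (Complex.exp (ν * s))
    · refine ((integrable_exp_mul_one_add_cosh_rpow hν).const_mul (Real.Gamma p)).congr
        (Eventually.of_forall fun s => ?_)
      have h1 : ∀ t ∈ Set.Ioi (0 : ℝ), ‖Complex.exp (ν * s) *
          ((t ^ (p - 1) * Real.exp (-((1 + Real.cosh s) * t)) : ℝ) : ℂ)‖ =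
          Real.exp (ν.re * s) * (t ^ (p - 1) * Real.exp (-((1 + Real.cosh s) * t))) := by
        intro t ht
        have ht0 : 0 < t := ht
        rw [norm_mul, Complex.norm_real, Real.norm_of_nonneg (by positivity), Complex.norm_exp,
          Complex.re_mul_ofReal]
      simp only [Function.uncurry_apply_pair]
      rw [setIntegral_congr_fun measurableSet_Ioi h1, integral_const_mul,
        integral_rpow_mul_exp_one_add_cosh hp]
      ring
  · have : (volume : Measure ℝ).prod (volume.restrict (Set.Ioi (0 : ℝ))) =
        ((volume : Measure ℝ).prod volume).restrict (Set.univ ×ˢ Set.Ioi 0) := by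
      rw [← Measure.prod_restrict, Measure.restrict_univ]
    rw [this]
    refine ContinuousOn.aestronglyMeasurable (fun q hq => ?_)
      (MeasurableSet.univ.prod measurableSet_Ioi)
    have : q.2 ≠ 0 := ne_of_gt hq.2
    refine ContinuousAt.continuousWithinAt (ContinuousAt.mul (by fun_prop) ?_)
    refine Complex.continuous_ofReal.continuousAt.comp (ContinuousAt.mul ?_ (by fun_prop))
    exact continuousAt_snd.rpow_const (Or.inl this)

/-- Integration of `K_ν` against `t^(p-1) e^(-t) h(t)` with a bounded function `h`, by Fubini. -/
theorem integral_rpow_mul_exp_mul_macdonald {ν : ℂ} {p : ℝ} (hν : |ν.re| < p) {h : ℝ → ℂ} {C : ℝ}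
    (hm : AEStronglyMeasurable h (volume.restrict (Set.Ioi 0)))
    (hC : ∀ t ∈ Set.Ioi (0 : ℝ), ‖h t‖ ≤ C) :
    IntegrableOn (fun t : ℝ => ((t ^ (p - 1) * Real.exp (-t) : ℝ) : ℂ) * macdonaldIntegral ν t * h t)
        (Set.Ioi 0) ∧
      ∫ t in Set.Ioi (0 : ℝ), ((t ^ (p - 1) * Real.exp (-t) : ℝ) : ℂ) * macdonaldIntegral ν t * h t =
        1 / 2 * ∫ s : ℝ, Complex.exp (ν * s) * ∫ t in Set.Ioi (0 : ℝ),
          ((t ^ (p - 1) * Real.exp (-((1 + Real.cosh s) * t)) : ℝ) : ℂ) * h t := by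
  have hI : Integrable (Function.uncurry fun s t : ℝ => Complex.exp (ν * s) *
      ((t ^ (p - 1) * Real.exp (-((1 + Real.cosh s) * t)) : ℝ) : ℂ) * h t)
      (volume.prod (volume.restrict (Set.Ioi 0))) := by
    refine (integrable_prod_macdonald hν).mul_bdd (g := fun q : ℝ × ℝ => h q.2) (c := C) hm.comp_snd ?_
    have := Measure.quasiMeasurePreserving_snd (μ := (volume : Measure ℝ))
      (ν := volume.restrict (Set.Ioi (0 : ℝ)))
    exact this.ae (p := fun t => ‖h t‖ ≤ C)
      ((ae_restrict_mem measurableSet_Ioi).mono fun t ht => hC t ht)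
  have hinner : ∀ t ∈ Set.Ioi (0 : ℝ), ∫ s : ℝ, Complex.exp (ν * s) *
      ((t ^ (p - 1) * Real.exp (-((1 + Real.cosh s) * t)) : ℝ) : ℂ) * h t =
      2 * (((t ^ (p - 1) * Real.exp (-t) : ℝ) : ℂ) * macdonaldIntegral ν t * h t) := by
    intro t _
    have h1 : ∀ s : ℝ, Complex.exp (ν * s) *
        ((t ^ (p - 1) * Real.exp (-((1 + Real.cosh s) * t)) : ℝ) : ℂ) * h t =
        ((t ^ (p - 1) * Real.exp (-t) : ℝ) : ℂ) * h t * Complex.exp (ν * s - t * Real.cosh s) := by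
      intro s
      have h2 : Real.exp (-((1 + Real.cosh s) * t)) = Real.exp (-t) * Real.exp (-(t * Real.cosh s)) := by
        rw [← Real.exp_add]; congr 1; ring
      have h3 : Complex.exp (ν * s - t * Real.cosh s) =
          Complex.exp (ν * s) * (Real.exp (-(t * Real.cosh s)) : ℝ) := by
        rw [Complex.ofReal_exp, ← Complex.exp_add]; congr 1; push_cast; ring
      rw [h2, h3]
      push_cast
      ring
    simp only [h1]
    rw [integral_const_mul, macdonaldIntegral]
    ring
  have hfub := integral_integral_swap hI
  rw [setIntegral_congr_fun measurableSet_Ioi hinner, integral_const_mul] at hfub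
  constructor
  · have := (hI.integral_prod_right).const_mul (1 / 2 : ℂ)
    refine this.congr ?_
    filter_upwards [ae_restrict_mem measurableSet_Ioi] with t ht
    simp only [Function.uncurry_apply_pair]
    rw [hinner t ht]
    ring
  · have h4 : ∀ s : ℝ, ∫ t in Set.Ioi (0 : ℝ), Complex.exp (ν * s) *
        ((t ^ (p - 1) * Real.exp (-((1 + Real.cosh s) * t)) : ℝ) : ℂ) * h t =
        Complex.exp (ν * s) * ∫ t in Set.Ioi (0 : ℝ),
          ((t ^ (p - 1) * Real.exp (-((1 + Real.cosh s) * t)) : ℝ) : ℂ) * h t := by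
      intro s
      rw [← integral_const_mul]
      simp only [mul_assoc]
    simp only [h4] at hfub
    rw [hfub]
    ring

theorem integrableOn_rpow_mul_exp_mul_macdonald {ν : ℂ} {p : ℝ} (hν : |ν.re| < p) :
    IntegrableOn (fun t : ℝ => ((t ^ (p - 1) * Real.exp (-t) : ℝ) : ℂ) * macdonaldIntegral ν t)
      (Set.Ioi 0) := by
  simpa using (integral_rpow_mul_exp_mul_macdonald hν (h := fun _ => 1) (C := 1)
    aestronglyMeasurable_const (by simp)).1

/-! ### The moments of `K_ν` and the coefficients `a_n(ν)` -/

/-- With `x = 1 / (1 + e^(-s))`, one has `x (1 - x) = 1 / (2 (1 + cosh s))` and `x / (1 - x) = e^s`, so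
that this substitution turns the Beta integral into an integral over the line. -/
theorem sigmoid_cpow_mul_one_sub_sigmoid_cpow (ν : ℂ) (p s : ℝ) :
    (Real.sigmoid s * (1 - Real.sigmoid s)) • ((Real.sigmoid s : ℂ) ^ ((p + ν : ℂ) - 1) *
      (1 - Real.sigmoid s : ℂ) ^ ((p - ν : ℂ) - 1)) =
      ((2 ^ (-p) : ℝ) : ℂ) * (Complex.exp (ν * s) * ((1 + Real.cosh s) ^ (-p) : ℝ)) := by
  set x := Real.sigmoid s with hx
  have hx0 : 0 < x := Real.sigmoid_pos s
  have hx1 : 0 < 1 - x := by linarith [Real.sigmoid_lt_one s]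
  have hc : 0 < 1 + Real.cosh s := by linarith [Real.cosh_pos s]
  have hs : s = Real.log x - Real.log (1 - x) := by
    rw [← Real.log_div hx0.ne' hx1.ne', ← Real.sigmoid_neg, hx, ← Real.sigmoid_mul_rexp_neg]
    rw [div_mul_cancel_left₀ hx0.ne', Real.exp_neg, inv_inv, Real.log_exp]
  have hcosh : Real.log 2 + Real.log (1 + Real.cosh s) = -(Real.log x + Real.log (1 - x)) := by
    rw [← Real.log_mul two_ne_zero hc.ne', ← Real.log_mul hx0.ne' hx1.ne', ← Real.log_inv]
    congr 1
    rw [hx, Real.sigmoid_def, Real.cosh_eq, Real.exp_neg]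
    have := Real.exp_pos s
    field_simp
    ring
  have e1 : ((2 ^ (-p) : ℝ) : ℂ) * ((1 + Real.cosh s) ^ (-p) : ℝ) =
      Complex.exp (p * (Real.log x + Real.log (1 - x))) := by
    rw [← Complex.ofReal_mul, Real.rpow_def_of_pos two_pos, Real.rpow_def_of_pos hc, ← Real.exp_add,
      Complex.ofReal_exp]
    congr 1
    rw [← add_mul, hcosh]
    push_cast
    ring
  have e2 : ((1 : ℂ) - (x : ℂ)) = ((1 - x : ℝ) : ℂ) := by push_cast; rfl
  have hx0' : (x : ℂ) ≠ 0 := by exact_mod_cast hx0.ne'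
  have hx1' : ((1 - x : ℝ) : ℂ) ≠ 0 := by exact_mod_cast hx1.ne'
  rw [mul_left_comm, e1, ← Complex.exp_add, e2,
    Complex.cpow_sub _ _ hx0', Complex.cpow_sub _ _ hx1', Complex.cpow_one, Complex.cpow_one, Complex.cpow_def_of_ne_zero hx0', Complex.cpow_def_of_ne_zero hx1',
    ← Complex.ofReal_log hx0.le, ← Complex.ofReal_log hx1.le, Complex.real_smul]
  rw [Complex.ofReal_mul]
  field_simp
  rw [← Complex.exp_add]
  congr 1
  conv_rhs => rw [hs]
  push_cast
  ring

theorem integral_exp_mul_one_add_cosh_rpow {ν : ℂ} {p : ℝ} (hν : |ν.re| < p) :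
    ∫ s : ℝ, Complex.exp (ν * s) * ((1 + Real.cosh s) ^ (-p) : ℝ) =
      ((2 ^ p : ℝ) : ℂ) * (Complex.Gamma (p + ν) * Complex.Gamma (p - ν) / Complex.Gamma (2 * p)) := by
  have hp : 0 < p := (abs_nonneg _).trans_lt hν
  have h := integral_image_eq_integral_abs_deriv_smul MeasurableSet.univ
    (fun x _ => (Real.hasDerivAt_sigmoid x).hasDerivWithinAt) Real.sigmoid_injective.injOn
    (fun x : ℝ => (x : ℂ) ^ ((p + ν : ℂ) - 1) * (1 - x : ℂ) ^ ((p - ν : ℂ) - 1))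
  rw [Set.image_univ, Real.range_sigmoid, setIntegral_univ] at h
  have hpos : ∀ s, |Real.sigmoid s * (1 - Real.sigmoid s)| =
      Real.sigmoid s * (1 - Real.sigmoid s) := fun s =>
    abs_of_pos (mul_pos (Real.sigmoid_pos s) (by linarith [Real.sigmoid_lt_one s]))
  simp only [hpos, sigmoid_cpow_mul_one_sub_sigmoid_cpow] at h
  rw [integral_const_mul, ← integral_Ioc_eq_integral_Ioo,
    ← intervalIntegral.integral_of_le zero_le_one] at h
  have habs := abs_lt.mp hν
  have hbeta := Complex.Gamma_mul_Gamma_eq_betaIntegral (s := p + ν) (t := p - ν)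
    (by simp; linarith) (by simp; linarith)
  rw [Complex.betaIntegral, h, show (p : ℂ) + ν + (p - ν) = 2 * p by ring] at hbeta
  have hG : Complex.Gamma (2 * p) ≠ 0 := Complex.Gamma_ne_zero_of_re_pos (by simp [hp])
  have h2 : ((2 ^ p : ℝ) : ℂ) * ((2 ^ (-p) : ℝ) : ℂ) = 1 := by
    rw [← Complex.ofReal_mul, ← Real.rpow_add two_pos, add_neg_cancel, Real.rpow_zero,
      Complex.ofReal_one]
  rw [hbeta, mul_div_cancel_left₀ _ hG, ← mul_assoc, h2, one_mul]

/-- The Mellin transform of `e^(-t) K_ν(t)`. -/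
theorem integral_rpow_mul_exp_mul_macdonald_eq_Gamma {ν : ℂ} {p : ℝ} (hν : |ν.re| < p) :
    ∫ t in Set.Ioi (0 : ℝ), ((t ^ (p - 1) * Real.exp (-t) : ℝ) : ℂ) * macdonaldIntegral ν t =
      ((Real.sqrt Real.pi * 2 ^ (-p) : ℝ) : ℂ) *
        (Complex.Gamma (p + ν) * Complex.Gamma (p - ν) / Complex.Gamma (p + 1 / 2)) := by
  have hp : 0 < p := (abs_nonneg _).trans_lt hν
  have h := (integral_rpow_mul_exp_mul_macdonald hν (h := fun _ => 1) (C := 1)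
    aestronglyMeasurable_const (by simp)).2
  simp only [mul_one] at h
  have h1 : ∀ s : ℝ, ∫ t in Set.Ioi (0 : ℝ),
      ((t ^ (p - 1) * Real.exp (-((1 + Real.cosh s) * t)) : ℝ) : ℂ) =
      Complex.Gamma p * ((1 + Real.cosh s) ^ (-p) : ℝ) := by
    intro s
    rw [integral_complex_ofReal, integral_rpow_mul_exp_one_add_cosh hp, Complex.ofReal_mul,
      Complex.Gamma_ofReal]
  simp only [h1, mul_left_comm _ (Complex.Gamma (p : ℂ))] at h
  rw [h, integral_const_mul, integral_exp_mul_one_add_cosh_rpow hν]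
  have hdup := Complex.Gamma_mul_Gamma_add_half (p : ℂ)
  have hG : Complex.Gamma (2 * p) ≠ 0 := Complex.Gamma_ne_zero_of_re_pos (by simp [hp])
  have hG2 : Complex.Gamma (p + 1 / 2) ≠ 0 :=
    Complex.Gamma_ne_zero_of_re_pos (by simp; linarith)
  have h2 : (2 : ℂ) ^ (1 - 2 * (p : ℂ)) = 2 * ((2 ^ (-p) : ℝ) : ℂ) * ((2 ^ (-p) : ℝ) : ℂ) := by
    rw [mul_assoc, ← Complex.ofReal_mul, ← Real.rpow_add two_pos, Complex.cpow_sub _ _ two_ne_zero,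
      Complex.cpow_one, show -p + -p = -(2 * p) by ring, Real.rpow_neg two_pos.le,
      Complex.ofReal_inv, Complex.ofReal_cpow two_pos.le]
    push_cast
    rfl
  have h3 : ((2 ^ p : ℝ) : ℂ) * ((2 ^ (-p) : ℝ) : ℂ) = 1 := by
    rw [← Complex.ofReal_mul, ← Real.rpow_add two_pos, add_neg_cancel, Real.rpow_zero,
      Complex.ofReal_one]
  rw [h2] at hdup
  rw [Complex.ofReal_mul]
  generalize Complex.Gamma (p + 1 / 2) = H at *
  field_simp
  linear_combination Complex.Gamma (p + ν) * Complex.Gamma (p - ν) * ((2 ^ p : ℝ) : ℂ) * hdup +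
    2 * Complex.Gamma (p + ν) * Complex.Gamma (p - ν) * Complex.Gamma (2 * p) *
      ((2 ^ (-p) : ℝ) : ℂ) * (Real.sqrt Real.pi : ℝ) * h3

/-- The reflection formula for `Γ(1/2 + ν) Γ(1/2 - ν)`, shifted `N` times. -/
theorem cos_mul_Gamma_mul_Gamma (N : ℕ) {ν : ℂ} (hν : Complex.cos (Real.pi * ν) ≠ 0) :
    Complex.cos (Real.pi * ν) * (Complex.Gamma (N + 1 / 2 + ν) * Complex.Gamma (N + 1 / 2 - ν)) =
      Real.pi * ∏ k ∈ Finset.range N, (((k : ℂ) + 1 / 2) ^ 2 - ν ^ 2) := by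
  induction N with
  | zero =>
    have h := Complex.Gamma_mul_Gamma_one_sub (1 / 2 + ν)
    rw [show (1 : ℂ) - (1 / 2 + ν) = 1 / 2 - ν by ring,
      show (Real.pi : ℂ) * (1 / 2 + ν) = Real.pi * ν + Real.pi / 2 by ring,
      Complex.sin_add_pi_div_two] at h
    simp only [Nat.cast_zero, zero_add, Finset.range_zero, Finset.prod_empty, mul_one]
    rw [h]
    field_simp
  | succ n ih =>
    have hne : ∀ μ : ℂ, Complex.cos (Real.pi * μ) ≠ 0 → (n : ℂ) + 1 / 2 + μ ≠ 0 := by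
      intro μ hμ h0
      refine hμ (Complex.cos_eq_zero_iff.mpr ⟨-(n : ℤ) - 1, ?_⟩)
      rw [show μ = -((n : ℂ) + 1 / 2) by linear_combination h0]
      push_cast
      ring
    have h1 := Complex.Gamma_add_one _ (hne ν hν)
    have h2 := Complex.Gamma_add_one _ (hne (-ν) (by rwa [mul_neg, Complex.cos_neg]))
    rw [Finset.prod_range_succ]
    push_cast
    rw [show (n : ℂ) + 1 + 1 / 2 + ν = n + 1 / 2 + ν + 1 by ring,
      show (n : ℂ) + 1 + 1 / 2 - ν = n + 1 / 2 + -ν + 1 by ring, h1, h2,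
      show (n : ℂ) + 1 / 2 + -ν = n + 1 / 2 - ν by ring]
    linear_combination (((n : ℂ) + 1 / 2) ^ 2 - ν ^ 2) * ih

theorem hankelCoeff_eq_prod (N : ℕ) (ν : ℂ) :
    hankelCoeff N ν = (-1) ^ N * (∏ k ∈ Finset.range N, (((k : ℂ) + 1 / 2) ^ 2 - ν ^ 2)) /
      (2 ^ N * N.factorial) := by
  have h : ∏ k ∈ Finset.range N, (4 * ν ^ 2 - (2 * (k : ℂ) + 1) ^ 2) =
      (-4) ^ N * ∏ k ∈ Finset.range N, (((k : ℂ) + 1 / 2) ^ 2 - ν ^ 2) := by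
    rw [← Finset.card_range N, ← Finset.prod_const, Finset.card_range, ← Finset.prod_mul_distrib]
    refine Finset.prod_congr rfl fun k _ => ?_
    ring
  rw [hankelCoeff, h, show (8 : ℂ) = 4 * 2 by norm_num, mul_pow, show (-4 : ℂ) = -1 * 4 by norm_num,
    mul_pow]
  generalize ∏ k ∈ Finset.range N, (((k : ℂ) + 1 / 2) ^ 2 - ν ^ 2) = Q
  field_simp

/-- The moments of `K_ν` are, up to elementary factors, the coefficients `a_N(ν)`. -/
theorem hankelCoeff_eq_integral {ν : ℂ} (N : ℕ) (hν : |ν.re| < N + 1 / 2)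
    (hc : Complex.cos (Real.pi * ν) ≠ 0) :
    hankelCoeff N ν = (-1) ^ N * (Complex.cos (Real.pi * ν) / Real.pi) * Real.sqrt (2 / Real.pi) *
      ∫ t in Set.Ioi (0 : ℝ), ((t ^ ((N + 1 / 2 : ℝ) - 1) * Real.exp (-t) : ℝ) : ℂ) *
        macdonaldIntegral ν t := by
  rw [integral_rpow_mul_exp_mul_macdonald_eq_Gamma hν, hankelCoeff_eq_prod]
  have h1 := cos_mul_Gamma_mul_Gamma N hc
  have h2 : Real.sqrt (2 / Real.pi) * (Real.sqrt Real.pi * 2 ^ (-((N : ℝ) + 1 / 2))) =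
      (2 ^ N)⁻¹ := by
    rw [← mul_assoc, ← Real.sqrt_mul (by positivity), div_mul_cancel₀ _ Real.pi_ne_zero, neg_add,
      Real.rpow_add two_pos, Real.sqrt_eq_rpow, mul_left_comm, ← Real.rpow_add two_pos,
      add_neg_cancel, Real.rpow_zero, mul_one, Real.rpow_neg two_pos.le, Real.rpow_natCast]
  have h3 : ((N : ℝ) + 1 / 2 : ℝ) + (1 / 2 : ℂ) = (N : ℂ) + 1 := by push_cast; ring
  have h2' := congrArg (fun x : ℝ => (x : ℂ)) h2
  simp only [Complex.ofReal_mul (Real.sqrt (2 / Real.pi))] at h2'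
  rw [h3, Complex.Gamma_nat_eq_factorial]
  have hpi : (Real.pi : ℂ) ≠ 0 := by exact_mod_cast Real.pi_ne_zero
  have hf : (N.factorial : ℂ) ≠ 0 := by exact_mod_cast N.factorial_ne_zero
  have h4 : (((N : ℝ) + 1 / 2 : ℝ) : ℂ) = (N : ℂ) + 1 / 2 := by push_cast; ring
  rw [h4]
  push_cast at h2' ⊢
  have h5 : ∏ k ∈ Finset.range N, (((k : ℂ) + 1 / 2) ^ 2 - ν ^ 2) =
      Complex.cos (Real.pi * ν) * (Complex.Gamma (N + 1 / 2 + ν) * Complex.Gamma (N + 1 / 2 - ν)) /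
        Real.pi := by
    rw [h1, mul_div_cancel_left₀ _ hpi]
  rw [h5]
  have h6 : ((-1 : ℂ) ^ N * (Complex.cos (Real.pi * ν) * (Complex.Gamma (N + 1 / 2 + ν) *
      Complex.Gamma (N + 1 / 2 - ν)) / Real.pi) / (2 ^ N * N.factorial)) = (-1) ^ N *
      (Complex.cos (Real.pi * ν) * (Complex.Gamma (N + 1 / 2 + ν) *
      Complex.Gamma (N + 1 / 2 - ν)) / Real.pi) / N.factorial * (2 ^ N)⁻¹ := by
    field_simp
  rw [h6, ← h2']
  ring

/-! ### The remainder `R_N^{(K)}` as a Stieltjes transform -/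

/-- The Stieltjes transform `∫_0^∞ t^(N-1/2) e^(-t) K_ν(t) / (1 + t/z) dt` at `z = exp ζ`. -/
noncomputable def besselStieltjes (N : ℕ) (ν ζ : ℂ) : ℂ :=
  ∫ t in Set.Ioi (0 : ℝ), ((t ^ ((N + 1 / 2 : ℝ) - 1) * Real.exp (-t) : ℝ) : ℂ) *
    macdonaldIntegral ν t * stieltjesKernel ζ t

theorem differentiable_macdonaldIntegral_order {t : ℝ} (ht : 0 < t) :
    Differentiable ℂ fun ν => macdonaldIntegral ν t := by
  have h : (fun ν => macdonaldIntegral ν t) = fun ν : ℂ =>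
      1 / 2 * Complex.exp (-(ν * (Real.log t - Real.log 2 : ℝ))) *
        besselEta ν (Real.exp (2 * (Real.log t - Real.log 2))) := by
    funext ν
    rw [← macdonaldIntegral_exp, sub_add_cancel, Real.exp_log ht]
  have := differentiable_besselEta_order (Real.exp_pos (2 * (Real.log t - Real.log 2)))
  rw [h]
  fun_prop

theorem isOpen_abs_re_lt (p : ℝ) : IsOpen {ν : ℂ | |ν.re| < p} :=
  isOpen_lt (by fun_prop) continuous_const

theorem isPreconnected_abs_re_lt (p : ℝ) : IsPreconnected {ν : ℂ | |ν.re| < p} := by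
  have h : Convex ℝ {ν : ℂ | |ν.re| < p} := by
    have : {ν : ℂ | |ν.re| < p} = Complex.reCLM ⁻¹' Set.Ioo (-p) p := by
      ext ν
      simp [abs_lt]
    rw [this]
    exact (convex_Ioo _ _).linear_preimage Complex.reCLM.toLinearMap
  exact h.isPreconnected

theorem differentiableOn_besselStieltjes_order (N : ℕ) {ζ : ℂ} (hζ : ζ ∈ cutStrip) :
    DifferentiableOn ℂ (fun ν => besselStieltjes N ν ζ) {ν : ℂ | |ν.re| < N + 1 / 2} := by
  have hq : ∀ t ∈ Set.Ioi (0 : ℝ), ‖stieltjesKernel ζ t‖ ≤ (Real.cos (ζ.im / 2))⁻¹ :=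
    fun t ht => norm_stieltjesKernel_le hζ (le_of_lt ht)
  refine differentiableOn_integral_of_locally_dominated (isOpen_abs_re_lt _) (fun ν hν => ?_) ?_ ?_
  · exact (integral_rpow_mul_exp_mul_macdonald hν
      (aestronglyMeasurable_stieltjesKernel hζ) hq).1.aestronglyMeasurable
  · filter_upwards [ae_restrict_mem measurableSet_Ioi] with t ht
    exact (((differentiable_macdonaldIntegral_order ht).const_mul _).mul_const _).differentiableOn
  · intro w hw
    have hw' : |w.re| < (N : ℝ) + 1 / 2 := hw
    obtain ⟨b, hb1, hb2⟩ := exists_between hw'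
    have hb0 : |((b : ℂ)).re| < (N : ℝ) + 1 / 2 := by
      rw [Complex.ofReal_re, abs_of_pos ((abs_nonneg _).trans_lt hb1)]
      exact hb2
    have hint := (integrableOn_rpow_mul_exp_mul_macdonald hb0).norm.const_mul
      (2 * (Real.cos (ζ.im / 2))⁻¹)
    refine ⟨b - |w.re|, sub_pos.mpr hb1, _, hint, ?_⟩
    filter_upwards [ae_restrict_mem measurableSet_Ioi] with t ht v hv
    have hvre : |v.re| ≤ b := by
      have h1 := Complex.abs_re_le_norm (v - w)
      rw [Metric.mem_ball, dist_eq_norm] at hv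
      rw [Complex.sub_re] at h1
      have h2 := abs_sub_abs_le_abs_sub v.re w.re
      linarith
    have hk : ‖macdonaldIntegral v t‖ ≤ 2 * ‖macdonaldIntegral b t‖ :=
      (norm_macdonaldIntegral_le v t).trans ((macdonaldIntegral_re_le hvre ht).trans
        (by gcongr; exact Complex.re_le_norm _))
    rw [norm_mul, norm_mul, norm_mul]
    calc _ ≤ ‖((t ^ ((N + 1 / 2 : ℝ) - 1) * Real.exp (-t) : ℝ) : ℂ)‖ *
          (2 * ‖macdonaldIntegral b t‖) * (Real.cos (ζ.im / 2))⁻¹ := by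
          gcongr
          exact hq t ht
      _ = _ := by ring

theorem differentiableOn_besselStieltjes (N : ℕ) {ν : ℂ} (hν : |ν.re| < N + 1 / 2) :
    DifferentiableOn ℂ (besselStieltjes N ν) cutStrip :=
  differentiableOn_integral_mul_stieltjesKernel (integrableOn_rpow_mul_exp_mul_macdonald hν)

/-- Expanding the kernel by one term of the geometric series. -/
theorem besselStieltjes_succ (N : ℕ) {ν ζ : ℂ} (hν : |ν.re| < N + 1 / 2) (hζ : ζ ∈ cutStrip) :
    besselStieltjes N ν ζ = (∫ t in Set.Ioi (0 : ℝ),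
        ((t ^ ((N + 1 / 2 : ℝ) - 1) * Real.exp (-t) : ℝ) : ℂ) * macdonaldIntegral ν t) -
      (Complex.exp ζ)⁻¹ * besselStieltjes (N + 1) ν ζ := by
  have i1 := integrableOn_rpow_mul_exp_mul_macdonald hν
  have i2 := integrableOn_mul_stieltjesKernel i1 hζ
  have h1 : ∀ t ∈ Set.Ioi (0 : ℝ),
      ((t ^ (((N + 1 : ℕ) + 1 / 2 : ℝ) - 1) * Real.exp (-t) : ℝ) : ℂ) *
        macdonaldIntegral ν t * stieltjesKernel ζ t =
      Complex.exp ζ * (((t ^ ((N + 1 / 2 : ℝ) - 1) * Real.exp (-t) : ℝ) : ℂ) *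
        macdonaldIntegral ν t - ((t ^ ((N + 1 / 2 : ℝ) - 1) * Real.exp (-t) : ℝ) : ℂ) *
        macdonaldIntegral ν t * stieltjesKernel ζ t) := by
    intro t ht
    have ht0 : 0 < t := ht
    have hne := exp_add_ne_zero hζ ht0.le
    have h2 : t ^ (((N + 1 : ℕ) + 1 / 2 : ℝ) - 1) = t ^ ((N + 1 / 2 : ℝ) - 1) * t := by
      rw [← Real.rpow_add_one ht0.ne']
      congr 1
      push_cast
      ring
    rw [h2, stieltjesKernel]
    push_cast
    field_simp
    ring
  have h2 : besselStieltjes (N + 1) ν ζ = Complex.exp ζ * ((∫ t in Set.Ioi (0 : ℝ),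
      ((t ^ ((N + 1 / 2 : ℝ) - 1) * Real.exp (-t) : ℝ) : ℂ) * macdonaldIntegral ν t) -
      besselStieltjes N ν ζ) := by
    rw [besselStieltjes, setIntegral_congr_fun measurableSet_Ioi h1, integral_const_mul,
      integral_sub i1 i2, besselStieltjes]
  rw [h2, inv_mul_cancel_left₀ (Complex.exp_ne_zero ζ)]
  ring

theorem cos_pi_mul_ne_zero_of_abs_re_lt {ν : ℂ} (hν : |ν.re| < 1 / 2) :
    Complex.cos (Real.pi * ν) ≠ 0 := by
  intro h
  obtain ⟨k, hk⟩ := Complex.cos_eq_zero_iff.mp h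
  have hpi : (Real.pi : ℂ) ≠ 0 := by exact_mod_cast Real.pi_ne_zero
  have h1 : ν = ((k : ℝ) + 1 / 2 : ℝ) := by
    push_cast
    refine mul_left_cancel₀ hpi ?_
    rw [hk]
    ring
  rw [h1, Complex.ofReal_re, abs_lt] at hν
  have h2 : (-1 : ℝ) < k := by linarith [hν.1]
  have h3 : (k : ℝ) < 0 := by linarith [hν.2]
  have h4 : (-1 : ℤ) < k := by exact_mod_cast h2
  have h5 : k < (0 : ℤ) := by exact_mod_cast h3
  omega

theorem besselStieltjes_zero_ofReal {ν : ℂ} (hν : |ν.re| < 1 / 2) (ξ : ℝ) :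
    Complex.cos (Real.pi * ν) * besselStieltjes 0 ν ξ =
      Real.pi * Real.sqrt (Real.exp ξ) * Complex.exp (Complex.exp ξ) *
        macdonaldIntegral ν (Real.exp ξ) := by
  have hζ := ofReal_mem_cutStrip ξ
  have h := (integral_rpow_mul_exp_mul_macdonald hν (aestronglyMeasurable_stieltjesKernel hζ)
    fun t ht => norm_stieltjesKernel_le hζ (le_of_lt ht)).2
  have h1 : besselStieltjes 0 ν ξ = 1 / 2 * ∫ s : ℝ, Complex.exp (ν * s) *
      ((∫ t in Set.Ioi (0 : ℝ), t ^ ((1 / 2 : ℝ) - 1) * Real.exp (-((1 + Real.cosh s) * t)) *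
        (Real.exp ξ / (Real.exp ξ + t)) : ℝ) : ℂ) := by
    rw [besselStieltjes, Nat.cast_zero, zero_add, h]
    congr 2
    funext s
    rw [← integral_complex_ofReal]
    congr 2
    funext t
    rw [stieltjesKernel]
    push_cast
    ring
  have h2 := cos_mul_integral_stieltjes_eq_macdonaldIntegral hν (Real.exp_pos ξ)
  rw [h1, mul_left_comm, h2]
  push_cast
  ring

/-- The base case `N = 0` of the Stieltjes representation, for all `z` in the cut plane. -/
theorem sin_mul_cos_mul_besselStieltjes_zero {ν : ℂ} (hν : |ν.re| < 1 / 2) {ζ : ℂ}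
    (hζ : ζ ∈ cutStrip) :
    Complex.sin (Real.pi * ν) * (Complex.cos (Real.pi * ν) / Real.pi * besselStieltjes 0 ν ζ) =
      Complex.exp (ζ / 2) * Complex.exp (Complex.exp ζ) *
        (Real.pi / 2 * (modBesselI (-ν) ζ - modBesselI ν ζ)) := by
  have hI1 := differentiable_modBesselI_arg ν
  have hI2 := differentiable_modBesselI_arg (-ν)
  have hS := differentiableOn_besselStieltjes 0 (ν := ν) (by simpa using hν)
  refine eqOn_of_eventually_eq_ofReal (x₀ := 0)
    (f := fun ζ => Complex.sin (Real.pi * ν) *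
      (Complex.cos (Real.pi * ν) / Real.pi * besselStieltjes 0 ν ζ))
    (g := fun ζ => Complex.exp (ζ / 2) * Complex.exp (Complex.exp ζ) *
        (Real.pi / 2 * (modBesselI (-ν) ζ - modBesselI ν ζ))) isOpen_cutStrip
    isPreconnected_cutStrip ((hS.const_mul _).const_mul _)
    (Differentiable.differentiableOn ?_) (ofReal_mem_cutStrip 0)
    (Eventually.of_forall fun ξ => ?_) hζ
  · fun_prop
  · have h1 := besselStieltjes_zero_ofReal hν ξ
    have h2 := sin_mul_macdonaldIntegral ν ξ
    have h3 : ((Real.sqrt (Real.exp ξ) : ℝ) : ℂ) = Complex.exp (ξ / 2) := by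
      rw [← Real.exp_half]
      push_cast
      rfl
    have hpi : (Real.pi : ℂ) ≠ 0 := by exact_mod_cast Real.pi_ne_zero
    rw [h3] at h1
    rw [← h2, div_mul_eq_mul_div, h1]
    field_simp

theorem besselStieltjes_expansion (N : ℕ) {ν ζ : ℂ} (hν : |ν.re| < 1 / 2) (hζ : ζ ∈ cutStrip) :
    (∑ n ∈ Finset.range N, hankelCoeff n ν / Complex.exp ζ ^ n) +
      (-1) ^ N * (Complex.cos (Real.pi * ν) / Real.pi) * Real.sqrt (2 / Real.pi) /
        Complex.exp ζ ^ N * besselStieltjes N ν ζ =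
      Complex.cos (Real.pi * ν) / Real.pi * Real.sqrt (2 / Real.pi) * besselStieltjes 0 ν ζ := by
  induction N with
  | zero => simp
  | succ n ih =>
    have hn : |ν.re| < (n : ℝ) + 1 / 2 := by linarith [(Nat.cast_nonneg n : (0 : ℝ) ≤ n)]
    rw [← ih, Finset.sum_range_succ, besselStieltjes_succ n hn hζ,
      hankelCoeff_eq_integral n hn (cos_pi_mul_ne_zero_of_abs_re_lt hν)]
    have := Complex.exp_ne_zero ζ
    rw [pow_succ, pow_succ]
    field_simp
    ring

/-- The Stieltjes representation with `N` terms removed. It holds for `|Re ν| < 1/2` by the base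
case, and extends to `|Re ν| < N + 1/2` by analytic continuation in `ν`. -/
theorem sin_mul_stieltjes_expansion (N : ℕ) {ν ζ : ℂ} (hν : |ν.re| < N + 1 / 2)
    (hζ : ζ ∈ cutStrip) :
    Complex.sin (Real.pi * ν) * ((∑ n ∈ Finset.range N, hankelCoeff n ν / Complex.exp ζ ^ n) +
      (-1) ^ N * (Complex.cos (Real.pi * ν) / Real.pi) * Real.sqrt (2 / Real.pi) /
        Complex.exp ζ ^ N * besselStieltjes N ν ζ) =
      Real.sqrt (2 / Real.pi) * Complex.exp (ζ / 2) * Complex.exp (Complex.exp ζ) *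
        (Real.pi / 2 * (modBesselI (-ν) ζ - modBesselI ν ζ)) := by
  have hI := differentiable_modBesselI ζ
  have hI' : Differentiable ℂ fun ν => modBesselI (-ν) ζ := hI.comp differentiable_neg
  have hS := differentiableOn_besselStieltjes_order N hζ
  have ha : ∀ n, Differentiable ℂ (hankelCoeff n) := by
    intro n
    unfold hankelCoeff
    fun_prop
  refine eqOn_of_eventually_eq_ofReal (x₀ := 0)
    (f := fun ν => Complex.sin (Real.pi * ν) *
      ((∑ n ∈ Finset.range N, hankelCoeff n ν / Complex.exp ζ ^ n) +
      (-1) ^ N * (Complex.cos (Real.pi * ν) / Real.pi) * Real.sqrt (2 / Real.pi) /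
        Complex.exp ζ ^ N * besselStieltjes N ν ζ))
    (g := fun ν => Real.sqrt (2 / Real.pi) * Complex.exp (ζ / 2) * Complex.exp (Complex.exp ζ) *
        (Real.pi / 2 * (modBesselI (-ν) ζ - modBesselI ν ζ)))
    (isOpen_abs_re_lt _) (isPreconnected_abs_re_lt _) ?_ (Differentiable.differentiableOn ?_)
    (by simp only [Set.mem_ofPred_eq, Complex.ofReal_re, abs_zero]; positivity) ?_ hν
  · refine DifferentiableOn.mul (Differentiable.differentiableOn (by fun_prop)) ?_
    refine DifferentiableOn.add (DifferentiableOn.fun_sum fun n _ => ?_)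
      (DifferentiableOn.mul (Differentiable.differentiableOn (by fun_prop)) hS)
    exact ((ha n).div_const _).differentiableOn
  · fun_prop
  · have : Set.Ioo (-(1 / 2) : ℝ) (1 / 2) ∈ 𝓝 (0 : ℝ) := Ioo_mem_nhds (by norm_num) (by norm_num)
    filter_upwards [this] with x hx
    have hx' : |(x : ℂ).re| < 1 / 2 := by
      rw [Complex.ofReal_re, abs_lt]
      exact hx
    have h1 := besselStieltjes_expansion N hx' hζ
    have h2 := sin_mul_cos_mul_besselStieltjes_zero hx' hζ
    rw [h1]
    linear_combination Real.sqrt (2 / Real.pi) * h2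

theorem modBesselK_eq_of_sin_ne_zero {ν : ℂ} (hs : Complex.sin (Real.pi * ν) ≠ 0) (ζ : ℂ) :
    modBesselK ν ζ =
      (Real.pi / 2 : ℂ) * (modBesselI (-ν) ζ - modBesselI ν ζ) / Complex.sin (Real.pi * ν) := by
  refine tendsto_nhds_unique (tendsto_modBesselK ν ζ) ?_
  have hI := (differentiable_modBesselI ζ).continuous
  have hc : ContinuousAt (fun μ : ℂ =>
      (Real.pi / 2 : ℂ) * (modBesselI (-μ) ζ - modBesselI μ ζ) / Complex.sin (Real.pi * μ)) ν :=
    ContinuousAt.div (by fun_prop) (by fun_prop) hs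
  exact hc.tendsto.mono_left nhdsWithin_le_nhds

/-- `R_N^{(K)}` as a Stieltjes transform. -/
theorem remK_eq_besselStieltjes (N : ℕ) {ν ζ : ℂ} (hν : |ν.re| < N + 1 / 2)
    (hs : Complex.sin (Real.pi * ν) ≠ 0) (hζ : ζ ∈ cutStrip) :
    remK N ζ ν = (-1) ^ N * (Complex.cos (Real.pi * ν) / Real.pi) * Real.sqrt (2 / Real.pi) /
        Complex.exp ζ ^ N * besselStieltjes N ν ζ := by
  have h := sin_mul_stieltjes_expansion N hν hζ
  have h2 : (Real.sqrt (2 / Real.pi) : ℂ) = (Real.sqrt (Real.pi / 2) : ℂ)⁻¹ := by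
    rw [← Complex.ofReal_inv, ← Real.sqrt_inv, inv_div]
  have h3 : (Real.sqrt (Real.pi / 2) : ℂ) ≠ 0 := by
    exact_mod_cast (Real.sqrt_pos.mpr (by positivity)).ne'
  have h4 : modBesselK ν ζ / ((Real.sqrt (Real.pi / 2) : ℂ) * Complex.exp (-ζ / 2) *
      Complex.exp (-Complex.exp ζ)) = Real.sqrt (2 / Real.pi) * Complex.exp (ζ / 2) *
        Complex.exp (Complex.exp ζ) * (Real.pi / 2 * (modBesselI (-ν) ζ - modBesselI ν ζ)) /
          Complex.sin (Real.pi * ν) := by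
    rw [modBesselK_eq_of_sin_ne_zero hs, h2, neg_div, Complex.exp_neg, Complex.exp_neg]
    field_simp
  -- `h` holds for every order, but `sin (πν)` can be cancelled only off the integers
  rw [remK, h4, ← h, mul_div_cancel_left₀ _ hs]
  ring

/-! ### The quotient `|a_M(x)| / |cos (πx)|` -/

/-- The continuous extension `Γ(M+1/2+x) Γ(M+1/2-x) / (π 2^M M!)` of the quotient
`|a_M(x)| / |cos (πx)|` to the interval `|x| < M + 1/2`. -/
noncomputable def hankelQuotient (M : ℕ) (x : ℝ) : ℝ :=
  Real.Gamma (M + 1 / 2 + x) * Real.Gamma (M + 1 / 2 - x) / (Real.pi * 2 ^ M * M.factorial)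

theorem hankelQuotient_pos {M : ℕ} {x : ℝ} (hx : |x| < M + 1 / 2) : 0 < hankelQuotient M x := by
  have h := abs_lt.mp hx
  have h1 := Real.Gamma_pos_of_pos (show 0 < (M : ℝ) + 1 / 2 + x by linarith)
  have h2 := Real.Gamma_pos_of_pos (show 0 < (M : ℝ) + 1 / 2 - x by linarith)
  have := Real.pi_pos
  unfold hankelQuotient
  positivity

theorem norm_hankelCoeff_div_abs_cos {M : ℕ} {x : ℝ} (hx : |x| < M + 1 / 2)
    (hc : Real.cos (Real.pi * x) ≠ 0) :
    ‖hankelCoeff M (x : ℂ)‖ / |Real.cos (Real.pi * x)| = hankelQuotient M x := by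
  have hc' : Complex.cos (Real.pi * x) ≠ 0 := by exact_mod_cast hc
  have h := cos_mul_Gamma_mul_Gamma M hc'
  have h1 : hankelCoeff M (x : ℂ) =
      (((-1) ^ M * (Real.cos (Real.pi * x) * hankelQuotient M x) : ℝ) : ℂ) := by
    have hpi : (Real.pi : ℂ) ≠ 0 := by exact_mod_cast Real.pi_ne_zero
    have h2 : ∏ k ∈ Finset.range M, (((k : ℂ) + 1 / 2) ^ 2 - (x : ℂ) ^ 2) =
        Complex.cos (Real.pi * x) * (Complex.Gamma (M + 1 / 2 + x) *
          Complex.Gamma (M + 1 / 2 - x)) / Real.pi := by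
      rw [h, mul_div_cancel_left₀ _ hpi]
    rw [hankelCoeff_eq_prod, h2, hankelQuotient]
    push_cast [← Complex.Gamma_ofReal]
    field_simp
  rw [h1, Complex.norm_real, norm_mul, norm_mul, norm_pow, norm_neg, norm_one, one_pow, one_mul,
    Real.norm_eq_abs, Real.norm_of_nonneg (hankelQuotient_pos hx).le,
    mul_div_cancel_left₀ _ (abs_ne_zero.mpr hc)]

theorem continuousAt_hankelQuotient {M : ℕ} {x : ℝ} (hx : |x| < M + 1 / 2) :
    ContinuousAt (hankelQuotient M) x := by
  have h := abs_lt.mp hx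
  have hG : ∀ y : ℝ, 0 < y → ContinuousAt Real.Gamma y := fun y hy =>
    (Real.differentiableAt_Gamma fun m hm => by
      have : (0 : ℝ) ≤ m := Nat.cast_nonneg m
      linarith).continuousAt
  have h1 : ContinuousAt (fun x : ℝ => Real.Gamma ((M : ℝ) + 1 / 2 + x)) x :=
    ContinuousAt.comp (g := Real.Gamma) (f := fun x => (M : ℝ) + 1 / 2 + x)
      (hG _ (by linarith)) (by fun_prop)
  have h2 : ContinuousAt (fun x : ℝ => Real.Gamma ((M : ℝ) + 1 / 2 - x)) x :=
    ContinuousAt.comp (g := Real.Gamma) (f := fun x => (M : ℝ) + 1 / 2 - x)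
      (hG _ (by linarith)) (by fun_prop)
  exact (h1.mul h2).div_const _

theorem eventually_cos_pi_mul_ne_zero (x : ℝ) :
    ∀ᶠ y in 𝓝[≠] x, Real.cos (Real.pi * y) ≠ 0 := by
  by_cases hc : Real.cos (Real.pi * x) = 0
  · have hd : HasDerivAt (fun y : ℝ => Real.cos (Real.pi * y)) (-Real.sin (Real.pi * x) * Real.pi)
        x := by
      have h1 : HasDerivAt (fun y : ℝ => Real.pi * y) Real.pi x := by
        simpa using (hasDerivAt_id x).const_mul Real.pi
      exact h1.cos
    refine hd.eventually_ne (mul_ne_zero (neg_ne_zero.mpr fun hs => ?_) Real.pi_ne_zero)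
    have := Real.sin_sq_add_cos_sq (Real.pi * x)
    rw [hs, hc] at this
    norm_num at this
  · have : ContinuousAt (fun y : ℝ => Real.cos (Real.pi * y)) x := by fun_prop
    exact (this.eventually_ne hc).filter_mono nhdsWithin_le_nhds

theorem tendsto_norm_hankelCoeff_div_abs_cos {M : ℕ} {x : ℝ} (hx : |x| < M + 1 / 2) :
    Tendsto (fun y : ℝ => ‖hankelCoeff M (y : ℂ)‖ / |Real.cos (Real.pi * y)|) (𝓝[≠] x)
      (𝓝 (hankelQuotient M x)) := by
  refine ((continuousAt_hankelQuotient hx).tendsto.mono_left nhdsWithin_le_nhds).congr' ?_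
  have h : ∀ᶠ y : ℝ in 𝓝 x, |y| < M + 1 / 2 := continuous_abs.continuousAt.eventually_lt
    continuousAt_const hx
  filter_upwards [h.filter_mono nhdsWithin_le_nhds, eventually_cos_pi_mul_ne_zero x] with y h1 h2
  exact (norm_hankelCoeff_div_abs_cos h1 h2).symm

/-- The absolute moment of `K_ν` is at most the moment of `K_{Re ν}`, which is explicit. The bound
stays finite where `cos (π Re ν)` vanishes. -/
theorem integral_norm_macdonald_le {M : ℕ} {ν : ℂ} (hν : |ν.re| < M + 1 / 2) :
    Real.sqrt (2 / Real.pi) / Real.pi * ∫ t in Set.Ioi (0 : ℝ),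
      ‖((t ^ ((M + 1 / 2 : ℝ) - 1) * Real.exp (-t) : ℝ) : ℂ) * macdonaldIntegral ν t‖ ≤
      hankelQuotient M ν.re := by
  have hν' : |((ν.re : ℂ)).re| < (M : ℝ) + 1 / 2 := by rwa [Complex.ofReal_re]
  have hi := integrableOn_rpow_mul_exp_mul_macdonald hν
  have hi' := integrableOn_rpow_mul_exp_mul_macdonald hν'
  have h1 : ∫ t in Set.Ioi (0 : ℝ),
      ‖((t ^ ((M + 1 / 2 : ℝ) - 1) * Real.exp (-t) : ℝ) : ℂ) * macdonaldIntegral ν t‖ ≤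
      (∫ t in Set.Ioi (0 : ℝ), ((t ^ ((M + 1 / 2 : ℝ) - 1) * Real.exp (-t) : ℝ) : ℂ) *
        macdonaldIntegral ν.re t).re := by
    rw [← Complex.reCLM_apply, ← ContinuousLinearMap.integral_comp_comm _ hi']
    refine setIntegral_mono_on hi.norm (Complex.reCLM.integrable_comp hi') measurableSet_Ioi
      fun t ht => ?_
    have ht0 : 0 < t := ht
    rw [norm_mul, Complex.norm_real, Real.norm_of_nonneg (by positivity), Complex.reCLM_apply,
      Complex.re_ofReal_mul]
    gcongr
    exact norm_macdonaldIntegral_le ν t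
  have h2 := integral_rpow_mul_exp_mul_macdonald_eq_Gamma hν'
  have h3 : Real.sqrt (2 / Real.pi) * (Real.sqrt Real.pi * 2 ^ (-((M : ℝ) + 1 / 2))) =
      (2 ^ M)⁻¹ := by
    rw [← mul_assoc, ← Real.sqrt_mul (by positivity), div_mul_cancel₀ _ Real.pi_ne_zero, neg_add,
      Real.rpow_add two_pos, Real.sqrt_eq_rpow, mul_left_comm, ← Real.rpow_add two_pos,
      add_neg_cancel, Real.rpow_zero, mul_one, Real.rpow_neg two_pos.le, Real.rpow_natCast]
  have h4 : Complex.Gamma (((M + 1 / 2 : ℝ) : ℂ) + 1 / 2) = (M.factorial : ℂ) := by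
    rw [← Complex.Gamma_nat_eq_factorial]
    congr 1
    push_cast
    ring
  have h5 : (∫ t in Set.Ioi (0 : ℝ), ((t ^ ((M + 1 / 2 : ℝ) - 1) * Real.exp (-t) : ℝ) : ℂ) *
        macdonaldIntegral ν.re t).re = Real.sqrt Real.pi * 2 ^ (-((M : ℝ) + 1 / 2)) *
        (Real.Gamma (M + 1 / 2 + ν.re) * Real.Gamma (M + 1 / 2 - ν.re) / M.factorial) := by
    rw [h2, h4, ← Complex.ofReal_add, ← Complex.ofReal_sub, Complex.Gamma_ofReal,
      Complex.Gamma_ofReal, ← Complex.ofReal_natCast, ← Complex.ofReal_mul, ← Complex.ofReal_div,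
      ← Complex.ofReal_mul, Complex.ofReal_re]
  rw [h5] at h1
  have hs : 0 ≤ Real.sqrt (2 / Real.pi) / Real.pi := by positivity
  refine (mul_le_mul_of_nonneg_left h1 hs).trans (le_of_eq ?_)
  rw [hankelQuotient]
  have h6 : Real.sqrt (2 / Real.pi) / Real.pi * (Real.sqrt Real.pi * 2 ^ (-((M : ℝ) + 1 / 2)) *
        (Real.Gamma (M + 1 / 2 + ν.re) * Real.Gamma (M + 1 / 2 - ν.re) / M.factorial)) =
      Real.sqrt (2 / Real.pi) * (Real.sqrt Real.pi * 2 ^ (-((M : ℝ) + 1 / 2))) *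
        (Real.Gamma (M + 1 / 2 + ν.re) * Real.Gamma (M + 1 / 2 - ν.re) / M.factorial / Real.pi) := by
    ring
  rw [h6, h3]
  field_simp

/-! ### The re-expansion of the remainders -/

/-- The difference `t^M R_M^{(K)}(t, ν) - r^M R_M^{(K)}(r, ν)` at `r = exp ξ`. -/
noncomputable def remKDiff (M : ℕ) (ν : ℂ) (ξ t : ℝ) : ℂ :=
  (t : ℂ) ^ M * remK M (Real.log t : ℝ) ν - Complex.exp ξ ^ M * remK M ξ ν

/-- By the Stieltjes representation `t^M R_M(t) - r^M R_M(r)` is a multiple of the integral of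
`u^(M-1/2) e^(-u) K_ν(u)` against the difference of kernels `u (t - r) / ((t + u) (r + u))`, which is
at most `|t - r| / r` in absolute value. -/
theorem norm_remKDiff_le {M : ℕ} {ν : ℂ} (hν : |ν.re| < M + 1 / 2)
    (hs : Complex.sin (Real.pi * ν) ≠ 0) (ξ : ℝ) {t : ℝ} (ht : 0 < t) :
    ‖remKDiff M ν ξ t‖ ≤ |t - Real.exp ξ| / Real.exp ξ *
      (‖Complex.cos (Real.pi * ν)‖ * hankelQuotient M ν.re) := by
  have hmem := ofReal_mem_cutStrip
  have ht' : (t : ℂ) = Complex.exp (Real.log t : ℝ) := by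
    rw [← Complex.ofReal_exp, Real.exp_log ht]
  have hi := integrableOn_rpow_mul_exp_mul_macdonald hν
  have h0 : ∀ x : ℝ, Complex.exp x ^ M * remK M x ν = (-1) ^ M *
      (Complex.cos (Real.pi * ν) / Real.pi) * Real.sqrt (2 / Real.pi) * besselStieltjes M ν x := by
    intro x
    rw [remK_eq_besselStieltjes M hν hs (hmem x)]
    have := Complex.exp_ne_zero (x : ℂ)
    field_simp
  have h1 : ‖besselStieltjes M ν (Real.log t : ℝ) - besselStieltjes M ν ξ‖ ≤
      |t - Real.exp ξ| / Real.exp ξ * ∫ t in Set.Ioi (0 : ℝ),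
      ‖((t ^ ((M + 1 / 2 : ℝ) - 1) * Real.exp (-t) : ℝ) : ℂ) * macdonaldIntegral ν t‖ := by
    rw [besselStieltjes, besselStieltjes, ← integral_sub
      (integrableOn_mul_stieltjesKernel hi (hmem _)) (integrableOn_mul_stieltjesKernel hi (hmem _)),
      ← integral_const_mul]
    refine norm_integral_le_of_norm_le (hi.norm.const_mul _) ?_
    filter_upwards [ae_restrict_mem measurableSet_Ioi] with u hu
    have hu0 : 0 < u := hu
    rw [← mul_sub, norm_mul, mul_comm]
    gcongr
    have hr := Real.exp_pos ξ
    have h2 : stieltjesKernel (Real.log t : ℝ) u - stieltjesKernel ξ u =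
        ((u * (t - Real.exp ξ) / ((t + u) * (Real.exp ξ + u)) : ℝ) : ℂ) := by
      rw [stieltjesKernel, stieltjesKernel, ← ht', ← Complex.ofReal_exp]
      have e1 : (t : ℂ) + u ≠ 0 := by exact_mod_cast (by positivity : t + u ≠ 0)
      have e2 : ((Real.exp ξ : ℝ) : ℂ) + u ≠ 0 := by
        exact_mod_cast (by positivity : Real.exp ξ + u ≠ 0)
      rw [div_sub_div _ _ e1 e2]
      push_cast
      congr 1
      ring
    rw [h2, Complex.norm_real, norm_div, norm_mul, Real.norm_of_nonneg hu0.le, Real.norm_eq_abs,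
      Real.norm_of_nonneg (by positivity), div_le_div_iff₀ (by positivity) hr]
    have h3 : u * Real.exp ξ ≤ (t + u) * (Real.exp ξ + u) := by nlinarith [mul_pos ht hr, mul_pos ht hu0]
    nlinarith [abs_nonneg (t - Real.exp ξ)]
  have h2 := integral_norm_macdonald_le hν
  set I := ∫ t in Set.Ioi (0 : ℝ),
      ‖((t ^ ((M + 1 / 2 : ℝ) - 1) * Real.exp (-t) : ℝ) : ℂ) * macdonaldIntegral ν t‖
  have h3 : remKDiff M ν ξ t = (-1) ^ M *
      (Complex.cos (Real.pi * ν) / Real.pi) * Real.sqrt (2 / Real.pi) *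
        (besselStieltjes M ν (Real.log t : ℝ) - besselStieltjes M ν ξ) := by
    have h4 : (t : ℂ) ^ M = Complex.exp (Real.log t : ℝ) ^ M := by rw [← ht']
    rw [remKDiff, h4, h0, h0]
    ring
  rw [h3]
  simp only [norm_mul, norm_div, norm_pow, norm_neg, norm_one, one_pow, one_mul, Complex.norm_real,
    Real.norm_of_nonneg Real.pi_pos.le, Real.norm_of_nonneg (Real.sqrt_nonneg _)]
  calc _ ≤ ‖Complex.cos (Real.pi * ν)‖ / Real.pi * Real.sqrt (2 / Real.pi) *
        (|t - Real.exp ξ| / Real.exp ξ * I) := by gcongr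
    _ = |t - Real.exp ξ| / Real.exp ξ * (‖Complex.cos (Real.pi * ν)‖ *
        (Real.sqrt (2 / Real.pi) / Real.pi * I)) := by ring
    _ ≤ _ := by gcongr

theorem macdonaldIntegral_eq_modBesselK {ν : ℂ} (hs : Complex.sin (Real.pi * ν) ≠ 0) {t : ℝ}
    (ht : 0 < t) : macdonaldIntegral ν t = modBesselK ν (Real.log t : ℝ) := by
  have h := sin_mul_macdonaldIntegral ν (Real.log t)
  rw [Real.exp_log ht] at h
  rw [modBesselK_eq_of_sin_ne_zero hs, ← h, mul_div_cancel_left₀ _ hs]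

/-- The Hankel expansion of `K_ν(t)` inserted into the density of the Stieltjes representation. -/
theorem stieltjes_density_eq {N M : ℕ} {ν : ℂ} (hs : Complex.sin (Real.pi * ν) ≠ 0) (ξ : ℝ)
    {t : ℝ} (ht : 0 < t) :
    Real.sqrt (2 / Real.pi) *
        (((t ^ ((N + 1 / 2 : ℝ) - 1) * Real.exp (-t) : ℝ) : ℂ) * macdonaldIntegral ν t) =
      (∑ m ∈ Finset.range M, hankelCoeff m ν *
        ((t ^ (((N : ℝ) - m) - 1) * Real.exp (-(2 * t)) : ℝ) : ℂ)) +
      Complex.exp ξ ^ M * remK M ξ ν *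
        ((t ^ (((N : ℝ) - M) - 1) * Real.exp (-(2 * t)) : ℝ) : ℂ) +
      ((t ^ (((N : ℝ) - M) - 1) * Real.exp (-(2 * t)) : ℝ) : ℂ) * remKDiff M ν ξ t := by
  have ht' : Complex.exp (Real.log t : ℝ) = t := by
    rw [← Complex.ofReal_exp, Real.exp_log ht]
  have htC : (t : ℂ) ≠ 0 := by exact_mod_cast ht.ne'
  have hpow : ∀ m : ℕ, ((t ^ (((N : ℝ) - m) - 1) * Real.exp (-(2 * t)) : ℝ) : ℂ) =
      ((t ^ ((N : ℝ) - 1) * Real.exp (-(2 * t)) : ℝ) : ℂ) / t ^ m := by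
    intro m
    rw [show (N : ℝ) - m - 1 = (N - 1) - m by ring, Real.rpow_sub_natCast ht.ne']
    push_cast
    ring
  have h2 : (Real.sqrt (2 / Real.pi) : ℂ) = (Real.sqrt (Real.pi / 2) : ℂ)⁻¹ := by
    rw [← Complex.ofReal_inv, ← Real.sqrt_inv, inv_div]
  have h3 : (Real.sqrt (Real.pi / 2) : ℂ) ≠ 0 := by
    exact_mod_cast (Real.sqrt_pos.mpr (by positivity)).ne'
  have hR : remK M (Real.log t : ℝ) ν = macdonaldIntegral ν t * (Real.sqrt (2 / Real.pi) *
      ((Real.exp (Real.log t / 2) * Real.exp t : ℝ) : ℂ)) -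
      ∑ m ∈ Finset.range M, hankelCoeff m ν / (t : ℂ) ^ m := by
    rw [remK, ht', ← macdonaldIntegral_eq_modBesselK hs ht, h2, neg_div, Complex.exp_neg,
      Complex.exp_neg]
    push_cast
    field_simp
  have hA : ((t ^ ((N + 1 / 2 : ℝ) - 1) * Real.exp (-t) : ℝ) : ℂ) =
      ((t ^ ((N : ℝ) - 1) * Real.exp (-(2 * t)) : ℝ) : ℂ) *
        ((Real.exp (Real.log t / 2) * Real.exp t : ℝ) : ℂ) := by
    rw [← Complex.ofReal_mul, Complex.ofReal_inj, Real.rpow_def_of_pos ht, Real.rpow_def_of_pos ht,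
      ← Real.exp_add, ← Real.exp_add, ← Real.exp_add, ← Real.exp_add]
    congr 1
    ring
  simp only [hpow]
  rw [remKDiff, hR, hA]
  have hsum : ∑ m ∈ Finset.range M, hankelCoeff m ν *
      (((t ^ ((N : ℝ) - 1) * Real.exp (-(2 * t)) : ℝ) : ℂ) / t ^ m) =
      ((t ^ ((N : ℝ) - 1) * Real.exp (-(2 * t)) : ℝ) : ℂ) *
        ∑ m ∈ Finset.range M, hankelCoeff m ν / (t : ℂ) ^ m := by
    rw [Finset.mul_sum]
    refine Finset.sum_congr rfl fun m _ => ?_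
    ring
  rw [hsum]
  field_simp
  ring

/-- What remains of the Stieltjes transform once the contribution of `R_M^{(K)}(|z|, ν)` is split
off. -/
noncomputable def remKDiffStieltjes (N M : ℕ) (ν : ℂ) (ξ : ℝ) (κ : ℝ → ℂ) : ℂ :=
  ∫ t in Set.Ioi (0 : ℝ), ((t ^ (((N : ℝ) - M) - 1) * Real.exp (-(2 * t)) : ℝ) : ℂ) *
    remKDiff M ν ξ t * κ t

/-- The difference need not be estimated here: by `stieltjes_density_eq` it is a combination of
integrable densities. -/
theorem integrableOn_remKDiff {N M : ℕ} (hMN : M < N) {ν : ℂ} (hν : |ν.re| < M + 1 / 2)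
    (hs : Complex.sin (Real.pi * ν) ≠ 0) (ξ : ℝ) :
    IntegrableOn (fun t : ℝ => ((t ^ (((N : ℝ) - M) - 1) * Real.exp (-(2 * t)) : ℝ) : ℂ) *
      remKDiff M ν ξ t) (Set.Ioi 0) := by
  have hMN' : (M : ℝ) < N := by exact_mod_cast hMN
  have hg : ∀ m : ℕ, m < N → IntegrableOn (fun t : ℝ =>
      ((t ^ (((N : ℝ) - m) - 1) * Real.exp (-(2 * t)) : ℝ) : ℂ)) (Set.Ioi 0) := fun m hm =>
    (integrableOn_rpow_mul_exp_neg (by have : (m : ℝ) < N := by exact_mod_cast hm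
                                       linarith) two_pos).ofReal
  have h1 := (integrableOn_rpow_mul_exp_mul_macdonald (ν := ν) (p := (N : ℝ) + 1 / 2)
    (by linarith)).const_mul (Real.sqrt (2 / Real.pi) : ℂ)
  have h2 : IntegrableOn (fun t : ℝ => ∑ m ∈ Finset.range M, hankelCoeff m ν *
      ((t ^ (((N : ℝ) - m) - 1) * Real.exp (-(2 * t)) : ℝ) : ℂ)) (Set.Ioi 0) :=
    integrable_finsetSum _ fun m hm =>
      (hg m ((Finset.mem_range.mp hm).trans hMN)).const_mul _
  have h3 := (hg M hMN).const_mul (Complex.exp ξ ^ M * remK M ξ ν)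
  refine ((h1.sub h2).sub h3).congr ?_
  filter_upwards [ae_restrict_mem measurableSet_Ioi] with t ht
  simp only [Pi.sub_apply]
  rw [stieltjes_density_eq (M := M) hs ξ ht]
  ring

/-- The re-expansion of `R_N^{(K)}` in terms of terminants. -/
theorem remK_eq_terminant_expansion {N M : ℕ} (hMN : M < N) {ν : ℂ} (hν : |ν.re| < M + 1 / 2)
    (hs : Complex.sin (Real.pi * ν) ≠ 0) {ζ : ℂ} (hζ : ζ ∈ cutStrip) :
    remK N ζ ν = (-1) ^ N / Complex.exp ζ ^ N * (Complex.cos (Real.pi * ν) / Real.pi *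
      ((∑ m ∈ Finset.range M, 2 ^ m / 2 ^ N * hankelCoeff m ν * Complex.Gamma ((N : ℂ) - m) *
        terminantL ((N : ℂ) - m) (ζ + Real.log 2)) +
      (2 ^ M / 2 ^ N * (Complex.exp ζ.re ^ M * remK M ζ.re ν) * Complex.Gamma ((N : ℂ) - M) *
        terminantL ((N : ℂ) - M) (ζ + Real.log 2) +
      remKDiffStieltjes N M ν ζ.re (stieltjesKernel ζ)))) := by
  have hMN' : (M : ℝ) < N := by exact_mod_cast hMN
  have hT : ∀ m : ℕ, m < N → IntegrableOn (fun t : ℝ =>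
      ((t ^ (((N : ℝ) - m) - 1) * Real.exp (-(2 * t)) : ℝ) : ℂ) * stieltjesKernel ζ t) (Set.Ioi 0) ∧
      ∫ t in Set.Ioi (0 : ℝ), ((t ^ (((N : ℝ) - m) - 1) * Real.exp (-(2 * t)) : ℝ) : ℂ) *
        stieltjesKernel ζ t = 2 ^ m / 2 ^ N * Complex.Gamma ((N : ℂ) - m) *
          terminantL ((N : ℂ) - m) (ζ + Real.log 2) := by
    intro m hm
    have hp : (0 : ℝ) < (N : ℝ) - m := by
      have : (m : ℝ) < N := by exact_mod_cast hm
      linarith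
    refine ⟨integrableOn_mul_stieltjesKernel (g := fun t : ℝ =>
      ((t ^ (((N : ℝ) - m) - 1) * Real.exp (-(2 * t)) : ℝ) : ℂ))
      (integrableOn_rpow_mul_exp_neg hp two_pos).ofReal hζ, ?_⟩
    rw [integral_rpow_mul_exp_neg_mul_stieltjesKernel hp two_pos hζ, Complex.ofReal_mul,
      ← Complex.Gamma_ofReal, Real.rpow_sub two_pos, Real.rpow_natCast, Real.rpow_natCast, inv_div]
    push_cast
    rfl
  have hD := integrableOn_mul_stieltjesKernel (integrableOn_remKDiff hMN hν hs ζ.re) hζ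
  -- the Stieltjes transform of the three parts of the density in `stieltjes_density_eq`
  have hS : Real.sqrt (2 / Real.pi) * besselStieltjes N ν ζ =
      (∑ m ∈ Finset.range M, 2 ^ m / 2 ^ N * hankelCoeff m ν * Complex.Gamma ((N : ℂ) - m) *
        terminantL ((N : ℂ) - m) (ζ + Real.log 2)) +
      (2 ^ M / 2 ^ N * (Complex.exp ζ.re ^ M * remK M ζ.re ν) * Complex.Gamma ((N : ℂ) - M) *
        terminantL ((N : ℂ) - M) (ζ + Real.log 2) +
      remKDiffStieltjes N M ν ζ.re (stieltjesKernel ζ)) := by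
    have h1 : ∀ t ∈ Set.Ioi (0 : ℝ), (Real.sqrt (2 / Real.pi) : ℂ) *
        (((t ^ ((N + 1 / 2 : ℝ) - 1) * Real.exp (-t) : ℝ) : ℂ) * macdonaldIntegral ν t *
          stieltjesKernel ζ t) =
        (∑ m ∈ Finset.range M, hankelCoeff m ν *
          (((t ^ (((N : ℝ) - m) - 1) * Real.exp (-(2 * t)) : ℝ) : ℂ) * stieltjesKernel ζ t)) +
        (Complex.exp ζ.re ^ M * remK M ζ.re ν *
          (((t ^ (((N : ℝ) - M) - 1) * Real.exp (-(2 * t)) : ℝ) : ℂ) * stieltjesKernel ζ t) +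
        ((t ^ (((N : ℝ) - M) - 1) * Real.exp (-(2 * t)) : ℝ) : ℂ) * remKDiff M ν ζ.re t *
          stieltjesKernel ζ t) := by
      intro t ht
      rw [← mul_assoc, stieltjes_density_eq (M := M) hs ζ.re ht, add_mul, add_mul, Finset.sum_mul]
      simp only [mul_assoc, add_assoc]
    rw [besselStieltjes, ← integral_const_mul, setIntegral_congr_fun measurableSet_Ioi h1,
      integral_add (integrable_finsetSum _ fun m hm =>
        ((hT m ((Finset.mem_range.mp hm).trans hMN)).1.const_mul _))
        (by exact ((hT M hMN).1.const_mul (Complex.exp ζ.re ^ M * remK M ζ.re ν)).add hD),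
      integral_add ((hT M hMN).1.const_mul _) hD,
      integral_finsetSum _ fun m hm =>
        ((hT m ((Finset.mem_range.mp hm).trans hMN)).1.const_mul _),
      integral_const_mul, (hT M hMN).2, remKDiffStieltjes]
    congr 1
    · refine Finset.sum_congr rfl fun m hm => ?_
      rw [integral_const_mul, (hT m ((Finset.mem_range.mp hm).trans hMN)).2]
      ring
    · ring
  rw [remK_eq_besselStieltjes N (by linarith) hs hζ, ← hS]
  ring

/-- The factor `|t - r| / r` from `norm_remKDiff_le` is compensated by the kernel `κ`; what is left is
a Gamma integral. -/
theorem norm_remKDiffStieltjes_le {N M : ℕ} (hMN : M < N) {ν : ℂ} (hν : |ν.re| < M + 1 / 2)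
    (hs : Complex.sin (Real.pi * ν) ≠ 0) (ξ : ℝ) {κ : ℝ → ℂ}
    (hκ : ∀ t, 0 < t → ‖κ t‖ * |t - Real.exp ξ| ≤ Real.exp ξ) :
    ‖remKDiffStieltjes N M ν ξ κ‖ ≤ 2 ^ M / 2 ^ N *
      (‖Complex.cos (Real.pi * ν)‖ * hankelQuotient M ν.re) * Real.Gamma ((N : ℝ) - M) := by
  have hp : (0 : ℝ) < (N : ℝ) - M := by
    have : (M : ℝ) < N := by exact_mod_cast hMN
    linarith
  have hQ := hankelQuotient_pos hν
  set A := ‖Complex.cos (Real.pi * ν)‖ * hankelQuotient M ν.re with hA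
  have hA0 : 0 ≤ A := by positivity
  have h1 : ‖remKDiffStieltjes N M ν ξ κ‖ ≤ ∫ t in Set.Ioi (0 : ℝ),
      t ^ (((N : ℝ) - M) - 1) * Real.exp (-(2 * t)) * A := by
    refine norm_integral_le_of_norm_le ((integrableOn_rpow_mul_exp_neg hp two_pos).mul_const A) ?_
    filter_upwards [ae_restrict_mem measurableSet_Ioi] with t ht
    have ht0 : 0 < t := ht
    rw [norm_mul, norm_mul, Complex.norm_real, Real.norm_of_nonneg (by positivity), mul_assoc]
    gcongr
    have hr := Real.exp_pos ξ
    calc ‖remKDiff M ν ξ t‖ * ‖κ t‖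
        ≤ |t - Real.exp ξ| / Real.exp ξ * A * ‖κ t‖ := by
          gcongr
          exact norm_remKDiff_le hν hs ξ ht0
      _ = (‖κ t‖ * |t - Real.exp ξ|) / Real.exp ξ * A := by ring
      _ ≤ 1 * A := by
          gcongr
          rw [div_le_one hr]
          exact hκ t ht0
      _ = A := one_mul A
  refine h1.trans (le_of_eq ?_)
  rw [integral_mul_const, Real.integral_rpow_mul_exp_neg_mul_Ioi hp two_pos, one_div,
    Real.inv_rpow two_pos.le, Real.rpow_sub two_pos, Real.rpow_natCast, Real.rpow_natCast, inv_div]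
  ring

/-! ### The bounds in the open sectors, for orders that are not integers -/

/-- The right-hand side of the error bounds, `T` being the value of the terminant. -/
noncomputable def reRemBound (N M : ℕ) (ζ ν T : ℂ) : ℝ :=
  ‖Complex.cos (Real.pi * ν)‖ / (2 ^ N * Real.pi) * (1 / ‖Complex.exp ζ‖ ^ N) * 2 ^ M *
      ‖Complex.exp ζ‖ ^ M * ‖remK M (ζ.re : ℂ) ν‖ * Real.Gamma ((N : ℝ) - M) * ‖T‖ +
    ‖Complex.cos (Real.pi * ν)‖ / (2 ^ N * Real.pi) * (1 / ‖Complex.exp ζ‖ ^ N) * 2 ^ M *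
      (‖Complex.cos (Real.pi * ν)‖ * hankelQuotient M ν.re) * Real.Gamma ((N : ℝ) - M)

/-- The error bound for both remainders at once: they have this form with `u = ±1`, `T` the terminant
and `κ` the kernel that belongs to it. -/
theorem norm_terminant_add_remKDiffStieltjes_le {N M : ℕ} (hMN : M < N) {ν : ℂ}
    (hν : |ν.re| < M + 1 / 2) (hs : Complex.sin (Real.pi * ν) ≠ 0) (ζ T : ℂ) {u : ℂ} (hu : ‖u‖ = 1)
    {κ : ℝ → ℂ} (hκ : ∀ t, 0 < t → ‖κ t‖ * |t - Real.exp ζ.re| ≤ Real.exp ζ.re) :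
    ‖u / Complex.exp ζ ^ N * (Complex.cos (Real.pi * ν) / Real.pi *
      (2 ^ M / 2 ^ N * (Complex.exp ζ.re ^ M * remK M ζ.re ν) * Complex.Gamma ((N : ℂ) - M) * T +
        remKDiffStieltjes N M ν ζ.re κ))‖ ≤ reRemBound N M ζ ν T := by
  have hp : (0 : ℝ) < (N : ℝ) - M := by
    have : (M : ℝ) < N := by exact_mod_cast hMN
    linarith
  have hG : Complex.Gamma ((N : ℂ) - M) = (Real.Gamma ((N : ℝ) - M) : ℂ) := by
    rw [← Complex.Gamma_ofReal]
    push_cast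
    rfl
  have hexp : ‖Complex.exp (ζ.re : ℂ)‖ = ‖Complex.exp ζ‖ := by
    rw [Complex.norm_exp, Complex.norm_exp, Complex.ofReal_re]
  have h := norm_add_le (2 ^ M / 2 ^ N * (Complex.exp ζ.re ^ M * remK M ζ.re ν) *
    Complex.Gamma ((N : ℂ) - M) * T) (remKDiffStieltjes N M ν ζ.re κ)
  have h2 := h.trans (add_le_add_right (norm_remKDiffStieltjes_le hMN hν hs ζ.re hκ) _)
  rw [norm_mul, norm_mul, norm_div, norm_div, hu, norm_pow, Complex.norm_real,
    Real.norm_of_nonneg Real.pi_pos.le]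
  refine (mul_le_mul_of_nonneg_left (mul_le_mul_of_nonneg_left h2
    (by positivity)) (by positivity)).trans (le_of_eq ?_)
  rw [reRemBound, hG]
  simp only [norm_mul, norm_div, norm_pow, hexp, Complex.norm_real, Complex.norm_ofNat,
    Real.norm_of_nonneg (Real.Gamma_pos_of_pos hp).le]
  ring

theorem reRemK_eq {N M : ℕ} (hMN : M < N) {ν : ℂ} (hν : |ν.re| < M + 1 / 2)
    (hs : Complex.sin (Real.pi * ν) ≠ 0) {ζ : ℂ} (hζ : ζ ∈ cutStrip) :
    reRemK N M ζ ν = (-1) ^ N / Complex.exp ζ ^ N * (Complex.cos (Real.pi * ν) / Real.pi *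
      (2 ^ M / 2 ^ N * (Complex.exp ζ.re ^ M * remK M ζ.re ν) * Complex.Gamma ((N : ℂ) - M) *
        terminantL ((N : ℂ) - M) (ζ + Real.log 2) +
      remKDiffStieltjes N M ν ζ.re (stieltjesKernel ζ))) := by
  have hsum : ∑ m ∈ Finset.range M, 2 ^ m / 2 ^ N * hankelCoeff m ν *
      Complex.Gamma ((N : ℂ) - m) * terminantL ((N : ℂ) - m) (ζ + Real.log 2) =
      (2 ^ N)⁻¹ * ∑ m ∈ Finset.range M, 2 ^ m * hankelCoeff m ν * Complex.Gamma ((N : ℂ) - m) *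
        terminantL ((N : ℂ) - m) (ζ + Real.log 2) := by
    rw [Finset.mul_sum]
    exact Finset.sum_congr rfl fun m _ => by ring
  rw [reRemK, remK_eq_terminant_expansion hMN hν hs hζ, hsum]
  have hpi : (Real.pi : ℂ) ≠ 0 := by exact_mod_cast Real.pi_ne_zero
  have := Complex.exp_ne_zero ζ
  field_simp
  ring

theorem norm_reRemK_le_of_mem_cutStrip {N M : ℕ} (hMN : M < N) {ν : ℂ} (hν : |ν.re| < M + 1 / 2)
    (hs : Complex.sin (Real.pi * ν) ≠ 0) {ζ : ℂ} (hζ : ζ ∈ cutStrip) :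
    ‖reRemK N M ζ ν‖ ≤
      reRemBound N M ζ ν (terminantL ((N : ℂ) - M) (ζ + Real.log 2)) := by
  rw [reRemK_eq hMN hν hs hζ]
  refine norm_terminant_add_remKDiffStieltjes_le hMN hν hs ζ _ (by simp) fun t ht => ?_
  have h0 : 0 < ‖Complex.exp ζ + t‖ := norm_pos_iff.mpr (exp_add_ne_zero hζ ht.le)
  -- `| t - |z| | ≤ |t + z|` cancels the growth of the difference of remainders
  have h1 : |t - Real.exp ζ.re| ≤ ‖Complex.exp ζ + t‖ := by
    have h := abs_norm_sub_norm_le (t : ℂ) (-Complex.exp ζ)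
    rwa [norm_neg, Complex.norm_exp, Complex.norm_real, Real.norm_of_nonneg ht.le, sub_neg_eq_add,
      add_comm (t : ℂ)] at h
  rw [stieltjesKernel, norm_div, Complex.norm_exp, div_mul_eq_mul_div, div_le_iff₀ h0]
  gcongr

/-- The mean of the two Stieltjes kernels at `z e^(±πi/2)`; it equals `z² / (z² + t²)`. -/
noncomputable def meanKernel (ζ : ℂ) (t : ℝ) : ℂ :=
  (stieltjesKernel (ζ + Real.pi / 2 * Complex.I) t +
    stieltjesKernel (ζ - Real.pi / 2 * Complex.I) t) / 2

theorem exp_add_pi_div_two_mul_I (ζ : ℂ) :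
    Complex.exp (ζ + Real.pi / 2 * Complex.I) = Complex.I * Complex.exp ζ := by
  rw [Complex.exp_add, Complex.exp_pi_div_two_mul_I, mul_comm]

theorem exp_sub_pi_div_two_mul_I (ζ : ℂ) :
    Complex.exp (ζ - Real.pi / 2 * Complex.I) = -Complex.I * Complex.exp ζ := by
  rw [sub_eq_add_neg, Complex.exp_add, ← neg_mul, ← neg_div, Complex.exp_neg_pi_div_two_mul_I,
    mul_comm]

theorem add_sub_pi_div_two_mem_cutStrip {ζ : ℂ} (hζ : |ζ.im| < Real.pi / 2) :
    ζ + Real.pi / 2 * Complex.I ∈ cutStrip ∧ ζ - Real.pi / 2 * Complex.I ∈ cutStrip := by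
  have h := abs_lt.mp hζ
  have h1 : ((Real.pi : ℂ) / 2 * Complex.I).im = Real.pi / 2 := by simp
  constructor
  · show |(ζ + Real.pi / 2 * Complex.I).im| < Real.pi
    rw [Complex.add_im, h1, abs_lt]
    constructor <;> linarith [Real.pi_pos]
  · show |(ζ - Real.pi / 2 * Complex.I).im| < Real.pi
    rw [Complex.sub_im, h1, abs_lt]
    constructor <;> linarith [Real.pi_pos]

/-- This is `|t - r| r ≤ |t - r| (t + r) = |t² - r²| ≤ |t² + z²|` with `r = |z|`. -/
theorem norm_meanKernel_mul_le {ζ : ℂ} (hζ : |ζ.im| < Real.pi / 2) {t : ℝ} (ht : 0 < t) :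
    ‖meanKernel ζ t‖ * |t - Real.exp ζ.re| ≤ Real.exp ζ.re := by
  obtain ⟨hp, hm⟩ := add_sub_pi_div_two_mem_cutStrip hζ
  have h1 := exp_add_ne_zero hp ht.le
  have h2 := exp_add_ne_zero hm ht.le
  rw [exp_add_pi_div_two_mul_I] at h1
  rw [exp_sub_pi_div_two_mul_I] at h2
  set z := Complex.exp ζ with hz
  have hprod : (Complex.I * z + t) * (-Complex.I * z + t) = z ^ 2 + (t : ℂ) ^ 2 := by
    linear_combination (-z ^ 2) * Complex.I_sq
  have h3 : z ^ 2 + (t : ℂ) ^ 2 ≠ 0 := hprod ▸ mul_ne_zero h1 h2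
  have h4 : meanKernel ζ t = z ^ 2 / (z ^ 2 + (t : ℂ) ^ 2) := by
    rw [meanKernel, stieltjesKernel, stieltjesKernel, exp_add_pi_div_two_mul_I,
      exp_sub_pi_div_two_mul_I, div_add_div _ _ h1 h2, hprod, div_div, div_eq_div_iff
      (mul_ne_zero h3 two_ne_zero) h3]
    linear_combination (-(z ^ 2) * 2 * (z ^ 2 + (t : ℂ) ^ 2)) * Complex.I_sq
  have hr := Real.exp_pos ζ.re
  have h5 : |t - Real.exp ζ.re| * (t + Real.exp ζ.re) ≤ ‖z ^ 2 + (t : ℂ) ^ 2‖ := by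
    have h := abs_norm_sub_norm_le ((t : ℂ) ^ 2) (-z ^ 2)
    rw [norm_neg, sub_neg_eq_add, add_comm ((t : ℂ) ^ 2), norm_pow, norm_pow, Complex.norm_real,
      Real.norm_of_nonneg ht.le, hz, Complex.norm_exp, ← hz, sq_sub_sq, abs_mul,
      abs_of_pos (by positivity : 0 < t + Real.exp ζ.re)] at h
    rwa [mul_comm]
  rw [h4, norm_div, norm_pow, hz, Complex.norm_exp, ← hz, div_mul_eq_mul_div,
    div_le_iff₀ (norm_pos_iff.mpr h3)]
  have h6 : |t - Real.exp ζ.re| * Real.exp ζ.re ≤ ‖z ^ 2 + (t : ℂ) ^ 2‖ := by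
    refine le_trans ?_ h5
    gcongr
    linarith
  nlinarith

theorem remKDiffStieltjes_meanKernel {N M : ℕ} (hMN : M < N) {ν : ℂ} (hν : |ν.re| < M + 1 / 2)
    (hs : Complex.sin (Real.pi * ν) ≠ 0) (ξ : ℝ) {ζ : ℂ} (hζ : |ζ.im| < Real.pi / 2) :
    remKDiffStieltjes N M ν ξ (meanKernel ζ) =
      (remKDiffStieltjes N M ν ξ (stieltjesKernel (ζ + Real.pi / 2 * Complex.I)) +
        remKDiffStieltjes N M ν ξ (stieltjesKernel (ζ - Real.pi / 2 * Complex.I))) / 2 := by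
  obtain ⟨hp, hm⟩ := add_sub_pi_div_two_mem_cutStrip hζ
  have hi := integrableOn_remKDiff hMN hν hs ξ
  rw [remKDiffStieltjes, remKDiffStieltjes, remKDiffStieltjes,
    ← integral_add (integrableOn_mul_stieltjesKernel hi hp) (integrableOn_mul_stieltjesKernel hi hm),
    ← integral_div]
  congr 1
  funext t
  rw [meanKernel]
  ring

/-- The mean of the expansions at `z e^(±πi/2)`. The factors `(±i z)^(-N)` combine with the definition
of `R_N^{(J)}`, for either parity of `N`, into the sign `(-1)^⌊N/2⌋`. -/
theorem remJ_eq_terminant_expansion {N M : ℕ} (hMN : M < N) {ν : ℂ} (hν : |ν.re| < M + 1 / 2)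
    (hs : Complex.sin (Real.pi * ν) ≠ 0) {ζ : ℂ} (hζ : |ζ.im| < Real.pi / 2) :
    remJ N ζ ν = (-1) ^ (N / 2) / Complex.exp ζ ^ N * (Complex.cos (Real.pi * ν) / Real.pi *
      ((∑ m ∈ Finset.range M, 2 ^ m / 2 ^ N * hankelCoeff m ν * Complex.Gamma ((N : ℂ) - m) *
        terminantP ((N : ℂ) - m) (ζ + Real.log 2)) +
      (2 ^ M / 2 ^ N * (Complex.exp ζ.re ^ M * remK M ζ.re ν) * Complex.Gamma ((N : ℂ) - M) *
        terminantP ((N : ℂ) - M) (ζ + Real.log 2) +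
      remKDiffStieltjes N M ν ζ.re (meanKernel ζ)))) := by
  obtain ⟨hp, hm⟩ := add_sub_pi_div_two_mem_cutStrip hζ
  have ep := remK_eq_terminant_expansion hMN hν hs hp
  have em := remK_eq_terminant_expansion hMN hν hs hm
  have rp : (ζ + Real.pi / 2 * Complex.I).re = ζ.re := by simp
  have rm : (ζ - Real.pi / 2 * Complex.I).re = ζ.re := by simp
  rw [rp, exp_add_pi_div_two_mul_I, add_right_comm] at ep
  rw [rm, exp_sub_pi_div_two_mul_I, sub_add_eq_add_sub] at em
  rw [remKDiffStieltjes_meanKernel hMN hν hs _ hζ]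
  have hsum : ∑ m ∈ Finset.range M, 2 ^ m / 2 ^ N * hankelCoeff m ν *
      Complex.Gamma ((N : ℂ) - m) * terminantP ((N : ℂ) - m) (ζ + Real.log 2) =
      ((∑ m ∈ Finset.range M, 2 ^ m / 2 ^ N * hankelCoeff m ν * Complex.Gamma ((N : ℂ) - m) *
        terminantL ((N : ℂ) - m) (ζ + Real.log 2 + Real.pi / 2 * Complex.I)) +
      ∑ m ∈ Finset.range M, 2 ^ m / 2 ^ N * hankelCoeff m ν * Complex.Gamma ((N : ℂ) - m) *
        terminantL ((N : ℂ) - m) (ζ + Real.log 2 - Real.pi / 2 * Complex.I)) / 2 := by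
    rw [← Finset.sum_add_distrib, Finset.sum_div]
    refine Finset.sum_congr rfl fun m _ => ?_
    rw [terminantP]
    ring
  rw [hsum, terminantP]
  have hz := Complex.exp_ne_zero ζ
  have hI := Complex.I_ne_zero
  have h1 : ∀ k : ℕ, ((-1 : ℂ) ^ k)⁻¹ = (-1) ^ k := fun k => by
    rw [← inv_pow]
    norm_num
  rcases Nat.even_or_odd' N with ⟨k, hk | hk⟩
  · have hN : N / 2 = k := by omega
    have hpow : (-1 : ℂ) ^ N = 1 ∧ (Complex.I * Complex.exp ζ) ^ N = ((-1) ^ k)⁻¹ * Complex.exp ζ ^ N ∧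
        (-Complex.I * Complex.exp ζ) ^ N = ((-1) ^ k)⁻¹ * Complex.exp ζ ^ N := by
      refine ⟨by rw [hk, pow_mul]; simp, ?_, ?_⟩ <;>
        rw [h1, mul_pow, hk, pow_mul] <;> simp
    rw [hpow.1, hpow.2.1] at ep
    rw [hpow.1, hpow.2.2] at em
    rw [remJ, if_pos (by rw [hk]; simp), ep, em, hN]
    have hk0 : ((-1 : ℂ) ^ k) ≠ 0 := by simp
    generalize (-1 : ℂ) ^ k = ε at hk0 ⊢
    field_simp
    ring
  · have hN : N / 2 = k := by omega
    have hpow : (-1 : ℂ) ^ N = -1 ∧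
        (Complex.I * Complex.exp ζ) ^ N = ((-1) ^ k)⁻¹ * Complex.I * Complex.exp ζ ^ N ∧
        (-Complex.I * Complex.exp ζ) ^ N = -(((-1) ^ k)⁻¹ * Complex.I) * Complex.exp ζ ^ N := by
      refine ⟨by rw [hk, pow_succ, pow_mul]; simp, ?_, ?_⟩ <;>
        rw [h1, mul_pow, hk, pow_succ _ (2 * k), pow_mul] <;> simp
    rw [hpow.1, hpow.2.1] at ep
    rw [hpow.1, hpow.2.2] at em
    rw [remJ, if_neg (by rw [hk]; simp), ep, em, hN]
    have hk0 : ((-1 : ℂ) ^ k) ≠ 0 := by simp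
    generalize (-1 : ℂ) ^ k = ε at hk0 ⊢
    field_simp
    rw [Complex.I_sq]
    ring

theorem reRemJ_eq {N M : ℕ} (hMN : M < N) {ν : ℂ} (hν : |ν.re| < M + 1 / 2)
    (hs : Complex.sin (Real.pi * ν) ≠ 0) {ζ : ℂ} (hζ : |ζ.im| < Real.pi / 2) :
    reRemJ N M ζ ν = (-1) ^ (N / 2) / Complex.exp ζ ^ N * (Complex.cos (Real.pi * ν) / Real.pi *
      (2 ^ M / 2 ^ N * (Complex.exp ζ.re ^ M * remK M ζ.re ν) * Complex.Gamma ((N : ℂ) - M) *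
        terminantP ((N : ℂ) - M) (ζ + Real.log 2) +
      remKDiffStieltjes N M ν ζ.re (meanKernel ζ))) := by
  have hsum : ∑ m ∈ Finset.range M, 2 ^ m / 2 ^ N * hankelCoeff m ν *
      Complex.Gamma ((N : ℂ) - m) * terminantP ((N : ℂ) - m) (ζ + Real.log 2) =
      (2 ^ N)⁻¹ * ∑ m ∈ Finset.range M, 2 ^ m * hankelCoeff m ν * Complex.Gamma ((N : ℂ) - m) *
        terminantP ((N : ℂ) - m) (ζ + Real.log 2) := by
    rw [Finset.mul_sum]
    exact Finset.sum_congr rfl fun m _ => by ring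
  rw [reRemJ, remJ_eq_terminant_expansion hMN hν hs hζ, hsum]
  have hpi : (Real.pi : ℂ) ≠ 0 := by exact_mod_cast Real.pi_ne_zero
  have := Complex.exp_ne_zero ζ
  field_simp
  ring

theorem norm_reRemJ_le_of_abs_im_lt {N M : ℕ} (hMN : M < N) {ν : ℂ} (hν : |ν.re| < M + 1 / 2)
    (hs : Complex.sin (Real.pi * ν) ≠ 0) {ζ : ℂ} (hζ : |ζ.im| < Real.pi / 2) :
    ‖reRemJ N M ζ ν‖ ≤
      reRemBound N M ζ ν (terminantP ((N : ℂ) - M) (ζ + Real.log 2)) := by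
  rw [reRemJ_eq hMN hν hs hζ]
  exact norm_terminant_add_remKDiffStieltjes_le hMN hν hs ζ _ (by simp)
    fun t ht => norm_meanKernel_mul_le hζ ht

/-! ### The boundary of the sectors -/

/-- An inequality between continuous functions extends from the open strip to the closed one. -/
theorem le_of_abs_im_le {f g : ℂ → ℝ} (hf : Continuous f) (hg : Continuous g) {a : ℝ} (ha : 0 < a)
    (h : ∀ ζ : ℂ, |ζ.im| < a → f ζ ≤ g ζ) {ζ : ℂ} (hζ : |ζ.im| ≤ a) : f ζ ≤ g ζ := by
  have h1 : closure (Complex.im ⁻¹' Set.Ioo (-a) a) = Complex.im ⁻¹' Set.Icc (-a) a := by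
    rw [Complex.closure_preimage_im, closure_Ioo (by linarith)]
  exact le_on_closure (s := Complex.im ⁻¹' Set.Ioo (-a) a) (fun w hw => h w (abs_lt.mpr hw))
    hf.continuousOn hg.continuousOn (h1 ▸ (abs_le.mp hζ : ζ ∈ Complex.im ⁻¹' Set.Icc (-a) a))

theorem continuous_remK (N : ℕ) {ν : ℂ} (hs : Complex.sin (Real.pi * ν) ≠ 0) :
    Continuous fun ζ => remK N ζ ν := by
  have h1 := (differentiable_modBesselI_arg ν).continuous
  have h2 := (differentiable_modBesselI_arg (-ν)).continuous
  have h3 : (Real.sqrt (Real.pi / 2) : ℂ) ≠ 0 := by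
    exact_mod_cast (Real.sqrt_pos.mpr (by positivity)).ne'
  unfold remK
  simp only [modBesselK_eq_of_sin_ne_zero hs]
  refine Continuous.sub (Continuous.div (by fun_prop) (by fun_prop) fun ζ => ?_)
    (continuous_finsetSum _ fun n _ => Continuous.div (by fun_prop) (by fun_prop) fun ζ =>
      pow_ne_zero _ (Complex.exp_ne_zero _))
  exact mul_ne_zero (mul_ne_zero h3 (Complex.exp_ne_zero _)) (Complex.exp_ne_zero _)

theorem continuous_terminantP (p : ℂ) : Continuous (terminantP p) := by
  have := (differentiable_terminantL p).continuous
  unfold terminantP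
  fun_prop

theorem continuous_inv_exp_pow (N : ℕ) : Continuous fun ζ : ℂ => 1 / Complex.exp ζ ^ N :=
  continuous_const.div (by fun_prop) fun _ => pow_ne_zero _ (Complex.exp_ne_zero _)

theorem continuous_reRemK (N M : ℕ) {ν : ℂ} (hs : Complex.sin (Real.pi * ν) ≠ 0) :
    Continuous fun ζ => reRemK N M ζ ν := by
  have h1 := continuous_remK N hs
  have h2 : ∀ p, Continuous (terminantL p) := fun p => (differentiable_terminantL p).continuous
  have h3 := continuous_inv_exp_pow N
  unfold reRemK
  fun_prop

theorem continuous_reRemJ (N M : ℕ) {ν : ℂ} (hs : Complex.sin (Real.pi * ν) ≠ 0) :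
    Continuous fun ζ => reRemJ N M ζ ν := by
  have h1 := continuous_remK N hs
  have h2 := continuous_terminantP
  have h3 := continuous_inv_exp_pow N
  have h4 : Continuous fun ζ => remJ N ζ ν := by
    unfold remJ
    split_ifs <;> fun_prop
  unfold reRemJ
  fun_prop

theorem continuous_reRemBound (N M : ℕ) {ν : ℂ} (hs : Complex.sin (Real.pi * ν) ≠ 0) {T : ℂ → ℂ}
    (hT : Continuous T) : Continuous fun ζ => reRemBound N M ζ ν (T ζ) := by
  have h1 := continuous_remK M hs
  have h2 : Continuous fun ζ : ℂ => remK M (ζ.re : ℂ) ν :=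
    h1.comp (Complex.continuous_ofReal.comp Complex.continuous_re)
  have h3 : Continuous fun ζ : ℂ => 1 / ‖Complex.exp ζ‖ ^ N :=
    continuous_const.div (by fun_prop) fun _ =>
      pow_ne_zero _ (norm_ne_zero_iff.mpr (Complex.exp_ne_zero _))
  unfold reRemBound
  fun_prop

theorem norm_reRemK_le_of_sin_ne_zero {N M : ℕ} (hMN : M < N) {ν : ℂ} (hν : |ν.re| < M + 1 / 2)
    (hs : Complex.sin (Real.pi * ν) ≠ 0) {ζ : ℂ} (hζ : |ζ.im| ≤ Real.pi) :
    ‖reRemK N M ζ ν‖ ≤ reRemBound N M ζ ν (terminantL ((N : ℂ) - M) (ζ + Real.log 2)) := by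
  have h1 := (differentiable_terminantL ((N : ℂ) - M)).continuous
  exact le_of_abs_im_le (continuous_reRemK N M hs).norm
    (continuous_reRemBound N M hs (T := fun ζ => terminantL ((N : ℂ) - M) (ζ + Real.log 2))
      (by fun_prop)) Real.pi_pos
    (fun w hw => norm_reRemK_le_of_mem_cutStrip hMN hν hs hw) hζ

theorem norm_reRemJ_le_of_sin_ne_zero {N M : ℕ} (hMN : M < N) {ν : ℂ} (hν : |ν.re| < M + 1 / 2)
    (hs : Complex.sin (Real.pi * ν) ≠ 0) {ζ : ℂ} (hζ : |ζ.im| ≤ Real.pi / 2) :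
    ‖reRemJ N M ζ ν‖ ≤ reRemBound N M ζ ν (terminantP ((N : ℂ) - M) (ζ + Real.log 2)) := by
  have h1 := continuous_terminantP ((N : ℂ) - M)
  exact le_of_abs_im_le (continuous_reRemJ N M hs).norm
    (continuous_reRemBound N M hs (T := fun ζ => terminantP ((N : ℂ) - M) (ζ + Real.log 2))
      (by fun_prop)) Real.pi_div_two_pos
    (fun w hw => norm_reRemJ_le_of_abs_im_lt hMN hν hs hw) hζ

/-! ### Integer orders -/

theorem eventually_sin_pi_mul_ne_zero (ν : ℂ) :
    ∀ᶠ μ in 𝓝[≠] ν, Complex.sin (Real.pi * μ) ≠ 0 := by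
  by_cases hs : Complex.sin (Real.pi * ν) = 0
  · have hd : HasDerivAt (fun μ : ℂ => Complex.sin (Real.pi * μ))
        (Complex.cos (Real.pi * ν) * Real.pi) ν := by
      have h1 : HasDerivAt (fun μ : ℂ => (Real.pi : ℂ) * μ) (Real.pi : ℂ) ν := by
        simpa using (hasDerivAt_id ν).const_mul (Real.pi : ℂ)
      exact h1.csin
    refine hd.eventually_ne (mul_ne_zero (fun hc => ?_) (by exact_mod_cast Real.pi_ne_zero))
    have := Complex.sin_sq_add_cos_sq (Real.pi * ν)
    rw [hs, hc] at this
    norm_num at this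
  · have : ContinuousAt (fun μ : ℂ => Complex.sin (Real.pi * μ)) ν := by fun_prop
    exact (this.eventually_ne hs).filter_mono nhdsWithin_le_nhds

theorem continuous_hankelCoeff (n : ℕ) : Continuous (hankelCoeff n) := by
  unfold hankelCoeff
  fun_prop

/-- The remainder is continuous in the order, also at the integers, where `K_ν` is defined as a
limit. -/
theorem tendsto_remK (N : ℕ) (ζ ν : ℂ) :
    Tendsto (fun μ => remK N ζ μ) (𝓝[≠] ν) (𝓝 (remK N ζ ν)) := by
  have h1 : Tendsto (fun μ => modBesselK μ ζ) (𝓝[≠] ν) (𝓝 (modBesselK ν ζ)) := by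
    refine (tendsto_modBesselK ν ζ).congr' ?_
    filter_upwards [eventually_sin_pi_mul_ne_zero ν] with μ hμ
    exact (modBesselK_eq_of_sin_ne_zero hμ ζ).symm
  have h2 : Continuous fun μ => ∑ n ∈ Finset.range N, hankelCoeff n μ / Complex.exp ζ ^ n :=
    continuous_finsetSum _ fun n _ => (continuous_hankelCoeff n).div_const _
  exact (h1.div_const _).sub ((h2.tendsto ν).mono_left nhdsWithin_le_nhds)

theorem tendsto_remJ (N : ℕ) (ζ ν : ℂ) :
    Tendsto (fun μ => remJ N ζ μ) (𝓝[≠] ν) (𝓝 (remJ N ζ ν)) := by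
  have h1 := tendsto_remK N (ζ + Real.pi / 2 * Complex.I) ν
  have h2 := tendsto_remK N (ζ - Real.pi / 2 * Complex.I) ν
  unfold remJ
  split_ifs
  · exact (h1.add h2).div_const _
  · exact (h1.sub h2).div_const _

theorem tendsto_reRemK (N M : ℕ) (ζ ν : ℂ) :
    Tendsto (fun μ => reRemK N M ζ μ) (𝓝[≠] ν) (𝓝 (reRemK N M ζ ν)) := by
  have h := continuous_hankelCoeff
  refine (tendsto_remK N ζ ν).sub (Tendsto.mono_left (Continuous.tendsto ?_ ν) nhdsWithin_le_nhds)
  fun_prop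

theorem tendsto_reRemJ (N M : ℕ) (ζ ν : ℂ) :
    Tendsto (fun μ => reRemJ N M ζ μ) (𝓝[≠] ν) (𝓝 (reRemJ N M ζ ν)) := by
  have h := continuous_hankelCoeff
  refine (tendsto_remJ N ζ ν).sub (Tendsto.mono_left (Continuous.tendsto ?_ ν) nhdsWithin_le_nhds)
  fun_prop

theorem tendsto_reRemBound (N : ℕ) {M : ℕ} {ν : ℂ} (hν : |ν.re| < M + 1 / 2) (ζ T : ℂ) :
    Tendsto (fun μ => reRemBound N M ζ μ T) (𝓝[≠] ν) (𝓝 (reRemBound N M ζ ν T)) := by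
  have h1 : Tendsto (fun μ : ℂ => ‖Complex.cos (Real.pi * μ)‖) (𝓝[≠] ν)
      (𝓝 ‖Complex.cos (Real.pi * ν)‖) :=
    Tendsto.mono_left (Continuous.tendsto (by fun_prop) ν) nhdsWithin_le_nhds
  have h2 := (tendsto_remK M ζ.re ν).norm
  have h3 : Tendsto (fun μ : ℂ => hankelQuotient M μ.re) (𝓝[≠] ν) (𝓝 (hankelQuotient M ν.re)) :=
    ((continuousAt_hankelQuotient hν).tendsto.comp (Complex.continuous_re.tendsto ν)).mono_left
      nhdsWithin_le_nhds
  have h4 := (((h1.div_const (2 ^ N * Real.pi)).mul_const (1 / ‖Complex.exp ζ‖ ^ N)).mul_const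
    (2 ^ M))
  exact ((((h4.mul_const _).mul h2).mul_const _).mul_const _).add
    ((h4.mul (h1.mul h3)).mul_const _)

theorem eventually_order {M : ℕ} {ν : ℂ} (hν : |ν.re| < M + 1 / 2) :
    ∀ᶠ μ : ℂ in 𝓝[≠] ν, |μ.re| < M + 1 / 2 ∧ Complex.sin (Real.pi * μ) ≠ 0 :=
  (Eventually.filter_mono nhdsWithin_le_nhds
    ((isOpen_abs_re_lt ((M : ℝ) + 1 / 2)).mem_nhds hν)).and (eventually_sin_pi_mul_ne_zero ν)

theorem norm_reRemK_le {N M : ℕ} (hMN : M < N) {ν : ℂ} (hν : |ν.re| < M + 1 / 2) {ζ : ℂ}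
    (hζ : |ζ.im| ≤ Real.pi) :
    ‖reRemK N M ζ ν‖ ≤ reRemBound N M ζ ν (terminantL ((N : ℂ) - M) (ζ + Real.log 2)) := by
  refine le_of_tendsto_of_tendsto (tendsto_reRemK N M ζ ν).norm (tendsto_reRemBound N hν ζ _) ?_
  filter_upwards [eventually_order hν] with μ hμ
  exact norm_reRemK_le_of_sin_ne_zero hMN hμ.1 hμ.2 hζ

theorem norm_reRemJ_le {N M : ℕ} (hMN : M < N) {ν : ℂ} (hν : |ν.re| < M + 1 / 2) {ζ : ℂ}
    (hζ : |ζ.im| ≤ Real.pi / 2) :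
    ‖reRemJ N M ζ ν‖ ≤ reRemBound N M ζ ν (terminantP ((N : ℂ) - M) (ζ + Real.log 2)) := by
  refine le_of_tendsto_of_tendsto (tendsto_reRemJ N M ζ ν).norm (tendsto_reRemBound N hν ζ _) ?_
  filter_upwards [eventually_order hν] with μ hμ
  exact norm_reRemJ_le_of_sin_ne_zero hMN hμ.1 hμ.2 hζ

theorem theorem10 (N M : ℕ) (hMN : M < N) (ν : ℂ) (hν : |ν.re| < (M : ℝ) + 1 / 2) :
    ∃ C : ℝ,
      -- `C` is the quotient `|a_M(Re ν)| / |cos (π Re ν)|`, or its limiting value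
      Tendsto (fun x : ℝ => ‖hankelCoeff M (x : ℂ)‖ / |Real.cos (Real.pi * x)|)
          (𝓝[≠] ν.re) (𝓝 C) ∧
      (Real.cos (Real.pi * ν.re) ≠ 0 →
        C = ‖hankelCoeff M (ν.re : ℂ)‖ / |Real.cos (Real.pi * ν.re)|) ∧
      (∀ ζ : ℂ, |ζ.im| ≤ Real.pi →
        ‖reRemK N M ζ ν‖ ≤
          ‖Complex.cos (Real.pi * ν)‖ / (2 ^ N * Real.pi) * (1 / ‖Complex.exp ζ‖ ^ N) * 2 ^ M *
              ‖Complex.exp ζ‖ ^ M * ‖remK M (ζ.re : ℂ) ν‖ * Real.Gamma ((N : ℝ) - M) *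
              ‖terminantL ((N : ℂ) - M) (ζ + Real.log 2)‖ +
            ‖Complex.cos (Real.pi * ν)‖ / (2 ^ N * Real.pi) * (1 / ‖Complex.exp ζ‖ ^ N) * 2 ^ M *
              (‖Complex.cos (Real.pi * ν)‖ * C) * Real.Gamma ((N : ℝ) - M)) ∧
      (∀ ζ : ℂ, |ζ.im| ≤ Real.pi / 2 →
        ‖reRemJ N M ζ ν‖ ≤
          ‖Complex.cos (Real.pi * ν)‖ / (2 ^ N * Real.pi) * (1 / ‖Complex.exp ζ‖ ^ N) * 2 ^ M *
              ‖Complex.exp ζ‖ ^ M * ‖remK M (ζ.re : ℂ) ν‖ * Real.Gamma ((N : ℝ) - M) *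
              ‖terminantP ((N : ℂ) - M) (ζ + Real.log 2)‖ +
            ‖Complex.cos (Real.pi * ν)‖ / (2 ^ N * Real.pi) * (1 / ‖Complex.exp ζ‖ ^ N) * 2 ^ M *
              (‖Complex.cos (Real.pi * ν)‖ * C) * Real.Gamma ((N : ℝ) - M)) := by

  exact ⟨hankelQuotient M ν.re, tendsto_norm_hankelCoeff_div_abs_cos hν,
    fun hc => (norm_hankelCoeff_div_abs_cos hν hc).symm,
    fun ζ hζ => norm_reRemK_le hMN hν hζ, fun ζ hζ => norm_reRemJ_le hMN hν hζ⟩
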